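/- Setting. Let $\Omega\subset\mathbb R^2$ be a bounded open set, $\Omega_1$ an open set with $\overline{\Omega}_1\subset\Omega$ and Lipschitz boundary, $\Omega_2=\Omega\setminus\overline\Omega_1$, and suppose that the interface $\Gamma=\partial\Omega_1\cap\partial\Omega_2$ is piecewise $C^2$ (a finite union of simple regular arcs, $C^2$ up to their end points, which meet at end points only). A point of $\Gamma$ is singular if $\Gamma$ is not $C^2$-smooth near it. Fix $\delta_0\in(0,1/2)$ and $\sigma>0$. Interface elements. Let $K\subset\Omega$ be an open rectangle with sides parallel to the axes, with diameter $h_K$ and ratio of side lengths at most $\sigma$, such that $\Gamma\cap\overline K$ is a simple arc that runs through $K$ and joins a point $B$ of one open side to a point $B'$ of a different open side, and such that $\Gamma_K=\Gamma\cap K$ contains at most one singular point $Q_K$. Put $K_i=K\cap\Omega_i$, $i=1,2$. (A vertex or a part of a side of $K$ that lies on $\partial\Omega$ is counted as belonging to the adjacent subdomain $\Omega_2$.) $K$ is irregular with respect to $\Omega_i$ if it has exactly one vertex in $\Omega_i$ and contains a singular point, and regular otherwise. $K$ is large with respect to $\Omega_i$ if $|e\cap\Omega_i|\ge\delta_0|e|$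 for each side $e$ of $K$ that meets $\Omega_i$ and, in the irregular case, $\mathrm{dist}(Q_K,e)\ge\frac12\delta_0\min(|e_1|,|e_2|)$ for each of the two sides $e=e_1,e_2$ of $K$ that meet at the vertex in $\Omega_i$. Interface deviation. For a sub-arc $\gamma$ of $\Gamma_K$ with end points $P,P'$ put $$\eta^i(\gamma)=\frac{\sup_{x\in\gamma}\mathrm{dist}(x,PP')}{\max_A\mathrm{dist}(A,\ell_{PP'})},$$ where $PP'$ is the segment, $\ell_{PP'}$ the straight line through $P,P'$, and $A$ runs over the vertices of $K$ in $\Omega_i$. Let $\eta_K^i=\eta^i(\Gamma_K)$ if $K$ is regular with respect to $\Omega_i$, and $\eta_K^i=\max(\eta^i(\Gamma_{1K}),\eta^i(\Gamma_{2K}))$ if it is irregular, where $\Gamma_{1K},\Gamma_{2K}$ are the two parts into which $Q_K$ divides $\Gamma_K$. Let $\eta_K=\max(\eta_K^1,\eta_K^2)$. Claim. There is a constant $C>0$, which depends only on $\Omega,\Omega_1,\delta_0,\sigma$ (and not on $K$, $h_K$, $p$ or $\eta_K$), such that for every $K$ as above which is large with respect to both $\Omega_1$ and $\Omega_2$ and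 satisfies $\eta_K\le\max\left(\frac12,\frac{1-\delta_0}{1+\delta_0}\right)$, for $i=1,2$, every integer $p\ge1$ and every polynomial $v\in Q_p(K)$ (degree at most $p$ in each variable), $$\|v\|_{L^2(\partial K_i)}\le C\,p\,h_K^{-1/2}\,\mathsf T\left(\frac{1+3\eta_K}{1-\eta_K}\right)^{2p}\|v\|_{L^2(K_i)},\qquad \mathsf T(t)=t+\sqrt{t^2-1}.$$ -/

import Mathlib

open Set MeasureTheory
open scoped Topology ENNReal NNReal

noncomputable section

namespace CutFEM

/-- The Euclidean plane. -/
abbrev Plane : Type := EuclideanSpace ℝ (Fin 2)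

/-! ### The interface -/

/-- `D` has a Lipschitz boundary: near each boundary point, in suitable Cartesian coordinates,
`D` is the set of the points below the graph of a Lipschitz function. -/
def HasLipschitzBoundary (D : Set Plane) : Prop :=
  ∀ x ∈ frontier D, ∃ (e : Plane ≃ᵃⁱ[ℝ] Plane) (φ : ℝ → ℝ) (L : ℝ≥0), LipschitzWith L φ ∧
    ∀ᶠ y in 𝓝 x, (y ∈ D ↔ (e y) 1 < φ ((e y) 0))

/-- `S` is the union of finitely many simple regular arcs, each of class `C²` up to its end
points, two of which meet at end points only. -/
def IsPiecewiseC2Curve (S : Set Plane) : Prop :=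
  ∃ (n : ℕ) (c : Fin n → ℝ → Plane),
    (∀ k, ContDiffOn ℝ 2 (c k) (Icc 0 1) ∧ InjOn (c k) (Icc 0 1) ∧
      ∀ t ∈ Icc (0 : ℝ) 1, derivWithin (c k) (Icc 0 1) t ≠ 0) ∧
    (∀ k l, k ≠ l → ∀ s ∈ Icc (0 : ℝ) 1, ∀ t ∈ Icc (0 : ℝ) 1, c k s = c l t →
      (s = 0 ∨ s = 1) ∧ (t = 0 ∨ t = 1)) ∧
    S = ⋃ k, c k '' Icc 0 1

/-- Near `x` the set `S` is a `C²`-smooth curve (a regular level set of a `C²` function). -/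
def IsC2SmoothAt (S : Set Plane) (x : Plane) : Prop :=
  ∃ g : Plane → ℝ, ContDiffAt ℝ 2 g x ∧ fderiv ℝ g x ≠ 0 ∧ ∀ᶠ y in 𝓝 x, (y ∈ S ↔ g y = 0)

/-- The domain `Ω`, divided by the interface into `Ω₁`, with closure in `Ω`, and
`Ω₂ = Ω \ closure Ω₁`; the interface is Lipschitz and piecewise `C²`. -/
structure InterfaceGeometry where
  Ω : Set Plane
  Ω₁ : Set Plane
  isOpen_Ω : IsOpen Ω
  isBounded_Ω : Bornology.IsBounded Ω
  isOpen_Ω₁ : IsOpen Ω₁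
  closure_subset : closure Ω₁ ⊆ Ω
  lipschitz : HasLipschitzBoundary Ω₁
  piecewiseC2 : IsPiecewiseC2Curve (frontier Ω₁ ∩ frontier (Ω \ closure Ω₁))

namespace InterfaceGeometry

variable (G : InterfaceGeometry)

/-- The subdomains: `sub 0 = Ω₁` and `sub 1 = Ω₂ = Ω \ closure Ω₁`. -/
def sub (i : Fin 2) : Set Plane := if i = 0 then G.Ω₁ else G.Ω \ closure G.Ω₁

/-- The interface `Γ = ∂Ω₁ ∩ ∂Ω₂`. -/
def Γ : Set Plane := frontier (G.sub 0) ∩ frontier (G.sub 1)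

/-- The points where `Γ` is not `C²`-smooth. -/
def singularSet : Set Plane := {x | x ∈ G.Γ ∧ ¬ IsC2SmoothAt G.Γ x}

/-- `Ωᵢ` together with the part of the outer boundary `∂Ω` adjacent to it. Vertices and sides of
elements are attributed to the subdomains by means of this set, so that elements with a side
on `∂Ω` are treated like all others. -/
def region (i : Fin 2) : Set Plane := closure (G.sub i) \ G.Γ

end InterfaceGeometry

/-! ### Rectangular elements -/

/-- A nondegenerate rectangle with sides parallel to the axes, given by its lower left corner
`lo` and its upper right corner `hi`. -/
structure Rect where
  lo : Fin 2 → ℝ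
  hi : Fin 2 → ℝ
  lo_lt_hi : ∀ j, lo j < hi j

namespace Rect

variable (K : Rect)

/-- The open rectangle. -/
def set : Set Plane := {x | ∀ j, x j ∈ Ioo (K.lo j) (K.hi j)}

/-- The side length in the direction of the `j`-th axis. -/
def width (j : Fin 2) : ℝ := K.hi j - K.lo j

/-- The diameter `h_K`. -/
def h : ℝ := Metric.diam K.set

/-- The four vertices. -/
def vertices : Set Plane := {x | ∀ j, x j = K.lo j ∨ x j = K.hi j}

/-- The line coordinate of a side: the sides are indexed by the axis `s.1` they are orthogonal to
and by a Boolean that selects the lower or the upper one. -/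
def sideCoord (s : Fin 2 × Bool) : ℝ := if s.2 then K.hi s.1 else K.lo s.1

/-- The sides, with their end points. -/
def side (s : Fin 2 × Bool) : Set Plane :=
  {x | x s.1 = K.sideCoord s ∧ ∀ k, k ≠ s.1 → x k ∈ Icc (K.lo k) (K.hi k)}

/-- The sides, without their end points. -/
def openSide (s : Fin 2 × Bool) : Set Plane :=
  {x | x s.1 = K.sideCoord s ∧ ∀ k, k ≠ s.1 → x k ∈ Ioo (K.lo k) (K.hi k)}

/-- Shape regularity: the ratio of the side lengths is at most `σ`. -/
def ShapeRegular (σ : ℝ) : Prop := ∀ j k, K.width j ≤ σ * K.width k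

end Rect

/-! ### Elements cut by the interface -/

/-- A rectangular element `K ⊆ Ω` cut by the interface: inside the closed rectangle, `Γ` is a simple
arc that runs through the open rectangle from a point of an open side to a point of a
different open side, and there is at most one singular point of `Γ` in `K`. -/
structure CutElement (G : InterfaceGeometry) extends Rect where
  subset_Ω : toRect.set ⊆ G.Ω
  /-- a parametrization of the arc on `[0, 1]` -/
  γ : ℝ → Plane
  continuousOn_γ : ContinuousOn γ (Icc 0 1)
  injOn_γ : InjOn γ (Icc 0 1)
  image_γ : γ '' Icc 0 1 = G.Γ ∩ closure toRect.set
  mapsTo_γ : MapsTo γ (Ioo 0 1) toRect.set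
  ends_γ : ∃ s s', s ≠ s' ∧ γ 0 ∈ toRect.openSide s ∧ γ 1 ∈ toRect.openSide s'
  singular_subsingleton : (G.singularSet ∩ toRect.set).Subsingleton

/-- The Hausdorff distance `max_{x ∈ S} min_{y ∈ T} |x - y|` of a curve from a segment. -/
def distH (S T : Set Plane) : ℝ := sSup ((fun x => Metric.infDist x T) '' S)

/-- `T(t) = t + √(t² - 1)`. -/
def T (t : ℝ) : ℝ := t + Real.sqrt (t ^ 2 - 1)

namespace CutElement

variable {G : InterfaceGeometry} (K : CutElement G)

/-- The piece `Kᵢ = K ∩ Ωᵢ`. -/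
def piece (i : Fin 2) : Set Plane := K.set ∩ G.sub i

/-- The vertices of `K` in `Ωᵢ`. -/
def verticesIn (i : Fin 2) : Set Plane := K.vertices ∩ G.region i

/-- `K` has one vertex in `Ωᵢ` only, and contains a singular point of `Γ`. -/
def Irregular (i : Fin 2) : Prop :=
  (K.verticesIn i).ncard = 1 ∧ (G.singularSet ∩ K.set).Nonempty

/-- `K` is large with respect to `Ωᵢ`, with constant `δ₀`. -/
def IsLarge (δ₀ : ℝ) (i : Fin 2) : Prop :=
  (∀ s, (K.side s ∩ G.region i).Nonempty →
    ENNReal.ofReal δ₀ * μH[1] (K.side s) ≤ μH[1] (K.side s ∩ G.region i)) ∧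
  (K.Irregular i → ∀ A ∈ K.verticesIn i, ∀ Q ∈ G.singularSet ∩ K.set, ∀ s, A ∈ K.side s →
    (1 / 2) * δ₀ * min (K.width 0) (K.width 1) ≤ Metric.infDist Q (K.side s))

/-- The largest distance of a vertex of `K` in `Ωᵢ` from the straight line through `P` and `P'`. -/
def height (i : Fin 2) (P P' : Plane) : ℝ :=
  sSup ((fun A => Metric.infDist A (affineSpan ℝ {P, P'} : Set Plane)) '' K.verticesIn i)

/-- The deviation of the part of the interface between the parameters `s < t` from its chord,
relative to the distance of the vertex from that chord. -/
def relDeviation (i : Fin 2) (s t : ℝ) : ℝ :=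
  distH (K.γ '' Ioo s t) (openSegment ℝ (K.γ s) (K.γ t)) / K.height i (K.γ s) (K.γ t)

/-- The parameters (at most one) of the singular point of `Γ` in `K`. -/
def singularParams : Set ℝ := {t | t ∈ Ioo 0 1 ∧ K.γ t ∈ G.singularSet}

open Classical in
/-- The interface deviation `η_K^i`: that of the whole arc if `K` is regular with respect to `Ωᵢ`,
and the larger one of the two arcs ending at the singular point if `K` is irregular. -/
def etaSide (i : Fin 2) : ℝ :=
  if K.Irregular i then
    max (K.relDeviation i 0 (sSup K.singularParams)) (K.relDeviation i (sSup K.singularParams) 1)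
  else K.relDeviation i 0 1

/-- The interface deviation `η_K`. -/
def eta : ℝ := max (K.etaSide 0) (K.etaSide 1)

/-- `K` has the properties of the interface elements of a mesh which resolves the interface:
it is large with respect to both subdomains and its interface deviation is not too close to `1`. -/
structure ResolvesInterface (δ₀ : ℝ) : Prop where
  large : ∀ i, K.IsLarge δ₀ i
  eta_le : K.eta ≤ max (1 / 2) ((1 - δ₀) / (1 + δ₀))

end CutElement

/-- `Q_p`: the polynomials of degree at most `p` in each variable, as functions on the plane. -/
def Qp (p : ℕ) : Set (Plane → ℝ) :=
  {v | ∃ P : MvPolynomial (Fin 2) ℝ, (∀ j, P.degreeOf j ≤ p) ∧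
    v = fun x => MvPolynomial.eval (fun j => x j) P}

/-- The norm of `L²(S)` for a curve `S`, with respect to arc length. -/
def curveL2 (S : Set Plane) (v : Plane → ℝ) : ℝ≥0∞ := eLpNorm v 2 ((μH[1]).restrict S)

/-- The norm of `L²(D)` for a plane region `D`. -/
def areaL2 (D : Set Plane) (v : Plane → ℝ) : ℝ≥0∞ := eLpNorm v 2 (volume.restrict D)

end CutFEM

end

/-! The boundary of K_i consists of boundedly many nearly straight curves. On each of them two
estimates are combined, and both rest on the extremal growth of Chebyshev polynomials.

Trace. For a polynomial q of degree n, q(0)² is at most 2(2n+1)² times the integral of q² over [0,1]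
(`sq_eval_zero_le`). Integrating this over parallel segments which start on a flat curve and are
transversal to it (`lintegral_curve_le`) bounds the trace by a multiple of p²/h times the integral
of v² over any open convex set E which is fat on the scale h and has the curve in its closure
(`lintegral_curve_le_of_convex`).

Extrapolation. E reaches across the interface and has to be replaced by a subset D of K_i. The
integral of v² over a dilated star-shaped set is a polynomial in the dilation factor ρ, which on
[0,1] is bounded by its value at 1. So it grows at most like T(2ρ-1)^((2p+1)d), where d is 1 or 2,
the number of dilated coordinates (`lintegral_dilation_le`). If g is affine, zero at a suitable
vertex A of K in Ω_i and one on the chord, the deviation bounds |g-1| by η on the arc. With D = {g <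
1-η}, E = {g < 1+η} and ρ = (1+η)/(1-η) one has 2ρ-1 = (1+3η)/(1-η). After taking square roots the
exponent is 2p+1; the surplus factor T is bounded, since η stays away from 1.

In the regular case this works on all of K (`lintegral_frontier_le_of_regular`). In the irregular
case the boundary of K_i is divided into two strips along the sides which meet at A, and a rest. For
small η each strip meets only one of the two arcs, and the argument above applies to the chord of
that arc. For η bounded below, the other arc may also cross the strip; then two dilations in one
direction are used, and since log T is midpoint concave (`T_mul_T_le`) their factors multiply to no
more than the allowed power. On the rest, the uniform cones of the Lipschitz interface give
transversal segments inside K_i of length comparable to h, and no extrapolation is needed.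

The geometric input is that the line of the chord separates the boundary of K into the parts in Ω_1
and Ω_2 (`exists_isChord`), and that the chord ends are not close to vertices (`IsChord.le_depth`).
All flatness and cone constants come from compactness of the interface and are fixed before K. -/

noncomputable section

namespace CutFEM

/-! ### Polynomials in one variable: Chebyshev growth and the trace at an end point -/

open Polynomial in
/-- Every real polynomial has a primitive vanishing at the origin. -/
theorem exists_primitive (R : ℝ[X]) :
    ∃ S : ℝ[X], derivative S = R ∧ S.natDegree ≤ R.natDegree + 1 ∧ S.eval 0 = 0 := by
  refine ⟨∑ i ∈ Finset.range (R.natDegree + 1), monomial (i + 1) (R.coeff i / (i + 1)), ?_, ?_, ?_⟩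
  · rw [derivative_sum]
    conv_rhs => rw [R.as_sum_range]
    refine Finset.sum_congr rfl fun i _ => ?_
    rw [derivative_monomial]
    congr 1
    push_cast
    field_simp
  · refine natDegree_sum_le_of_forall_le _ _ fun i hi => ?_
    refine (natDegree_monomial_le _).trans ?_
    have := Finset.mem_range.1 hi
    omega
  · simp [eval_finsetSum]

theorem one_le_T {t : ℝ} (ht : 1 ≤ t) : 1 ≤ T t := by
  unfold T
  have := Real.sqrt_nonneg (t ^ 2 - 1)
  linarith

theorem T_mono {s t : ℝ} (hs : 1 ≤ s) (hst : s ≤ t) : T s ≤ T t := by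
  unfold T
  have : Real.sqrt (s ^ 2 - 1) ≤ Real.sqrt (t ^ 2 - 1) := Real.sqrt_le_sqrt (by nlinarith)
  linarith

theorem T_cosh {θ : ℝ} (hθ : 0 ≤ θ) : T (Real.cosh θ) = Real.exp θ := by
  unfold T
  have h : Real.cosh θ ^ 2 - 1 = Real.sinh θ ^ 2 := by rw [Real.cosh_sq]; ring
  rw [h, Real.sqrt_sq (Real.sinh_nonneg_iff.2 hθ), Real.cosh_add_sinh]

/-- `log T` is midpoint concave. -/
theorem T_mul_T_le {a b : ℝ} (ha : 1 ≤ a) (hb : 1 ≤ b) : T a * T b ≤ T ((a + b) / 2) ^ 2 := by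
  set u := Real.sqrt (a ^ 2 - 1) with hu
  set w := Real.sqrt (b ^ 2 - 1) with hw
  set r := Real.sqrt (((a + b) / 2) ^ 2 - 1) with hr
  have hu2 : u ^ 2 = a ^ 2 - 1 := Real.sq_sqrt (by nlinarith)
  have hw2 : w ^ 2 = b ^ 2 - 1 := Real.sq_sqrt (by nlinarith)
  have hr2 : r ^ 2 = ((a + b) / 2) ^ 2 - 1 := Real.sq_sqrt (by nlinarith)
  have hu0 : 0 ≤ u := Real.sqrt_nonneg _
  have hw0 : 0 ≤ w := Real.sqrt_nonneg _
  have hr0 : 0 ≤ r := Real.sqrt_nonneg _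
  -- For a = cosh x and b = cosh y, `T a * T b` is cosh(x+y) + sinh(x+y); `e1` and `e2` compare the
  -- two summands with cosh 2z and sinh 2z, where cosh z is the mean of a and b.
  have e1 : a * b + u * w ≤ 2 * ((a + b) / 2) ^ 2 - 1 := by nlinarith [sq_nonneg (u - w)]
  have e2 : a * w + b * u ≤ (a + b) * r := by
    refine le_of_sq_le_sq ?_ (by positivity) 
    have h1 : (a * w + b * u) ^ 2 = (a * b + u * w) ^ 2 - 1 := by
      have : (a * b + u * w) ^ 2 - (a * w + b * u) ^ 2 = (a ^ 2 - u ^ 2) * (b ^ 2 - w ^ 2) := by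
        ring
      rw [hu2, hw2] at this
      linarith
    have h2 : ((a + b) * r) ^ 2 = (2 * ((a + b) / 2) ^ 2 - 1) ^ 2 - 1 := by
      rw [mul_pow, hr2]; ring
    rw [h1, h2]
    have : 0 ≤ a * b + u * w := by positivity
    nlinarith
  unfold T
  rw [← hu, ← hw, ← hr]
  have : ((a + b) / 2 + r) ^ 2 = 2 * ((a + b) / 2) ^ 2 - 1 + (a + b) * r := by
    have : ((a + b) / 2 + r) ^ 2 = ((a + b) / 2) ^ 2 + r ^ 2 + (a + b) * r := by ring
    rw [this, hr2]; ring
  rw [this]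
  nlinarith

open Polynomial in
-- With t = cosh θ the left side is cosh nθ and the right side is exp nθ.
theorem eval_chebyshev_le {t : ℝ} (ht : 1 ≤ t) (n : ℕ) :
    (Chebyshev.T ℝ n).eval t ≤ T t ^ n := by
  obtain ⟨θ, hθ, rfl⟩ : ∃ θ, 0 ≤ θ ∧ Real.cosh θ = t :=
    ⟨Real.arcosh t, Real.arcosh_nonneg ht, Real.cosh_arcosh ht⟩
  rw [T_cosh hθ, Chebyshev.T_real_cosh, ← Real.exp_nat_mul, Real.cosh_eq]
  have : Real.exp (-(((n : ℤ) : ℝ) * θ)) ≤ Real.exp (((n : ℤ) : ℝ) * θ) := by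
    apply Real.exp_le_exp.2
    have : 0 ≤ ((n : ℤ) : ℝ) * θ := by positivity
    linarith
  push_cast at *
  linarith

open Polynomial in
-- The Chebyshev polynomial is extremal beyond the interval for the derivatives of every order.
-- Order 0 gives the growth estimate, order 1 at the point 1 the trace estimate.
theorem iterate_derivative_eval_le {n k : ℕ} {R : ℝ[X]} (hR : R.natDegree ≤ n) {M : ℝ}
    (hM : ∀ x ∈ Icc (-1 : ℝ) 1, |R.eval x| ≤ M) {x : ℝ} (hx : 1 ≤ x) :
    (derivative^[k] R).eval x ≤ M * (derivative^[k] (Chebyshev.T ℝ n)).eval x := by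
  have hM0 : 0 ≤ M := (abs_nonneg _).trans (hM 0 (by simp))
  have key : ∀ M' > 0, (∀ x ∈ Icc (-1 : ℝ) 1, |R.eval x| ≤ M') →
      (derivative^[k] R).eval x ≤ M' * (derivative^[k] (Chebyshev.T ℝ n)).eval x := by
    intro M' hM' h
    have := Chebyshev.eval_iterate_derivative_le_of_forall_abs_le_one (n := n) (k := k)
      (P := C M'⁻¹ * R) hx ?_ ?_
    · rw [iterate_derivative_C_mul, eval_C_mul] at this
      rw [inv_mul_le_iff₀ hM'] at this
      linarith
    · exact degree_le_of_natDegree_le ((natDegree_C_mul_le _ _).trans hR)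
    · intro y hy
      rw [eval_C_mul, abs_mul, abs_of_pos (inv_pos.2 hM'), inv_mul_le_iff₀ hM']
      simpa using h y hy
  -- Normalizing `R` needs a positive bound; M = 0 is covered by the limit of the bounds M + ε.
  refine ge_of_tendsto (x := 𝓝[>] (0 : ℝ))
    (f := fun ε => (M + ε) * (derivative^[k] (Chebyshev.T ℝ n)).eval x) ?_ ?_
  · have : ContinuousAt (fun ε : ℝ => (M + ε) * (derivative^[k] (Chebyshev.T ℝ n)).eval x) 0 := by
      fun_prop
    have h := this.tendsto
    simp only [add_zero] at h
    exact h.mono_left nhdsWithin_le_nhds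
  · filter_upwards [self_mem_nhdsWithin] with ε hε
    exact key _ (add_pos_of_nonneg_of_pos hM0 hε) fun y hy => (hM y hy).trans (by
      have : (0 : ℝ) < ε := hε
      linarith)

open Polynomial in
/-- Growth of a polynomial outside the unit interval. -/
theorem eval_le_mul_T_pow {n : ℕ} {R : ℝ[X]} (hR : R.natDegree ≤ n) {M : ℝ}
    (hM : ∀ x ∈ Icc (0 : ℝ) 1, |R.eval x| ≤ M) {ρ : ℝ} (hρ : 1 ≤ ρ) :
    R.eval ρ ≤ M * T (2 * ρ - 1) ^ n := by
  have hM0 : 0 ≤ M := (abs_nonneg _).trans (hM 0 (by simp))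
  have h := iterate_derivative_eval_le (k := 0) (n := n)
    (R := R.comp (C (1 / 2) * X + C (1 / 2))) (M := M) (x := 2 * ρ - 1) ?_ ?_ (by linarith)
  · simp only [Function.iterate_zero, id_eq, eval_comp, eval_add, eval_mul, eval_C, eval_X] at h
    rw [show (1 / 2 : ℝ) * (2 * ρ - 1) + 1 / 2 = ρ by ring] at h
    exact h.trans (mul_le_mul_of_nonneg_left (eval_chebyshev_le (by linarith) n) hM0)
  · refine natDegree_comp_le.trans ?_
    have : (C (1 / 2 : ℝ) * X + C (1 / 2)).natDegree ≤ 1 := natDegree_linear_le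
    calc _ ≤ R.natDegree * 1 := Nat.mul_le_mul_left _ this
      _ ≤ n := by simpa using hR
  · intro x hx
    simp only [eval_comp, eval_add, eval_mul, eval_C, eval_X]
    exact hM _ ⟨by linarith [hx.1], by linarith [hx.2]⟩

open Polynomial in
/-- The inverse trace inequality on the unit interval. -/
theorem sq_eval_zero_le {n : ℕ} {q : ℝ[X]} (hq : q.natDegree ≤ n) :
    q.eval 0 ^ 2 ≤ 2 * (2 * n + 1) ^ 2 * ∫ t in (0 : ℝ)..1, q.eval t ^ 2 := by
  obtain ⟨S, hS, hdeg, hS0⟩ := exists_primitive (q ^ 2)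
  have hderiv : ∀ t, HasDerivAt (fun t => S.eval t) (q.eval t ^ 2) t := fun t => by
    have := S.hasDerivAt t
    rwa [hS, eval_pow] at this
  have hint : ∀ a b : ℝ, ∫ t in a..b, q.eval t ^ 2 = S.eval b - S.eval a := fun a b =>
    intervalIntegral.integral_eq_sub_of_hasDerivAt (fun t _ => hderiv t)
      ((by fun_prop : Continuous fun t => q.eval t ^ 2).intervalIntegrable _ _)
  have hmono : Monotone fun t => S.eval t :=
    monotone_of_hasDerivAt_nonneg hderiv fun t => sq_nonneg _
  rw [hint, hS0, sub_zero]
  -- The primitive `S` of q² is increasing, so it is bounded by S(1) on [0,1]. The substitution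
  -- (1-x)/2 moves 0 to the end point 1, where the derivative of the transformed polynomial is
  -- q(0)²/2 and that of the Chebyshev polynomial is (2n+1)².
  have h := iterate_derivative_eval_le (k := 1) (n := 2 * n + 1)
    (R := -S.comp (C (-1 / 2) * X + C (1 / 2))) (M := S.eval 1) (x := 1) ?_ ?_ le_rfl
  · have hT : (derivative^[1] (Chebyshev.T ℝ ((2 * n + 1 : ℕ) : ℤ))).eval 1
        = (2 * n + 1 : ℝ) ^ 2 := by
      rw [Function.iterate_one, Chebyshev.T_derivative_eq_U]
      simp only [eval_mul, Chebyshev.U_eval_one]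
      push_cast
      simp
      ring
    rw [hT] at h
    rw [Function.iterate_one, derivative_neg, derivative_comp, hS] at h
    simp [eval_comp] at h
    norm_num at h
    linarith
  · rw [natDegree_neg]
    refine natDegree_comp_le.trans ?_
    have h1 : (C (-1 / 2 : ℝ) * X + C (1 / 2)).natDegree ≤ 1 := natDegree_linear_le
    have h2 : (q ^ 2).natDegree ≤ 2 * n := natDegree_pow_le.trans (by omega)
    calc _ ≤ S.natDegree * 1 := Nat.mul_le_mul_left _ h1
      _ ≤ 2 * n + 1 := by omega
  · intro x hx
    simp only [eval_neg, eval_comp, eval_add, eval_mul, eval_C, eval_X, abs_neg]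
    have h1 := hmono (show (0 : ℝ) ≤ -1 / 2 * x + 1 / 2 by linarith [hx.2])
    have h2 := hmono (show -1 / 2 * x + 1 / 2 ≤ (1 : ℝ) by linarith [hx.1])
    simp only at h1 h2
    rw [hS0] at h1
    rw [abs_of_nonneg h1]
    exact h2

/-! ### Restriction of `Q_p` to polynomial curves -/

open Polynomial in
-- Since the degree is bounded in each variable separately, an axis-parallel line gives degree p and
-- a general line 2p. This difference is what makes dilations in one direction cheaper.
theorem natDegree_aeval_le {p : ℕ} {P : MvPolynomial (Fin 2) ℝ} (hP : ∀ j, P.degreeOf j ≤ p)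
    {k : Fin 2 → ℕ} {f : Fin 2 → ℝ[X]} (hf : ∀ j, (f j).natDegree ≤ k j) :
    (MvPolynomial.aeval f P).natDegree ≤ p * (k 0 + k 1) := by
  rw [MvPolynomial.aeval_def, MvPolynomial.eval₂_eq]
  refine natDegree_sum_le_of_forall_le _ _ fun d hd => ?_
  have hdj : ∀ j, d j ≤ p := fun j => (MvPolynomial.monomial_le_degreeOf j hd).trans (hP j)
  refine natDegree_mul_le.trans ?_
  have h0 : ((algebraMap ℝ ℝ[X]) (MvPolynomial.coeff d P)).natDegree = 0 := natDegree_C _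
  rw [h0, zero_add]
  refine (natDegree_prod_le _ _).trans ?_
  have hj : ∀ j, (f j ^ d j).natDegree ≤ p * k j := fun j =>
    natDegree_pow_le.trans (Nat.mul_le_mul (hdj j) (hf j))
  calc ∑ i ∈ d.support, (f i ^ d i).natDegree ≤ ∑ i, (f i ^ d i).natDegree :=
        Finset.sum_le_univ_sum_of_nonneg fun _ => Nat.zero_le _
    _ ≤ ∑ i, p * k i := Finset.sum_le_sum fun j _ => hj j
    _ = p * (k 0 + k 1) := by rw [Fin.sum_univ_two]; ring

theorem eval_aeval (P : MvPolynomial (Fin 2) ℝ) (f : Fin 2 → Polynomial ℝ) (t : ℝ) :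
    (MvPolynomial.aeval f P).eval t = MvPolynomial.eval (fun j => (f j).eval t) P := by
  rw [MvPolynomial.aeval_def, MvPolynomial.eval₂_eq, MvPolynomial.eval_eq,
    Polynomial.eval_finsetSum]
  refine Finset.sum_congr rfl fun d _ => ?_
  simp [Polynomial.eval_mul, Polynomial.eval_prod, Polynomial.eval_pow]

/-- The restriction of an element of `Q_p` to a curve with polynomial coordinates. -/
theorem Qp.exists_polynomial {p : ℕ} {v : Plane → ℝ} (hv : v ∈ Qp p) {k : Fin 2 → ℕ}
    {f : Fin 2 → Polynomial ℝ} (hf : ∀ j, (f j).natDegree ≤ k j) {g : ℝ → Plane}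
    (hg : ∀ t j, g t j = (f j).eval t) :
    ∃ q : Polynomial ℝ, q.natDegree ≤ p * (k 0 + k 1) ∧ ∀ t, v (g t) = q.eval t := by
  obtain ⟨P, hP, rfl⟩ := hv
  refine ⟨MvPolynomial.aeval f P, natDegree_aeval_le hP hf, fun t => ?_⟩
  rw [eval_aeval]
  simp only [hg]

theorem Qp.continuous {p : ℕ} {v : Plane → ℝ} (hv : v ∈ Qp p) : Continuous v := by
  obtain ⟨P, -, rfl⟩ := hv
  exact (MvPolynomial.continuous_eval P).comp (by fun_prop)

/-- The square of a function, with values in `ℝ≥0∞`. -/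
def sqE (v : Plane → ℝ) (x : Plane) : ℝ≥0∞ := ENNReal.ofReal (v x ^ 2)

theorem Qp.measurable_sqE {p : ℕ} {v : Plane → ℝ} (hv : v ∈ Qp p) : Measurable (sqE v) :=
  (ENNReal.continuous_ofReal.comp ((Qp.continuous hv).pow 2)).measurable

/-! ### Integration along parallel lines -/

/-- The determinant of two plane vectors. -/
def cross (a b : Plane) : ℝ := a 0 * b 1 - a 1 * b 0

theorem continuous_cross (a : Plane) : Continuous (cross a) := by unfold cross; fun_prop

/-- Projecting a curve injectively, with Lipschitz inverse, to the real line does not decrease its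
length by more than the Lipschitz factor. -/
theorem lintegral_comp_le_of_antilipschitz {S : Set Plane} {π : Plane → ℝ} (hπ : Measurable π)
    {κ : ℝ} (hκ : 0 < κ) (h : ∀ x ∈ S, ∀ y ∈ S, κ * dist x y ≤ |π x - π y|)
    {F : ℝ → ℝ≥0∞} (hF : Measurable F) :
    ∫⁻ x in S, F (π x) ∂μH[1] ≤ ENNReal.ofReal κ⁻¹ * ∫⁻ m, F m := by
  rw [← lintegral_map hF hπ, ← smul_eq_mul, ← lintegral_smul_measure]
  refine lintegral_mono' ?_ le_rfl
  refine Measure.le_iff.2 fun t ht => ?_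
  rw [Measure.map_apply hπ ht, Measure.restrict_apply (hπ ht), Measure.smul_apply, smul_eq_mul]
  have hinj : InjOn π S := fun x hx y hy hxy => by
    have := h x hx y hy
    rw [hxy, sub_self, abs_zero] at this
    have hd : dist x y ≤ 0 := by
      by_contra hlt
      push Not at hlt
      nlinarith
    exact dist_le_zero.1 hd
  set g := Function.invFunOn π S
  have hg : ∀ x ∈ S, g (π x) = x := fun x hx => hinj.leftInvOn_invFunOn hx
  have hlip : LipschitzOnWith (Real.toNNReal κ⁻¹) g (π '' S ∩ t) := by
    refine LipschitzOnWith.of_dist_le_mul ?_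
    rintro _ ⟨⟨x, hx, rfl⟩, -⟩ _ ⟨⟨y, hy, rfl⟩, -⟩
    rw [hg x hx, hg y hy, Real.coe_toNNReal _ (inv_nonneg.2 hκ.le), Real.dist_eq,
      inv_mul_eq_div, le_div_iff₀ hκ]
    linarith [h x hx y hy]
  calc μH[1] (π ⁻¹' t ∩ S) ≤ μH[1] (g '' (π '' S ∩ t)) := by
        refine measure_mono ?_
        rintro x ⟨hxt, hx⟩
        exact ⟨π x, ⟨⟨x, hx, rfl⟩, hxt⟩, hg x hx⟩
    _ ≤ (Real.toNNReal κ⁻¹ : ℝ≥0∞) ^ (1 : ℝ) * μH[1] (π '' S ∩ t) :=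
        hlip.hausdorffMeasure_image_le zero_le_one
    _ ≤ ENNReal.ofReal κ⁻¹ * volume t := by
        rw [ENNReal.rpow_one, hausdorffMeasure_real]
        exact mul_le_mul_right (measure_mono inter_subset_right) _

/-- The linear map with a given matrix. -/
def matMap (M : Matrix (Fin 2) (Fin 2) ℝ) : Plane →L[ℝ] Plane :=
  LinearMap.toContinuousLinearMap (Matrix.toLpLin 2 2 M)

theorem matMap_apply (M : Matrix (Fin 2) (Fin 2) ℝ) (y : Plane) (i : Fin 2) :
    matMap M y i = M i 0 * y 0 + M i 1 * y 1 := by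
  fin_cases i <;> simp [matMap, Matrix.toLpLin_apply]

theorem det_matMap (M : Matrix (Fin 2) (Fin 2) ℝ) : (matMap M).det = M.det := by
  simp [matMap, ContinuousLinearMap.det, Matrix.toLpLin_eq_toLin]

theorem matMap_injective {M : Matrix (Fin 2) (Fin 2) ℝ} (hM : M.det ≠ 0) :
    Function.Injective (matMap M) := by
  have h : LinearMap.det (matMap M : Plane →ₗ[ℝ] Plane) ≠ 0 := by
    have := det_matMap M
    rw [ContinuousLinearMap.det] at this
    rwa [this]
  exact (LinearMap.equivOfDetNeZero _ h).injective

theorem matMap_surjective {M : Matrix (Fin 2) (Fin 2) ℝ} (hM : M.det ≠ 0) :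
    Function.Surjective (matMap M) :=
  (LinearMap.injective_iff_surjective (f := (matMap M : Plane →ₗ[ℝ] Plane))).1 (matMap_injective hM)

theorem lintegral_image_matMap {M : Matrix (Fin 2) (Fin 2) ℝ} (hM : M.det ≠ 0) (A : Plane)
    {D : Set Plane} (hD : MeasurableSet D) (f : Plane → ℝ≥0∞) :
    ∫⁻ x in (fun y => A + matMap M (y - A)) '' D, f x =
      ENNReal.ofReal |M.det| * ∫⁻ y in D, f (A + matMap M (y - A)) := by
  have hder : ∀ y ∈ D, HasFDerivWithinAt (fun y => A + matMap M (y - A)) (matMap M) D y := by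
    intro y _
    have h1 : HasFDerivAt (fun y : Plane => y - A) (ContinuousLinearMap.id ℝ Plane) y :=
      (hasFDerivAt_id y).sub_const A
    have h2 := ((matMap M).hasFDerivAt (x := y - A)).comp y h1
    exact (h2.const_add A).hasFDerivWithinAt
  rw [lintegral_image_eq_lintegral_abs_det_fderiv_mul volume hD hder
    (fun x _ y _ hxy => sub_left_injective (matMap_injective hM (add_left_cancel hxy)))]
  rw [det_matMap]
  exact lintegral_const_mul' _ _ ENNReal.ofReal_ne_top

theorem lintegral_plane (f : Plane → ℝ≥0∞) (hf : Measurable f) :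
    ∫⁻ x, f x = ∫⁻ m : ℝ, ∫⁻ s : ℝ, f (!₂[m, s]) := by
  rw [← (PiLp.volume_preserving_toLp (Fin 2)).lintegral_comp hf,
    ← ((volume_preserving_finTwoArrow ℝ).symm).lintegral_comp
      (f := fun y => f (WithLp.toLp 2 y))
      (hf.comp (PiLp.volume_preserving_toLp (Fin 2)).measurable),
    Measure.volume_eq_prod, lintegral_prod]
  · rfl
  · exact (hf.comp ((PiLp.volume_preserving_toLp (Fin 2)).measurable.comp
      (MeasurableEquiv.measurable _))).aemeasurable

theorem normSq_eq (d : Plane) : d 0 ^ 2 + d 1 ^ 2 = ‖d‖ ^ 2 := by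
  rw [EuclideanSpace.norm_sq_eq, Fin.sum_univ_two]; simp

/-- Integration along the lines with direction `d`. -/
theorem lintegral_eq_lines {d : Plane} (hd : d ≠ 0) {f : Plane → ℝ≥0∞} (hf : Measurable f) :
    ∫⁻ x, f x = ∫⁻ m : ℝ, ∫⁻ s : ℝ, f (!₂[s * d 0 - m * d 1 / ‖d‖ ^ 2,
      s * d 1 + m * d 0 / ‖d‖ ^ 2]) := by
  have hn : ‖d‖ ^ 2 ≠ 0 := by simpa using hd
  -- The columns are the rotated vector d/|d|² and d itself. The determinant is -1, so measure is
  -- preserved, and the coordinate m of a point x is `cross d x`.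
  set M : Matrix (Fin 2) (Fin 2) ℝ := !![-d 1 / ‖d‖ ^ 2, d 0; d 0 / ‖d‖ ^ 2, d 1] with hM
  have hdet : M.det = -1 := by
    rw [hM, Matrix.det_fin_two_of]
    field_simp
    linarith [normSq_eq d]
  have h := lintegral_image_matMap (M := M) (by rw [hdet]; norm_num) 0 MeasurableSet.univ f
  rw [hdet, image_univ, Set.range_eq_univ.2] at h
  · simp only [Measure.restrict_univ, abs_neg, abs_one, ENNReal.ofReal_one, one_mul, zero_add,
      sub_zero] at h
    rw [h, lintegral_plane (fun y => f (matMap M y)) (hf.comp (matMap M).continuous.measurable)]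
    refine lintegral_congr fun m => lintegral_congr fun s => ?_
    congr 1
    ext i
    rw [matMap_apply]
    fin_cases i <;> simp [hM] <;> ring
  · intro y
    obtain ⟨x, hx⟩ := matMap_surjective (M := M) (by rw [hdet]; norm_num) y
    exact ⟨x, by simpa using hx⟩

/-- The inverse trace inequality along a family of parallel segments which start on a curve that is
transversal to them. -/
theorem lintegral_curve_le {p : ℕ} (hp : 1 ≤ p) {v : Plane → ℝ} (hv : v ∈ Qp p) {S R : Set Plane}
    (hR : MeasurableSet R) {d : Plane} {κ : ℝ} (hκ : 0 < κ)
    (hS : ∀ x ∈ S, ∀ y ∈ S, κ * dist x y ≤ |cross d (x - y)|)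
    (hSR : ∀ x ∈ S, ∀ t ∈ Ioo (0 : ℝ) 1, x + t • d ∈ R) :
    ∫⁻ x in S, sqE v x ∂μH[1] ≤ ENNReal.ofReal (50 * p ^ 2 / κ) * ∫⁻ x in R, sqE v x := by
  have hvm := Qp.measurable_sqE hv
  set f : Plane → ℝ≥0∞ := R.indicator (sqE v) with hf
  have hfm : Measurable f := hvm.indicator hR
  -- At most one point is a null set for arc length; with two points, transversality forces d ≠ 0.
  rcases Set.subsingleton_or_nontrivial S with hsub | hnon
  · have hnoat : μH[1] S = 0 := by
      rcases hsub.eq_empty_or_singleton with h | ⟨x, h⟩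
      · rw [h]; simp
      · rw [h]
        exact (Measure.nullSingletonClass_hausdorff Plane one_pos).measure_singleton x
    rw [Measure.restrict_eq_zero.2 hnoat, lintegral_zero_measure]
    exact zero_le
  have hd : d ≠ 0 := by
    rintro rfl
    obtain ⟨x, hx, y, hy, hxy⟩ := hnon
    have := hS x hx y hy
    simp [cross] at this
    have h2 : 0 < dist x y := dist_pos.2 hxy
    nlinarith
  have hn : ‖d‖ ^ 2 ≠ 0 := by simpa using hd
  set F : ℝ → ℝ≥0∞ := fun m => ∫⁻ s : ℝ, f (!₂[s * d 0 - m * d 1 / ‖d‖ ^ 2,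
      s * d 1 + m * d 0 / ‖d‖ ^ 2]) with hFdef
  have hFm : Measurable F := by
    apply Measurable.lintegral_prod_right' (f := fun q : ℝ × ℝ => f (!₂[q.2 * d 0 -
      q.1 * d 1 / ‖d‖ ^ 2, q.2 * d 1 + q.1 * d 0 / ‖d‖ ^ 2]))
    apply hfm.comp
    refine (PiLp.volume_preserving_toLp (Fin 2)).measurable.comp ?_
    refine measurable_pi_lambda _ fun i => ?_
    fin_cases i <;> simp <;> fun_prop
  -- On the line through x the function v has degree at most 2p, and 2(4p+1)² ≤ 50p² for p ≥ 1.
  have hpt : ∀ x ∈ S, sqE v x ≤ ENNReal.ofReal (50 * p ^ 2) * F (cross d x) := by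
    intro x hx
    obtain ⟨q, hq, hqv⟩ := Qp.exists_polynomial hv (k := fun _ => 1)
      (f := fun j => Polynomial.C (d j) * Polynomial.X + Polynomial.C (x j))
      (g := fun t => x + t • d) (fun j => Polynomial.natDegree_linear_le)
      (fun t j => by simp; ring)
    have h1 := sq_eval_zero_le hq
    have h2 : v x = q.eval 0 := by have := hqv 0; simpa using this
    have hI : ENNReal.ofReal (∫ t in (0 : ℝ)..1, q.eval t ^ 2) ≤ F (cross d x) := by
      rw [intervalIntegral.integral_of_le zero_le_one, integral_Ioc_eq_integral_Ioo,
        ofReal_integral_eq_lintegral_ofReal]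
      · calc ∫⁻ t in Ioo (0 : ℝ) 1, ENNReal.ofReal (q.eval t ^ 2)
            = ∫⁻ t in Ioo (0 : ℝ) 1, f (x + t • d) := by
              refine setLIntegral_congr_fun measurableSet_Ioo fun t ht => ?_
              rw [hf, indicator_of_mem (hSR x hx t ht), sqE, hqv]
          _ ≤ ∫⁻ t : ℝ, f (x + t • d) := setLIntegral_le_lintegral _ _
          _ = F (cross d x) := by
              -- The point x + t d has line coordinate s = t + (x·d)/|d|², so the two integrals
              -- differ by a translation.
              refine Eq.trans ?_ (lintegral_add_right_eq_self (fun s : ℝ => f (!₂[s * d 0 -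
                cross d x * d 1 / ‖d‖ ^ 2, s * d 1 + cross d x * d 0 / ‖d‖ ^ 2]))
                ((x 0 * d 0 + x 1 * d 1) / ‖d‖ ^ 2))
              refine lintegral_congr fun t => ?_
              congr 1
              have hne : d 0 ^ 2 + d 1 ^ 2 ≠ 0 := by rw [normSq_eq]; exact hn
              ext i
              rw [← normSq_eq]
              fin_cases i <;> simp [cross] <;> field_simp <;> ring
      · exact ((by fun_prop : Continuous fun t => q.eval t ^ 2).integrableOn_Icc).mono_set
          Ioo_subset_Icc_self
      · exact Filter.Eventually.of_forall fun t => sq_nonneg _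
    calc sqE v x ≤ ENNReal.ofReal (50 * p ^ 2 * ∫ t in (0 : ℝ)..1, q.eval t ^ 2) := by
          rw [sqE, h2]
          refine ENNReal.ofReal_le_ofReal (h1.trans ?_)
          refine mul_le_mul_of_nonneg_right ?_ (intervalIntegral.integral_nonneg zero_le_one
            fun t _ => sq_nonneg _)
          have : (1 : ℝ) ≤ p := by exact_mod_cast hp
          push_cast
          nlinarith
      _ ≤ _ := by
          rw [ENNReal.ofReal_mul (by positivity)]
          exact mul_le_mul_right hI _
  calc ∫⁻ x in S, sqE v x ∂μH[1]
      ≤ ∫⁻ x in S, ENNReal.ofReal (50 * p ^ 2) * F (cross d x) ∂μH[1] :=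
        setLIntegral_mono (measurable_const.mul (hFm.comp (continuous_cross d).measurable)) hpt
    _ ≤ ENNReal.ofReal κ⁻¹ * ∫⁻ m, ENNReal.ofReal (50 * p ^ 2) * F m := by
        refine lintegral_comp_le_of_antilipschitz (F := fun m => ENNReal.ofReal (50 * p ^ 2) * F m)
          (continuous_cross d).measurable hκ (fun x hx y hy => ?_) (measurable_const.mul hFm)
        refine (hS x hx y hy).trans (le_of_eq ?_)
        congr 1
        simp [cross]; ring
    _ = ENNReal.ofReal (50 * p ^ 2 / κ) * ∫⁻ x in R, sqE v x := by
        rw [lintegral_const_mul _ hFm, ← mul_assoc, ← ENNReal.ofReal_mul (by positivity),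
          ← lintegral_indicator hR, ← hf, lintegral_eq_lines hd hfm]
        congr 2
        field_simp

/-! ### Growth of the area norm under dilations -/

/-- An integral of polynomials in one variable is a polynomial. -/
theorem exists_polynomial_integral {α : Type*} [MeasurableSpace α] {μ : Measure α} {n : ℕ}
    {f : ℝ → α → ℝ} (hf : ∀ y, ∃ R : Polynomial ℝ, R.natDegree ≤ n ∧ ∀ s, f s y = R.eval s)
    (hint : ∀ s, Integrable (f s) μ) :
    ∃ S : Polynomial ℝ, S.natDegree ≤ n ∧ ∀ s, ∫ y, f s y ∂μ = S.eval s := by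
  have hinj : Set.InjOn (fun i : ℕ => (i : ℝ)) (Finset.range (n + 1)) :=
    fun i _ j _ h => Nat.cast_injective h
  -- The integrand at s is a combination of its values at 0,…,n with coefficients which depend on s
  -- only, so the integral is the interpolant of its own values at these nodes.
  set S := Lagrange.interpolate (Finset.range (n + 1)) (fun i : ℕ => (i : ℝ))
    (fun i => ∫ y, f i y ∂μ) with hS
  refine ⟨S, ?_, fun s => ?_⟩
  · have := Lagrange.degree_interpolate_lt (fun i : ℕ => ∫ y, f i y ∂μ) hinj
    rw [Finset.card_range] at this
    rw [Nat.cast_withBot] at this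
    exact Polynomial.natDegree_le_of_degree_le (Order.lt_succ_iff.1 this)
  · have key : ∀ y, f s y = ∑ i ∈ Finset.range (n + 1), f i y *
        (Lagrange.basis (Finset.range (n + 1)) (fun i : ℕ => (i : ℝ)) i).eval s := by
      intro y
      obtain ⟨R, hR, hRe⟩ := hf y
      have h1 : R.degree < (Finset.range (n + 1)).card := by
        rw [Finset.card_range]
        exact (Polynomial.degree_le_of_natDegree_le hR).trans_lt (by exact_mod_cast Nat.lt_succ_self n)
      have h2 := Lagrange.eq_interpolate hinj h1
      rw [hRe, h2, Lagrange.interpolate_apply, Polynomial.eval_finsetSum]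
      refine Finset.sum_congr rfl fun i _ => ?_
      rw [Polynomial.eval_mul, Polynomial.eval_C, hRe]
    calc ∫ y, f s y ∂μ = ∫ y, ∑ i ∈ Finset.range (n + 1), f i y *
        (Lagrange.basis (Finset.range (n + 1)) (fun i : ℕ => (i : ℝ)) i).eval s ∂μ :=
          integral_congr_ae (Filter.Eventually.of_forall key)
      _ = S.eval s := by
          rw [integral_finsetSum (f := fun (i : ℕ) y => f i y * (Lagrange.basis (Finset.range (n + 1))
            (fun i : ℕ => (i : ℝ)) i).eval s) _ fun i _ => (hint i).mul_const _, hS, Lagrange.interpolate_apply,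
            Polynomial.eval_finsetSum]
          refine Finset.sum_congr rfl fun i _ => ?_
          rw [Polynomial.eval_mul, Polynomial.eval_C, integral_mul_const]

/-- The dilation about `A` with factor `s ^ k j` in the direction of the `j`-th axis. -/
def dilation (k : Fin 2 → ℕ) (A : Plane) (s : ℝ) (y : Plane) : Plane :=
  A + matMap (Matrix.diagonal fun j => s ^ k j) (y - A)

theorem dilation_apply (k : Fin 2 → ℕ) (A : Plane) (s : ℝ) (y : Plane) (j : Fin 2) :
    dilation k A s y j = A j + s ^ k j * (y j - A j) := by
  unfold dilation
  rw [PiLp.add_apply, matMap_apply]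
  fin_cases j <;> simp

theorem dilation_one (k : Fin 2 → ℕ) (A y : Plane) : dilation k A 1 y = y := by
  ext j; rw [dilation_apply]; simp

theorem continuous_dilation (k : Fin 2 → ℕ) (A : Plane) (s : ℝ) : Continuous (dilation k A s) := by
  unfold dilation; fun_prop

/-- Growth of the `L²` norm of a polynomial under dilations of a star-shaped domain. -/
theorem lintegral_dilation_le {p : ℕ} {v : Plane → ℝ} (hv : v ∈ Qp p) {k : Fin 2 → ℕ}
    (hk : 1 ≤ k 0 + k 1) {A : Plane} {D : Set Plane}
    (hDb : Bornology.IsBounded D) (hDm : MeasurableSet D)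
    (hstar : ∀ s ∈ Ioc (0 : ℝ) 1, ∀ y ∈ D, dilation k A s y ∈ D) {ρ : ℝ} (hρ : 1 ≤ ρ) :
    ∫⁻ x in dilation k A ρ '' D, sqE v x ≤
      ENNReal.ofReal (T (2 * ρ - 1) ^ ((2 * p + 1) * (k 0 + k 1))) * ∫⁻ x in D, sqE v x := by
  -- The Jacobian factor is part of the polynomial; together with v² along the dilation it gives
  -- degree (2p+1)(k 0 + k 1) in s.
  set f : ℝ → Plane → ℝ := fun s y => s ^ (k 0 + k 1) * v (dilation k A s y) ^ 2 with hf
  have hint : ∀ s, Integrable (f s) (volume.restrict D) := fun s => by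
    have hc : Continuous (f s) := continuous_const.mul
      (((Qp.continuous hv).comp (continuous_dilation k A s)).pow 2)
    exact (hc.continuousOn.integrableOn_compact hDb.isCompact_closure).mono_set subset_closure
  have hlin : ∀ s > 0, ∫⁻ x in dilation k A s '' D, sqE v x =
      ENNReal.ofReal (∫ y in D, f s y) := by
    intro s hs
    have hdet : (Matrix.diagonal fun j => s ^ k j).det = s ^ (k 0 + k 1) := by
      rw [Matrix.det_diagonal, Fin.prod_univ_two, pow_add]
    have hpos : 0 < s ^ (k 0 + k 1) := by positivity
    have := lintegral_image_matMap (M := Matrix.diagonal fun j => s ^ k j)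
      (by rw [hdet]; exact hpos.ne') A hDm (sqE v)
    rw [hdet, abs_of_pos hpos] at this
    rw [ofReal_integral_eq_lintegral_ofReal (hint s)
      (Filter.Eventually.of_forall fun y => by rw [hf]; positivity)]
    refine this.trans ?_
    rw [← lintegral_const_mul' _ _ ENNReal.ofReal_ne_top]
    refine lintegral_congr fun y => ?_
    rw [hf, ENNReal.ofReal_mul hpos.le]
    rfl
  obtain ⟨S, hSdeg, hS⟩ := exists_polynomial_integral (n := (2 * p + 1) * (k 0 + k 1))
    (f := f) (μ := volume.restrict D) (fun y => by
      obtain ⟨q, hq, hqv⟩ := Qp.exists_polynomial hv (k := k)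
        (f := fun j => Polynomial.C (A j) + Polynomial.C (y j - A j) * Polynomial.X ^ k j)
        (g := fun s => dilation k A s y) (fun j => by
          refine (Polynomial.natDegree_add_le _ _).trans (max_le (by simp) ?_)
          exact Polynomial.natDegree_C_mul_X_pow_le _ _)
        (fun t j => by rw [dilation_apply]; simp; ring)
      refine ⟨Polynomial.X ^ (k 0 + k 1) * q ^ 2, ?_, fun s => ?_⟩
      · refine Polynomial.natDegree_mul_le.trans ?_
        rw [Polynomial.natDegree_X_pow]
        have := (Polynomial.natDegree_pow_le (p := q) (n := 2))
        nlinarith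
      · rw [hf]; simp [hqv]) hint
  -- Star-shapedness: for dilation factors in (0,1] the dilated set is contained in D, and at 0 the
  -- Jacobian vanishes.
  have hmono : ∀ x ∈ Icc (0 : ℝ) 1, |S.eval x| ≤ S.eval 1 := by
    intro x hx
    have hnn : ∀ x : ℝ, 0 ≤ x → 0 ≤ ∫ y in D, f x y := fun x hx =>
      integral_nonneg fun y => by rw [hf]; positivity
    rw [← hS, ← hS, abs_of_nonneg (hnn x hx.1)]
    rcases hx.1.eq_or_lt with rfl | hx0
    · have : ∀ y, f 0 y = 0 := fun y => by
        rw [hf]; simp only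
        rw [zero_pow (by omega), zero_mul]
      simp only [this, integral_zero]
      exact hnn 1 zero_le_one
    · rw [← ENNReal.ofReal_le_ofReal_iff (hnn 1 zero_le_one), ← hlin x hx0, ← hlin 1 one_pos]
      refine lintegral_mono_set ?_
      rintro _ ⟨y, hy, rfl⟩
      exact ⟨_, hstar x ⟨hx0, hx.2⟩ y hy, dilation_one _ _ _⟩
  have hfin := eval_le_mul_T_pow hSdeg hmono hρ
  have h1 : ∫⁻ x in D, sqE v x = ENNReal.ofReal (S.eval 1) := by
    rw [← hS, ← hlin 1 one_pos]
    congr 2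
    ext y; simp [dilation_one]
  rw [hlin ρ (by linarith), hS, h1, ← ENNReal.ofReal_mul (by have := one_le_T (t := 2 * ρ - 1) (by linarith); positivity)]
  exact ENNReal.ofReal_le_ofReal (by linarith)

/-! ### Flat curves -/

theorem abs_cross_le (a b : Plane) : |cross a b| ≤ ‖a‖ * ‖b‖ := by
  refine abs_le_of_sq_le_sq ?_ (by positivity)
  rw [mul_pow, ← normSq_eq, ← normSq_eq, cross]
  nlinarith [sq_nonneg (a 0 * b 0 + a 1 * b 1)]

theorem cross_smul (a x : Plane) (t : ℝ) : cross a (t • x) = t * cross a x := by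
  simp [cross]; ring

theorem cross_smul_left (a x : Plane) (t : ℝ) : cross (t • a) x = t * cross a x := by
  simp [cross]; ring

/-- The secants of `S` deviate from the direction of `τ` by a slope of at most `ε`. -/
def IsFlat (ε : ℝ) (τ : Plane) (S : Set Plane) : Prop :=
  ‖τ‖ = 1 ∧ ∀ x ∈ S, ∀ y ∈ S, |cross τ (x - y)| ≤ ε * dist x y

theorem IsFlat.mono {ε ε' : ℝ} {τ : Plane} {S S' : Set Plane} (h : IsFlat ε τ S) (hε : ε ≤ ε')
    (hS : S' ⊆ S) : IsFlat ε' τ S' :=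
  ⟨h.1, fun x hx y hy => (h.2 x (hS hx) y (hS hy)).trans
    (mul_le_mul_of_nonneg_right hε dist_nonneg)⟩

/-- `S` is covered by finitely many flat sets. -/
def FlatCover (ε : ℝ) (S : Set Plane) : Prop :=
  ∃ 𝓕 : Set (Set Plane), 𝓕.Finite ∧ S ⊆ ⋃₀ 𝓕 ∧ ∀ F ∈ 𝓕, ∃ τ, IsFlat ε τ F

theorem FlatCover.union {ε : ℝ} {S S' : Set Plane} (h : FlatCover ε S) (h' : FlatCover ε S') :
    FlatCover ε (S ∪ S') := by
  obtain ⟨F, hF, hS, hf⟩ := h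
  obtain ⟨F', hF', hS', hf'⟩ := h'
  refine ⟨F ∪ F', hF.union hF', ?_, ?_⟩
  · rw [sUnion_union]; exact union_subset_union hS hS'
  · rintro A (hA | hA)
    exacts [hf A hA, hf' A hA]

theorem FlatCover.mono {ε : ℝ} {S S' : Set Plane} (h : FlatCover ε S) (hS : S' ⊆ S) :
    FlatCover ε S' := by
  obtain ⟨F, hF, hS', hf⟩ := h
  exact ⟨F, hF, hS.trans hS', hf⟩

theorem flatCover_empty (ε : ℝ) : FlatCover ε ∅ := ⟨∅, finite_empty, by simp, by simp⟩

theorem FlatCover.iUnion {ε : ℝ} {n : ℕ} {S : Fin n → Set Plane} (h : ∀ k, FlatCover ε (S k)) :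
    FlatCover ε (⋃ k, S k) := by
  choose F hF hS hf using h
  refine ⟨⋃ k, F k, finite_iUnion hF, ?_, ?_⟩
  · refine iUnion_subset fun k x hx => ?_
    obtain ⟨A, hA, hxA⟩ := hS k hx
    exact ⟨A, mem_iUnion.2 ⟨k, hA⟩, hxA⟩
  · intro A hA
    obtain ⟨k, hk⟩ := mem_iUnion.1 hA
    exact hf k A hk

/-- A regular arc of class `C¹` is nearly straight in the small. -/
theorem exists_isFlat_nhds {c : ℝ → Plane} (hc : ContDiffOn ℝ 2 c (Icc 0 1)) {ε : ℝ} (hε : 0 < ε)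
    {t : ℝ} (ht : t ∈ Icc (0 : ℝ) 1) (hne : derivWithin c (Icc 0 1) t ≠ 0) :
    ∃ U ∈ 𝓝[Icc 0 1] t, ∃ τ, IsFlat ε τ (c '' U) := by
  set w := derivWithin c (Icc 0 1) t with hw
  have hw0 : 0 < ‖w‖ := norm_pos_iff.2 hne
  -- Chosen so that ε(‖w‖ - η) = η: a secant has length at least (‖w‖ - η)|a - b| and deviates from
  -- the direction of w by at most η|a - b|.
  set η := ε * ‖w‖ / (1 + ε) with hη
  have hη0 : 0 < η := by positivity
  have hcont : ContinuousOn (derivWithin c (Icc 0 1)) (Icc 0 1) :=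
    hc.continuousOn_derivWithin (uniqueDiffOn_Icc zero_lt_one) (by norm_num)
  obtain ⟨δ, hδ, hball⟩ := Metric.continuousWithinAt_iff.1 (hcont t ht) η hη0
  set U := Icc (0 : ℝ) 1 ∩ Metric.ball t δ with hU
  have hUconv : Convex ℝ U := (convex_Icc 0 1).inter (convex_ball t δ)
  refine ⟨U, Filter.inter_mem self_mem_nhdsWithin
    (mem_nhdsWithin_of_mem_nhds (Metric.ball_mem_nhds t hδ)), ‖w‖⁻¹ • w, ?_, ?_⟩
  · rw [norm_smul, norm_inv, norm_norm, inv_mul_cancel₀ hw0.ne']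
  · rintro _ ⟨a, ha, rfl⟩ _ ⟨b, hb, rfl⟩
    have key : ‖(c a - a • w) - (c b - b • w)‖ ≤ η * ‖a - b‖ := by
      -- Mean value inequality for c(s) - s w, whose derivative has norm at most η on `U`.
      refine Convex.norm_image_sub_le_of_norm_hasDerivWithin_le (s := U)
        (f := fun s => c s - s • w) (f' := fun s => derivWithin c (Icc 0 1) s - (1 : ℝ) • w)
        (fun s hs => ?_) (fun s hs => ?_) hUconv hb ha
      · have h1 := ((hc.differentiableOn (by norm_num)) s hs.1).hasDerivWithinAt
        exact (h1.mono inter_subset_left).sub ((hasDerivAt_id s).smul_const w).hasDerivWithinAt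
      · have := hball hs.1 hs.2
        rw [dist_eq_norm] at this
        rw [one_smul]
        exact this.le
    have hsplit : c a - c b = (a - b) • w + ((c a - a • w) - (c b - b • w)) := by
      rw [sub_smul]; abel
    rw [cross_smul_left, abs_mul, abs_inv, abs_norm, inv_mul_le_iff₀ hw0]
    have h1 : |cross w (c a - c b)| ≤ ‖w‖ * (η * ‖a - b‖) := by
      have : cross w (c a - c b) = cross w ((c a - a • w) - (c b - b • w)) := by
        rw [hsplit]; simp [cross]; ring
      rw [this]
      exact (abs_cross_le _ _).trans (mul_le_mul_of_nonneg_left key hw0.le)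
    have h2 : ‖a - b‖ * ‖w‖ - η * ‖a - b‖ ≤ dist (c a) (c b) := by
      rw [dist_eq_norm, hsplit]
      have := norm_sub_norm_le ((a - b) • w) (-((c a - a • w) - (c b - b • w)))
      rw [norm_neg, sub_neg_eq_add, norm_smul] at this
      linarith
    refine h1.trans (mul_le_mul_of_nonneg_left ?_ hw0.le)
    have h3 : ε * (‖w‖ - η) = η := by rw [hη]; field_simp; ring
    calc η * ‖a - b‖ = ε * (‖a - b‖ * ‖w‖ - η * ‖a - b‖) := by
          linear_combination (-‖a - b‖) * h3
      _ ≤ _ := mul_le_mul_of_nonneg_left h2 hε.le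

/-- Local flatness plus compactness of each parameter interval; the number of flat sets depends on ε
and the curve only. -/
theorem IsPiecewiseC2Curve.flatCover {S : Set Plane} (hS : IsPiecewiseC2Curve S) {ε : ℝ}
    (hε : 0 < ε) : FlatCover ε S := by
  obtain ⟨n, c, hc, -, rfl⟩ := hS
  refine FlatCover.iUnion fun k => ?_
  refine isCompact_Icc.induction_on (p := fun U => FlatCover ε (c k '' U)) ?_ ?_ ?_ ?_
  · rw [image_empty]; exact flatCover_empty ε
  · intro s t hst ht
    exact ht.mono (image_mono hst)
  · intro s t hs ht
    rw [image_union]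
    exact hs.union ht
  · intro t ht
    obtain ⟨U, hU, τ, hτ⟩ := exists_isFlat_nhds (hc k).1 hε ht ((hc k).2.2 t ht)
    exact ⟨U, hU, {c k '' U}, finite_singleton _, by simp, by simpa using ⟨τ, hτ⟩⟩

/-! ### Charts and uniform cones of the interface -/

namespace InterfaceGeometry

variable (G : InterfaceGeometry)

theorem isOpen_sub (i : Fin 2) : IsOpen (G.sub i) := by
  fin_cases i
  · exact G.isOpen_Ω₁
  · exact G.isOpen_Ω.sdiff isClosed_closure

/-- Near an interface point the two subdomains lie below and above a Lipschitz graph. -/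
theorem exists_chart {x : Plane} (hx : x ∈ frontier G.Ω₁) :
    ∃ (e : Plane ≃ᵃⁱ[ℝ] Plane) (φ : ℝ → ℝ) (L : ℝ≥0) (r : ℝ), 0 < r ∧ LipschitzWith L φ ∧
      Metric.ball x r ⊆ G.Ω ∧ ∀ y ∈ Metric.ball x r,
        (y ∈ G.Ω₁ ↔ (e y) 1 < φ ((e y) 0)) ∧ (y ∈ frontier G.Ω₁ ↔ (e y) 1 = φ ((e y) 0)) ∧
        (y ∈ G.Ω \ closure G.Ω₁ ↔ φ ((e y) 0) < (e y) 1) := by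
  obtain ⟨e, φ, L, hφ, hev⟩ := G.lipschitz x hx
  have hxΩ : x ∈ G.Ω := G.closure_subset (frontier_subset_closure hx)
  have hevΩ : ∀ᶠ y in 𝓝 x, y ∈ G.Ω := G.isOpen_Ω.mem_nhds hxΩ
  obtain ⟨r, hr, hball⟩ := Metric.eventually_nhds_iff_ball.1
    (hev.and hevΩ)
  -- A point on or below the graph is a limit of points strictly below it, so it belongs to the
  -- closure of Ω₁; points strictly above have a neighbourhood free of Ω₁.
  have habove : ∀ y ∈ Metric.ball x r, (y ∈ G.Ω \ closure G.Ω₁ ↔ φ ((e y) 0) < (e y) 1) := by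
    intro y hy
    constructor
    · rintro ⟨-, hyc⟩
      by_contra hle
      push Not at hle
      refine hyc ?_
      rw [mem_closure_iff_nhds]
      intro U hU
      have hcont : ContinuousAt (fun s : ℝ => e.symm (e y + s • !₂[(0 : ℝ), -1])) 0 := by
        exact (e.symm.continuous.comp (by fun_prop)).continuousAt
      have h0 : e.symm (e y + (0 : ℝ) • !₂[(0 : ℝ), -1]) = y := by simp
      have hmem : ∀ᶠ s in 𝓝 (0 : ℝ), e.symm (e y + s • !₂[(0 : ℝ), -1]) ∈ U ∩ Metric.ball x r :=
        hcont.eventually_mem (by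
          simp only [h0]
          exact Filter.inter_mem hU (Metric.isOpen_ball.mem_nhds hy))
      obtain ⟨s, hs, hs0⟩ := ((hmem.filter_mono nhdsWithin_le_nhds).and
        (self_mem_nhdsWithin (a := (0 : ℝ)) (s := Ioi 0))).exists
      refine ⟨_, hs.1, ((hball _ hs.2).1).2 ?_⟩
      rw [e.apply_symm_apply]
      have : (0 : ℝ) < s := hs0
      simp
      linarith
    · intro hlt
      refine ⟨(hball y hy).2, fun hyc => ?_⟩
      have hopen : {z | φ ((e z) 0) < (e z) 1} ∈ 𝓝 y := by
        refine IsOpen.mem_nhds (isOpen_lt ?_ ?_) hlt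
        · exact hφ.continuous.comp ((by fun_prop : Continuous fun z : Plane => z 0).comp
            e.continuous)
        · exact (by fun_prop : Continuous fun z : Plane => z 1).comp e.continuous
      obtain ⟨z, hz, hzΩ⟩ := mem_closure_iff_nhds.1 hyc _
        (Filter.inter_mem hopen (Metric.isOpen_ball.mem_nhds hy))
      have h1 := ((hball z hz.2).1).1 hzΩ
      have h2 := hz.1
      simp only [mem_ofPred_eq] at h2
      linarith
  refine ⟨e, φ, L, r, hr, hφ, fun y hy => (hball y hy).2, fun y hy =>
    ⟨(hball y hy).1, ?_, habove y hy⟩⟩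
  have h1 := (hball y hy).1
  have h2 := habove y hy
  have h3 := (hball y hy).2
  rw [frontier, G.isOpen_Ω₁.interior_eq, mem_sdiff, h1]
  rw [mem_sdiff, and_iff_right h3] at h2
  constructor
  · rintro ⟨ha, hb⟩
    by_contra hne
    rcases lt_or_gt_of_ne hne with h | h
    · exact hb h
    · exact h2.2 h ha
  · intro h
    refine ⟨?_, h.not_lt⟩
    by_contra hc
    exact h.not_gt (h2.1 hc)

theorem chart_add (e : Plane ≃ᵃⁱ[ℝ] Plane) (y w : Plane) :
    e (y + w) = e y + e.linearIsometryEquiv w := by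
  have := e.map_vadd y w
  simpa [add_comm] using this

/-- A Lipschitz graph has points above it near each of its points, and these belong to Ω₂. So no
boundary point of Ω₁ is missed by Γ. -/
theorem frontier_eq : frontier G.Ω₁ = G.Γ := by
  refine subset_antisymm (fun x hx => ⟨hx, ?_⟩) fun x hx => hx.1
  obtain ⟨e, φ, L, r, hr, -, -, hch⟩ := G.exists_chart hx
  rw [(G.isOpen_sub 1).frontier_eq, mem_sdiff]
  refine ⟨?_, fun h => h.2 (frontier_subset_closure hx)⟩
  rw [mem_closure_iff_nhds]
  intro U hU
  set u := e.linearIsometryEquiv.symm (!₂[(0 : ℝ), 1]) with hu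
  have hcont : ContinuousAt (fun s : ℝ => x + s • u) 0 := by fun_prop
  have hmem : ∀ᶠ s in 𝓝 (0 : ℝ), x + s • u ∈ U ∩ Metric.ball x r :=
    hcont.eventually_mem (by
      simp only [zero_smul, add_zero]
      exact Filter.inter_mem hU (Metric.ball_mem_nhds x hr))
  obtain ⟨s, hs, hs0⟩ := ((hmem.filter_mono nhdsWithin_le_nhds).and
    (self_mem_nhdsWithin (a := (0 : ℝ)) (s := Ioi 0))).exists
  refine ⟨_, hs.1, ((hch _ hs.2).2.2).2 ?_⟩
  have h1 := ((hch x (Metric.mem_ball_self hr)).2.1).1 hx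
  have : (0 : ℝ) < s := hs0
  rw [chart_add, map_smul, hu, LinearIsometryEquiv.apply_symm_apply]
  simp
  linarith

/-- Uniform cones: `F` is a set of interface points with a common cone into `Ω₁` and a common
opposite cone into `Ω₂`. -/
def HasCone (α l : ℝ) (F : Set Plane) : Prop :=
  ∃ d : Plane, ‖d‖ = 1 ∧ ∀ x ∈ F, ∀ u, dist u d ≤ α → ∀ t ∈ Ioo (0 : ℝ) l,
    x + t • u ∈ G.sub 0 ∧ x - t • u ∈ G.sub 1

/-- In a chart, directions close to the downward vertical descend faster than the graph can, and
their opposites ascend faster. -/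
theorem exists_hasCone_nhds {x : Plane} (hx : x ∈ frontier G.Ω₁) :
    ∃ U ∈ 𝓝 x, ∃ α > 0, ∃ l > 0, G.HasCone α l (U ∩ frontier G.Ω₁) := by
  obtain ⟨e, φ, L, r, hr, hφ, -, hch⟩ := G.exists_chart hx
  have hL : (0 : ℝ) ≤ L := L.2
  -- With α(1+L) = 1/2 a step t lowers the second coordinate by at least t(1-α), while the graph
  -- falls by at most tLα < t(1-α). The length r/4 and ‖u‖ ≤ 2 keep the segments in the chart.
  set α : ℝ := 1 / (2 * (1 + L)) with hα
  have hα0 : 0 < α := by positivity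
  have hαL : α * (1 + L) = 1 / 2 := by rw [hα]; field_simp
  have hα1 : α ≤ 1 := by nlinarith
  refine ⟨Metric.ball x (r / 2), Metric.ball_mem_nhds x (by positivity), α, hα0, r / 4,
    by positivity, e.linearIsometryEquiv.symm (!₂[(0 : ℝ), -1]), ?_, ?_⟩
  · rw [LinearIsometryEquiv.norm_map, EuclideanSpace.norm_eq]
    simp
  · rintro y ⟨hy, hyF⟩ u hu t ht
    have hun : ‖u‖ ≤ 2 := by
      have h1 : ‖(e.linearIsometryEquiv.symm (!₂[(0 : ℝ), -1]) : Plane)‖ = 1 := by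
        rw [LinearIsometryEquiv.norm_map, EuclideanSpace.norm_eq]
        simp
      have h2 := norm_le_norm_add_norm_sub' u (e.linearIsometryEquiv.symm (!₂[(0 : ℝ), -1]))
      rw [dist_eq_norm] at hu
      linarith
    have htu : ‖t • u‖ < r / 2 := by
      rw [norm_smul, Real.norm_of_nonneg ht.1.le]
      nlinarith [ht.1, ht.2]
    have hyr : y ∈ Metric.ball x r := Metric.ball_subset_ball (by linarith) hy
    have hmem : ∀ w : Plane, ‖w‖ < r / 2 → y + w ∈ Metric.ball x r := by
      intro w hw
      rw [Metric.mem_ball] at hy ⊢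
      calc dist (y + w) x ≤ dist (y + w) y + dist y x := dist_triangle _ _ _
        _ < r := by rw [dist_self_add_left]; linarith
    have hgraph := ((hch y hyr).2.1).1 hyF
    set w := e.linearIsometryEquiv u with hw
    have hwd : ‖w - !₂[(0 : ℝ), -1]‖ ≤ α := by
      rw [dist_eq_norm] at hu
      rw [← LinearIsometryEquiv.norm_map e.linearIsometryEquiv, map_sub,
        LinearIsometryEquiv.apply_symm_apply] at hu
      exact hu
    have hw0 : |w 0| ≤ α := by
      have := (PiLp.norm_apply_le (w - !₂[(0 : ℝ), -1]) 0).trans hwd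
      simpa using this
    have hw1 : w 1 ≤ -1 + α := by
      have := (PiLp.norm_apply_le (w - !₂[(0 : ℝ), -1]) 1).trans hwd
      simp only [PiLp.sub_apply, Real.norm_eq_abs] at this
      have := (abs_le.1 this).2
      simp at this
      linarith
    have hlip : ∀ s : ℝ, |φ ((e y) 0 + s * w 0) - φ ((e y) 0)| ≤ L * (|s| * α) := by
      intro s
      have := hφ.dist_le_mul ((e y) 0 + s * w 0) ((e y) 0)
      rw [Real.dist_eq, dist_self_add_left, Real.norm_eq_abs, abs_mul] at this
      exact this.trans (mul_le_mul_of_nonneg_left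
        (mul_le_mul_of_nonneg_left hw0 (abs_nonneg s)) hL)
    constructor
    · refine ((hch _ (hmem _ htu)).1).2 ?_
      rw [chart_add, map_smul, ← hw]
      simp only [PiLp.add_apply, PiLp.smul_apply, smul_eq_mul]
      have := (abs_le.1 (hlip t)).1
      rw [abs_of_pos ht.1] at this
      nlinarith [ht.1]
    · refine ((hch _ (by
        rw [sub_eq_add_neg]; exact hmem _ (by rwa [norm_neg]))).2.2).2 ?_
      rw [sub_eq_add_neg, ← neg_smul, chart_add, map_smul, ← hw]
      simp only [PiLp.add_apply, PiLp.smul_apply, smul_eq_mul]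
      have := (abs_le.1 (hlip (-t))).2
      rw [abs_neg, abs_of_pos ht.1] at this
      nlinarith [ht.1]

/-- Compactness of ∂Ω₁ makes opening and length of the cones uniform: finitely many local constants,
of which the minimum is taken. -/
theorem exists_cone_cover :
    ∃ 𝓕 : Set (Set Plane), ∃ α > 0, ∃ l > 0, 𝓕.Finite ∧ G.Γ ⊆ ⋃₀ 𝓕 ∧
      ∀ F ∈ 𝓕, G.HasCone α l F := by
  have hcomp : IsCompact (frontier G.Ω₁) := by
    refine Metric.isCompact_of_isClosed_isBounded isClosed_frontier ?_
    exact G.isBounded_Ω.subset (frontier_subset_closure.trans G.closure_subset)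
  rw [← G.frontier_eq]
  refine hcomp.induction_on (p := fun U => ∃ 𝓕 : Set (Set Plane), ∃ α > 0, ∃ l > 0, 𝓕.Finite ∧
    U ⊆ ⋃₀ 𝓕 ∧ ∀ F ∈ 𝓕, G.HasCone α l F) ?_ ?_ ?_ ?_
  · exact ⟨∅, 1, one_pos, 1, one_pos, finite_empty, by simp, by simp⟩
  · rintro s t hst ⟨F, α, hα, l, hl, hF, hcov, hcone⟩
    exact ⟨F, α, hα, l, hl, hF, hst.trans hcov, hcone⟩
  · rintro s t ⟨F, α, hα, l, hl, hF, hcov, hcone⟩ ⟨F', α', hα', l', hl', hF', hcov', hcone'⟩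
    refine ⟨F ∪ F', min α α', lt_min hα hα', min l l', lt_min hl hl', hF.union hF', ?_, ?_⟩
    · rw [sUnion_union]; exact union_subset_union hcov hcov'
    · rintro A (hA | hA)
      · obtain ⟨d, hd, h⟩ := hcone A hA
        exact ⟨d, hd, fun x hx u hu t ht => h x hx u (hu.trans (min_le_left _ _)) t
          ⟨ht.1, ht.2.trans_le (min_le_left _ _)⟩⟩
      · obtain ⟨d, hd, h⟩ := hcone' A hA
        exact ⟨d, hd, fun x hx u hu t ht => h x hx u (hu.trans (min_le_right _ _)) t
          ⟨ht.1, ht.2.trans_le (min_le_right _ _)⟩⟩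
  · intro x hx
    obtain ⟨U, hU, α, hα, l, hl, hc⟩ := G.exists_hasCone_nhds hx
    refine ⟨U ∩ frontier G.Ω₁, ?_, {U ∩ frontier G.Ω₁}, α, hα, l, hl, finite_singleton _,
      by simp, by simpa using hc⟩
    exact Filter.inter_mem (mem_nhdsWithin_of_mem_nhds hU) self_mem_nhdsWithin

end InterfaceGeometry

/-! ### Trace inequality for flat curves on the boundary of convex sets -/

theorem lintegral_le_of_iUnion {ι : Type*} [Fintype ι] {μ : Measure Plane} {S : Set Plane}
    {F : ι → Set Plane} (hS : S ⊆ ⋃ i, F i) {f : Plane → ℝ≥0∞} {M : ℝ≥0∞}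
    (hM : ∀ i, ∫⁻ x in S ∩ F i, f x ∂μ ≤ M) :
    ∫⁻ x in S, f x ∂μ ≤ Fintype.card ι * M := by
  calc ∫⁻ x in S, f x ∂μ ≤ ∫⁻ x in ⋃ i, S ∩ F i, f x ∂μ := by
        refine lintegral_mono_set ?_
        rw [← inter_iUnion]
        exact subset_inter le_rfl hS
    _ ≤ ∑' i, ∫⁻ x in S ∩ F i, f x ∂μ := lintegral_iUnion_le _ _
    _ ≤ ∑' _ : ι, M := ENNReal.tsum_le_tsum hM
    _ = Fintype.card ι * M := by
        rw [tsum_fintype, Finset.sum_const, Finset.card_univ, nsmul_eq_mul]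

theorem lintegral_le_of_sUnion {μ : Measure Plane} {S : Set Plane} {𝓕 : Set (Set Plane)}
    (h𝓕 : 𝓕.Finite) (hS : S ⊆ ⋃₀ 𝓕) {f : Plane → ℝ≥0∞} {M : ℝ≥0∞}
    (hM : ∀ F ∈ 𝓕, ∫⁻ x in S ∩ F, f x ∂μ ≤ M) :
    ∫⁻ x in S, f x ∂μ ≤ 𝓕.ncard * M := by
  have := h𝓕.fintype
  have h := lintegral_le_of_iUnion (μ := μ) (S := S) (F := fun F : 𝓕 => (F : Set Plane))
    (by rwa [← sUnion_eq_iUnion]) (f := f) (M := M) fun F => hM F F.2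
  rwa [← Nat.card_eq_fintype_card, Nat.card_coe_set_eq] at h

/-- A direction transversal to the axis of a flat set is transversal to its secants. -/
theorem le_abs_cross_of_flat {τ d w : Plane} {ε c : ℝ} (hτ : ‖τ‖ = 1)
    (hw : |cross τ w| ≤ ε * ‖w‖) (hε : ε ≤ 1 / 2) (hc : c ≤ |cross τ d|)
    (hd : ε * ‖d‖ ≤ c / 4) : c / 4 * ‖w‖ ≤ |cross d w| := by
  have hτ2 : τ 0 ^ 2 + τ 1 ^ 2 = 1 := by rw [normSq_eq, hτ]; norm_num
  set a := τ 0 * w 0 + τ 1 * w 1 with ha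
  -- In the orthonormal frame of τ the vector w has components a and `cross τ w`. The second is at
  -- most ‖w‖/2, so |a| ≥ ‖w‖/2, and the product of a with the transversal part of d dominates.
  have hab : a ^ 2 + cross τ w ^ 2 = ‖w‖ ^ 2 := by
    rw [← normSq_eq w, ha, cross]
    linear_combination (w 0 ^ 2 + w 1 ^ 2) * hτ2
  have hsplit : cross d w = -(a * cross τ d) + cross τ w * (τ 0 * d 0 + τ 1 * d 1) := by
    simp only [cross, ha]
    linear_combination (d 0 * w 1 - d 1 * w 0) * (-hτ2)
  have hdot : |τ 0 * d 0 + τ 1 * d 1| ≤ ‖d‖ := by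
    refine abs_le_of_sq_le_sq ?_ (norm_nonneg _)
    rw [← normSq_eq d]
    nlinarith [sq_nonneg (τ 0 * d 1 - τ 1 * d 0)]
  have hw0 := norm_nonneg w
  have hhalf : |cross τ w| ≤ ‖w‖ / 2 := hw.trans (by nlinarith)
  have ha2 : ‖w‖ / 2 ≤ |a| := by
    refine le_of_sq_le_sq ?_ (abs_nonneg a)
    rw [sq_abs]
    nlinarith [sq_abs (cross τ w), abs_nonneg (cross τ w)]
  have h1 : |a * cross τ d| - |cross τ w * (τ 0 * d 0 + τ 1 * d 1)| ≤ |cross d w| := by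
    rw [hsplit]
    have := abs_sub_abs_le_abs_sub (cross τ w * (τ 0 * d 0 + τ 1 * d 1)) (a * cross τ d)
    have h2 := abs_sub_abs_le_abs_sub (a * cross τ d) (cross τ w * (τ 0 * d 0 + τ 1 * d 1))
    rw [abs_sub_comm] at h2
    rw [neg_add_eq_sub]
    exact h2
  rw [abs_mul, abs_mul] at h1
  have h3 : ‖w‖ / 2 * c ≤ |a| * |cross τ d| := by
    rcases le_or_gt c 0 with h | h
    · have : 0 ≤ |a| * |cross τ d| := by positivity
      nlinarith
    · exact mul_le_mul ha2 hc h.le (abs_nonneg a)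
  have h4 : |cross τ w| * |τ 0 * d 0 + τ 1 * d 1| ≤ c / 4 * ‖w‖ := by
    calc _ ≤ (ε * ‖w‖) * ‖d‖ := mul_le_mul hw hdot (abs_nonneg _) ((abs_nonneg _).trans hw)
      _ = (ε * ‖d‖) * ‖w‖ := by ring
      _ ≤ _ := mul_le_mul_of_nonneg_right hd hw0
  linarith

theorem norm_le_abs_add_abs (x : Plane) : ‖x‖ ≤ |x 0| + |x 1| := by
  refine le_of_sq_le_sq ?_ (by positivity)
  rw [← normSq_eq, ← sq_abs (x 0), ← sq_abs (x 1)]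
  nlinarith [abs_nonneg (x 0), abs_nonneg (x 1)]

/-- The constant in the inverse trace inequality for a convex domain of fatness `c`. -/
def convexConst (c : ℝ) : ℝ := 400 / c * (⌈4 / c⌉₊ + 2) ^ 2

theorem convexConst_pos {c : ℝ} (hc : 0 < c) : 0 < convexConst c := by
  unfold convexConst; positivity

/-- A single direction d serves all of S: it leads from one point of S to a point z' at distance r/2
from the centre z. As S has diameter less than r/2, every x + d stays in the ball, and convexity
puts the open segment into E. -/
theorem lintegral_curve_le_of_small {p : ℕ} (hp : 1 ≤ p) {v : Plane → ℝ} (hv : v ∈ Qp p)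
    {E S : Set Plane} (hEo : IsOpen E) (hEc : Convex ℝ E) {z : Plane} {r : ℝ} (hr : 0 < r)
    (hball : Metric.ball z r ⊆ E) (hSE : S ⊆ closure E) {τ : Plane} {ε : ℝ} (hflat : IsFlat ε τ S)
    (hε : ε ≤ 1 / 2) (hε0 : 0 ≤ ε) {H : ℝ} (hH : ∀ x ∈ S, dist z x ≤ H)
    (hεH : ε * (r / 2 + H) ≤ r / 8) (hdiam : ∀ x ∈ S, ∀ y ∈ S, dist x y < r / 2) :
    ∫⁻ x in S, sqE v x ∂μH[1] ≤ ENNReal.ofReal (400 * p ^ 2 / r) * ∫⁻ x in E, sqE v x := by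
  rcases S.eq_empty_or_nonempty with rfl | ⟨x₀, hx₀⟩
  · simp
  have hτ2 : τ 0 ^ 2 + τ 1 ^ 2 = 1 := by rw [normSq_eq, hflat.1]; norm_num
  set J : Plane := !₂[-τ 1, τ 0] with hJ
  have hJn : ‖J‖ = 1 := by
    have h := normSq_eq J
    simp [hJ] at h
    rw [← hJ] at h
    have h2 : ‖J‖ ^ 2 = 1 := by rw [← h]; linarith
    nlinarith [norm_nonneg J]
  -- The shift of z along the normal `J` is taken on the side away from the line through x₀, which
  -- makes the normal component of d at least r/2 wherever z lies.
  obtain ⟨σ, hσ1, hσ⟩ : ∃ σ : ℝ, |σ| = 1 ∧ r / 2 ≤ |cross τ (z + (σ * (r / 2)) • J - x₀)| := by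
    have hc : ∀ σ : ℝ, cross τ (z + (σ * (r / 2)) • J - x₀) = cross τ (z - x₀) + σ * (r / 2) := by
      intro σ
      simp [cross, hJ]
      linear_combination (σ * (r / 2)) * hτ2
    rcases le_total 0 (cross τ (z - x₀)) with h | h
    · refine ⟨1, by simp, ?_⟩
      rw [hc, abs_of_nonneg (by linarith)]
      linarith
    · refine ⟨-1, by simp, ?_⟩
      rw [hc, abs_of_nonpos (by linarith)]
      linarith
  set z' := z + (σ * (r / 2)) • J with hz'
  have hz'z : dist z' z = r / 2 := by
    rw [hz', dist_self_add_left, norm_smul, hJn, Real.norm_eq_abs, abs_mul, hσ1,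
      abs_of_pos (by positivity)]
    ring
  have h := lintegral_curve_le hp hv (S := S) hEo.measurableSet (d := z' - x₀) (κ := r / 8)
    (by positivity) (fun x hx y hy => ?_) (fun x hx t ht => ?_)
  · refine h.trans (le_of_eq ?_)
    congr 2
    field_simp; norm_num
  · have hd : ‖z' - x₀‖ ≤ r / 2 + H := by
      rw [← dist_eq_norm]
      calc dist z' x₀ ≤ dist z' z + dist z x₀ := dist_triangle _ _ _
        _ ≤ _ := by rw [hz'z]; linarith [hH x₀ hx₀]
    have h2 := le_abs_cross_of_flat (d := z' - x₀) (w := x - y) (c := r / 2) hflat.1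
      (by rw [← dist_eq_norm]; exact hflat.2 x hx y hy) hε hσ
      ((mul_le_mul_of_nonneg_left hd hε0).trans (by linarith))
    rw [dist_eq_norm]
    linarith
  · have hmem : x + (z' - x₀) ∈ Metric.ball z r := by
      rw [Metric.mem_ball]
      calc dist (x + (z' - x₀)) z ≤ dist (x + (z' - x₀)) z' + dist z' z := dist_triangle _ _ _
        _ < r := by
          have : dist (x + (z' - x₀)) z' = dist x x₀ := by
            rw [dist_eq_norm, dist_eq_norm]; congr 1; abel
          rw [this, hz'z]
          linarith [hdiam x hx x₀ hx₀]
    have hint : x + (z' - x₀) ∈ interior E := by rw [hEo.interior_eq]; exact hball hmem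
    have := hEc.combo_closure_interior_mem_interior (hSE hx) hint (a := 1 - t) (b := t)
      (by linarith [ht.2]) ht.1 (by ring)
    rw [hEo.interior_eq] at this
    convert! this using 1
    module

/-- The inverse trace inequality for a flat curve in the closure of a convex domain. -/
theorem lintegral_curve_le_of_convex {p : ℕ} (hp : 1 ≤ p) {v : Plane → ℝ} (hv : v ∈ Qp p)
    {E S : Set Plane} (hEo : IsOpen E) (hEc : Convex ℝ E) {z : Plane} {c h : ℝ} (hc : 0 < c)
    (hc1 : c ≤ 1) (hh : 0 < h) (hball : Metric.ball z (c * h) ⊆ E) {lo : Fin 2 → ℝ}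
    (hbox : ∀ x ∈ E, ∀ j, x j ∈ Icc (lo j) (lo j + h)) (hSE : S ⊆ closure E) {τ : Plane} {ε : ℝ}
    (hflat : IsFlat ε τ S) (hε0 : 0 ≤ ε) (hε : ε ≤ c / 24) :
    ∫⁻ x in S, sqE v x ∂μH[1] ≤
      ENNReal.ofReal (convexConst c * p ^ 2 / h) * ∫⁻ x in E, sqE v x := by
  have hbox' : ∀ x ∈ closure E, ∀ j, x j ∈ Icc (lo j) (lo j + h) := by
    intro x hx j
    have hcl : IsClosed {x : Plane | x j ∈ Icc (lo j) (lo j + h)} :=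
      isClosed_Icc.preimage (by fun_prop : Continuous fun x : Plane => x j)
    exact closure_minimal (fun y hy => hbox y hy j) hcl hx
  have hz : z ∈ E := hball (Metric.mem_ball_self (by positivity))
  -- More than 4/c cells in each direction make the cell sides shorter than ch/4, so that a cell has
  -- diameter less than ch/2.
  set m : ℕ := ⌈4 / c⌉₊ + 1 with hm
  have hm0 : (0 : ℝ) < m := by rw [hm]; positivity
  have hmc : 4 < m * c := by
    have h1 : 4 / c ≤ ⌈4 / c⌉₊ := Nat.le_ceil _
    have h2 : 4 / c < m := by rw [hm]; push_cast; linarith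
    rwa [div_lt_iff₀ hc] at h2
  -- Indices run up to m inclusive, since a point on the upper edge of the bounding square has index
  -- m.
  set cell : Fin (m + 1) × Fin (m + 1) → Set Plane := fun q =>
    {x | ⌊m * (x 0 - lo 0) / h⌋₊ = q.1 ∧ ⌊m * (x 1 - lo 1) / h⌋₊ = q.2} with hcell
  have hcover : S ⊆ ⋃ q, cell q := by
    intro x hx
    have hlt : ∀ j, ⌊m * (x j - lo j) / h⌋₊ < m + 1 := by
      intro j
      have hxj := hbox' x (hSE hx) j
      refine Nat.lt_succ_iff.2 (Nat.floor_le_of_le ?_)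
      rw [div_le_iff₀ hh]
      exact mul_le_mul_of_nonneg_left (by linarith [hxj.2]) hm0.le
    exact mem_iUnion.2 ⟨(⟨_, hlt 0⟩, ⟨_, hlt 1⟩), rfl, rfl⟩
  have hcoord : ∀ x ∈ S, ∀ y ∈ S, ∀ j, ⌊m * (x j - lo j) / h⌋₊ = ⌊m * (y j - lo j) / h⌋₊ →
      |x j - y j| < c * h / 4 := by
    intro x hx y hy j hfl
    have hnn : ∀ x ∈ S, 0 ≤ m * (x j - lo j) / h := fun x hx => by
      have := (hbox' x (hSE hx) j).1
      have : 0 ≤ x j - lo j := by linarith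
      positivity
    have h1 := Nat.floor_le (hnn x hx)
    have h2 := Nat.lt_floor_add_one (m * (x j - lo j) / h)
    have h3 := Nat.floor_le (hnn y hy)
    have h4 := Nat.lt_floor_add_one (m * (y j - lo j) / h)
    rw [hfl] at h1 h2
    have h5 : |m * (x j - lo j) / h - m * (y j - lo j) / h| < 1 := by
      rw [abs_lt]; constructor <;> linarith
    have h6 : m * (x j - lo j) / h - m * (y j - lo j) / h = m / h * (x j - y j) := by ring
    rw [h6, abs_mul, abs_of_pos (by positivity : 0 < m / h)] at h5
    have h7 : |x j - y j| < h / m := by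
      rw [lt_div_iff₀ hm0]
      rw [div_mul_eq_mul_div, div_lt_one hh] at h5
      linarith
    refine h7.trans_le ?_
    rw [div_le_iff₀ hm0]
    nlinarith
  have hM : ∀ q, ∫⁻ x in S ∩ cell q, sqE v x ∂μH[1] ≤
      ENNReal.ofReal (400 * p ^ 2 / (c * h)) * ∫⁻ x in E, sqE v x := by
    intro q
    refine lintegral_curve_le_of_small hp hv hEo hEc (by positivity) hball
      (inter_subset_left.trans hSE) (hflat.mono le_rfl inter_subset_left) (by linarith) hε0
      (H := 2 * h) ?_ ?_ ?_
    · rintro x ⟨hx, -⟩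
      rw [dist_eq_norm]
      refine (norm_le_abs_add_abs _).trans ?_
      have hj : ∀ j, |(z - x) j| ≤ h := fun j => by
        have h1 := hbox z hz j
        have h2 := hbox' x (hSE hx) j
        rw [PiLp.sub_apply, abs_le]
        constructor <;> linarith [h1.1, h1.2, h2.1, h2.2]
      linarith [hj 0, hj 1]
    · have : c * h / 2 + 2 * h ≤ 3 * h := by nlinarith
      calc ε * (c * h / 2 + 2 * h) ≤ c / 24 * (3 * h) :=
            mul_le_mul hε this (by positivity) (by positivity)
        _ = c * h / 8 := by ring
    · rintro x ⟨hx, hxq⟩ y ⟨hy, hyq⟩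
      have hxq' := hxq
      have hyq' := hyq
      simp only [hcell, mem_ofPred_eq] at hxq' hyq'
      have h0 := hcoord x hx y hy 0 (hxq'.1.trans hyq'.1.symm)
      have h1 := hcoord x hx y hy 1 (hxq'.2.trans hyq'.2.symm)
      rw [dist_eq_norm]
      refine (norm_le_abs_add_abs _).trans_lt ?_
      simp only [PiLp.sub_apply]
      linarith
  refine (lintegral_le_of_iUnion hcover hM).trans (le_of_eq ?_)
  rw [← mul_assoc]
  congr 1
  rw [← ENNReal.ofReal_natCast, ← ENNReal.ofReal_mul (by positivity)]
  congr 1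
  rw [Fintype.card_prod, Fintype.card_fin, convexConst, hm]
  push_cast
  field_simp
  ring

/-! ### Rectangles in the coordinates given by the distances from the sides -/

namespace Rect

variable (K : Rect)

/-- The signed distance from a side, positive inside. -/
def depth (s : Fin 2 × Bool) (y : Plane) : ℝ := if s.2 then K.hi s.1 - y s.1 else y s.1 - K.lo s.1

theorem depth_false (j : Fin 2) (y : Plane) : K.depth (j, false) y = y j - K.lo j := rfl

theorem depth_true (j : Fin 2) (y : Plane) : K.depth (j, true) y = K.hi j - y j := rfl

theorem width_pos (j : Fin 2) : 0 < K.width j := sub_pos.2 (K.lo_lt_hi j)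

theorem depth_add_depth {s s' : Fin 2 × Bool} (h : s'.1 = s.1) (hne : s' ≠ s) (y : Plane) :
    K.depth s y + K.depth s' y = K.width s.1 := by
  obtain ⟨j, b⟩ := s
  obtain ⟨j', b'⟩ := s'
  simp only at h
  subst h
  cases b <;> cases b' <;> simp_all [depth, width]

theorem continuous_depth (s : Fin 2 × Bool) : Continuous (K.depth s) := by
  unfold depth
  split_ifs <;> fun_prop

theorem depth_combo (s : Fin 2 × Bool) (x y : Plane) {a b : ℝ} (hab : a + b = 1) :
    K.depth s (a • x + b • y) = a * K.depth s x + b * K.depth s y := by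
  unfold depth
  split_ifs <;> simp
  · linear_combination (-K.hi s.1) * hab
  · linear_combination (K.lo s.1) * hab

theorem abs_depth_sub_le (s : Fin 2 × Bool) (x y : Plane) :
    |K.depth s x - K.depth s y| ≤ dist x y := by
  have h := PiLp.norm_apply_le (x - y) s.1
  rw [← dist_eq_norm, PiLp.sub_apply, Real.norm_eq_abs] at h
  unfold depth
  split_ifs
  · rw [abs_sub_comm] at h
    convert! h using 2
    ring
  · convert! h using 2
    ring

theorem mem_set_iff {y : Plane} : y ∈ K.set ↔ ∀ s, 0 < K.depth s y := by
  constructor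
  · rintro h ⟨j, b⟩
    have := h j
    cases b
    · rw [depth_false]; linarith [this.1]
    · rw [depth_true]; linarith [this.2]
  · intro h j
    have h1 := h (j, false)
    have h2 := h (j, true)
    rw [depth_false] at h1
    rw [depth_true] at h2
    exact ⟨by linarith, by linarith⟩

theorem isOpen_set : IsOpen K.set := by
  have : K.set = ⋂ s, {y | 0 < K.depth s y} := by
    ext y; rw [mem_set_iff]; simp
  rw [this]
  exact isOpen_iInter_of_finite fun s => isOpen_lt continuous_const (K.continuous_depth s)

theorem convex_set : Convex ℝ K.set := by
  intro x hx y hy a b ha hb hab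
  rw [mem_set_iff] at *
  intro s
  rw [depth_combo K s x y hab]
  rcases ha.eq_or_lt with rfl | ha
  · have : b = 1 := by linarith
    rw [this]; linarith [hy s]
  · have := mul_pos ha (hx s)
    have := mul_nonneg hb (hy s).le
    linarith

/-- The centre. -/
def center : Plane := WithLp.toLp 2 fun j => (K.lo j + K.hi j) / 2

theorem depth_center (s : Fin 2 × Bool) : K.depth s K.center = K.width s.1 / 2 := by
  unfold depth center width
  split_ifs <;> simp <;> ring

theorem center_mem : K.center ∈ K.set := by
  rw [mem_set_iff]
  intro s
  rw [depth_center]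
  linarith [K.width_pos s.1]

theorem mem_closure_iff {y : Plane} : y ∈ closure K.set ↔ ∀ s, 0 ≤ K.depth s y := by
  constructor
  · intro h s
    have hcl : IsClosed {y | 0 ≤ K.depth s y} := isClosed_le continuous_const (K.continuous_depth s)
    exact closure_minimal (fun y hy => ((K.mem_set_iff.1 hy) s).le) hcl h
  · intro h
    refine mem_closure_of_tendsto (b := 𝓝[>] (0 : ℝ))
      (f := fun t => (1 - t) • y + t • K.center) ?_ ?_
    · have : ContinuousAt (fun t : ℝ => (1 - t) • y + t • K.center) 0 := by fun_prop
      have h := this.tendsto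
      simp only [sub_zero, one_smul, zero_smul, add_zero] at h
      exact h.mono_left nhdsWithin_le_nhds
    · filter_upwards [Ioo_mem_nhdsGT (zero_lt_one (α := ℝ))] with t ht
      rw [mem_set_iff]
      intro s
      rw [depth_combo K s _ _ (by ring), depth_center]
      have := K.width_pos s.1
      have h1 : 0 ≤ (1 - t) * K.depth s y := mul_nonneg (by linarith [ht.2]) (h s)
      have h2 : 0 < t * (K.width s.1 / 2) := mul_pos ht.1 (by linarith)
      linarith

theorem mem_frontier_iff {y : Plane} :
    y ∈ frontier K.set ↔ (∀ s, 0 ≤ K.depth s y) ∧ ∃ s, K.depth s y = 0 := by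
  rw [frontier, K.isOpen_set.interior_eq, mem_sdiff, mem_closure_iff, mem_set_iff]
  constructor
  · rintro ⟨h1, h2⟩
    push Not at h2
    obtain ⟨s, hs⟩ := h2
    exact ⟨h1, s, le_antisymm hs (h1 s)⟩
  · rintro ⟨h1, s, hs⟩
    exact ⟨h1, fun h => (h s).ne' hs⟩

theorem isBounded_set : Bornology.IsBounded K.set := by
  refine (Metric.isBounded_closedBall (x := K.center) (r := K.width 0 + K.width 1)).subset ?_
  intro y hy
  rw [Metric.mem_closedBall, dist_eq_norm]
  refine (norm_le_abs_add_abs _).trans ?_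
  have hj : ∀ j, |(y - K.center) j| ≤ K.width j := fun j => by
    have := hy j
    simp only [center, PiLp.sub_apply, width]
    rw [abs_le]
    constructor <;> linarith [this.1, this.2]
  linarith [hj 0, hj 1]

theorem dist_le_h {x y : Plane} (hx : x ∈ closure K.set) (hy : y ∈ closure K.set) :
    dist x y ≤ K.h := by
  rw [h, ← Metric.diam_closure]
  exact Metric.dist_le_diam_of_mem K.isBounded_set.closure hx hy

theorem width_le_h (j : Fin 2) : K.width j ≤ K.h := by
  set x : Plane := WithLp.toLp 2 K.lo with hx
  set y : Plane := WithLp.toLp 2 (Function.update K.lo j (K.hi j)) with hy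
  have hxm : x ∈ closure K.set := by
    rw [mem_closure_iff]
    rintro ⟨k, b⟩
    cases b
    · simp [depth_false, hx]
    · simpa [depth_true, hx] using (K.lo_lt_hi k).le
  have hym : y ∈ closure K.set := by
    rw [mem_closure_iff]
    rintro ⟨k, b⟩
    rcases eq_or_ne k j with rfl | hkj
    · cases b
      · simpa [depth_false, hy] using (K.lo_lt_hi k).le
      · simp [depth_true, hy]
    · cases b
      · simp [depth_false, hy, hkj]
      · simpa [depth_true, hy, hkj] using (K.lo_lt_hi k).le
  have h1 := K.dist_le_h hym hxm
  have h2 := PiLp.norm_apply_le (y - x) j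
  rw [← dist_eq_norm] at h2
  simp only [PiLp.sub_apply, hx, hy, Function.update_self, Real.norm_eq_abs] at h2
  exact (le_abs_self _).trans (h2.trans h1)

theorem h_pos : 0 < K.h := (K.width_pos 0).trans_le (K.width_le_h 0)

theorem h_le : K.h ≤ K.width 0 + K.width 1 := by
  rw [h]
  refine Metric.diam_le_of_forall_dist_le
    (by linarith [K.width_pos 0, K.width_pos 1]) fun x hx y hy => ?_
  rw [dist_eq_norm]
  refine (norm_le_abs_add_abs _).trans ?_
  have hj : ∀ j, |(x - y) j| ≤ K.width j := fun j => by
    have h1 := hx j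
    have h2 := hy j
    simp only [PiLp.sub_apply, width]
    rw [abs_le]
    constructor <;> linarith [h1.1, h1.2, h2.1, h2.2]
  linarith [hj 0, hj 1]

theorem depth_le_h (s : Fin 2 × Bool) {y : Plane} (hy : y ∈ closure K.set) : K.depth s y ≤ K.h := by
  obtain ⟨j, b⟩ := s
  have h0 := (K.mem_closure_iff.1 hy) (j, !b)
  have := K.depth_add_depth (s := (j, b)) (s' := (j, !b)) rfl (by simp) y
  exact (by linarith : _ ≤ K.width j).trans (K.width_le_h j)

theorem mem_openSide_iff {s : Fin 2 × Bool} {y : Plane} :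
    y ∈ K.openSide s ↔ K.depth s y = 0 ∧ ∀ s', s' ≠ s → 0 < K.depth s' y := by
  obtain ⟨j, b⟩ := s
  constructor
  · rintro ⟨h1, h2⟩
    have hd : K.depth (j, b) y = 0 := by
      unfold depth
      simp only [sideCoord] at h1
      cases b <;> simp_all
    refine ⟨hd, ?_⟩
    rintro ⟨k, b'⟩ hne
    rcases eq_or_ne k j with rfl | hkj
    · have := K.depth_add_depth (s := (k, b)) (s' := (k, b')) rfl hne y
      have := K.width_pos k
      simp only at *
      linarith
    · have := h2 k hkj
      cases b'
      · rw [depth_false]; linarith [this.1]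
      · rw [depth_true]; linarith [this.2]
  · rintro ⟨h1, h2⟩
    refine ⟨?_, fun k hk => ?_⟩
    · unfold depth at h1
      simp only [sideCoord]
      cases b <;> simp_all <;> linarith
    · have ha := h2 (k, false) (by simp at hk; simp [hk])
      have hb := h2 (k, true) (by simp at hk; simp [hk])
      rw [depth_false] at ha
      rw [depth_true] at hb
      exact ⟨by linarith, by linarith⟩

theorem mem_side_iff {s : Fin 2 × Bool} {y : Plane} :
    y ∈ K.side s ↔ y ∈ closure K.set ∧ K.depth s y = 0 := by
  obtain ⟨j, b⟩ := s
  rw [mem_closure_iff]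
  constructor
  · rintro ⟨h1, h2⟩
    have hd : K.depth (j, b) y = 0 := by
      unfold depth
      simp only [sideCoord] at h1
      cases b <;> simp_all
    refine ⟨?_, hd⟩
    rintro ⟨k, b'⟩
    rcases eq_or_ne k j with rfl | hkj
    · rcases eq_or_ne b' b with rfl | hb
      · exact hd.ge
      · have := K.depth_add_depth (s := (k, b)) (s' := (k, b')) rfl (by simp [hb]) y
        have := K.width_pos k
        simp only at *
        linarith
    · have := h2 k hkj
      cases b'
      · rw [depth_false]; linarith [this.1]
      · rw [depth_true]; linarith [this.2]
  · rintro ⟨h1, h2⟩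
    refine ⟨?_, fun k hk => ?_⟩
    · unfold depth at h2
      simp only [sideCoord]
      cases b <;> simp_all <;> linarith
    · have ha := h1 (k, false)
      have hb := h1 (k, true)
      rw [depth_false] at ha
      rw [depth_true] at hb
      exact ⟨by linarith, by linarith⟩

theorem openSide_subset_side (s : Fin 2 × Bool) : K.openSide s ⊆ K.side s := by
  intro y hy
  rw [mem_openSide_iff] at hy
  rw [mem_side_iff, mem_closure_iff]
  refine ⟨fun s' => ?_, hy.1⟩
  rcases eq_or_ne s' s with rfl | h
  · exact hy.1.ge
  · exact (hy.2 s' h).le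

theorem openSide_subset_closure (s : Fin 2 × Bool) : K.openSide s ⊆ closure K.set :=
  fun _ hy => (K.mem_side_iff.1 (K.openSide_subset_side s hy)).1

theorem openSide_subset_frontier (s : Fin 2 × Bool) : K.openSide s ⊆ frontier K.set :=
  fun _ hy => K.mem_frontier_iff.2 ⟨K.mem_closure_iff.1 (K.openSide_subset_closure s hy), s,
    (K.mem_openSide_iff.1 hy).1⟩

theorem frontier_eq_iUnion_side : frontier K.set = ⋃ s, K.side s := by
  ext y
  simp only [mem_frontier_iff, mem_iUnion, mem_side_iff, mem_closure_iff]
  tauto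

/-- The sides are flat. -/
theorem isFlat_side (s : Fin 2 × Bool) : ∃ τ, IsFlat 0 τ (K.side s) := by
  refine ⟨EuclideanSpace.single (1 - s.1) 1, by simp, ?_⟩
  intro x hx y hy
  have h : (x - y) s.1 = 0 := by rw [PiLp.sub_apply, hx.1, hy.1, sub_self]
  rw [zero_mul, cross]
  obtain ⟨j, b⟩ := s
  fin_cases j <;> simp_all

theorem combo_mem_set {s s' : Fin 2 × Bool} (hne : s ≠ s') {x y : Plane} (hx : x ∈ K.openSide s)
    (hy : y ∈ K.openSide s') {a b : ℝ} (ha : 0 < a) (hb : 0 < b) (hab : a + b = 1) :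
    a • x + b • y ∈ K.set := by
  rw [mem_openSide_iff] at hx hy
  rw [mem_set_iff]
  intro r
  rw [depth_combo K r x y hab]
  rcases eq_or_ne r s with rfl | h
  · rw [hx.1]
    have := mul_pos hb (hy.2 r hne)
    linarith
  · have h1 := mul_pos ha (hx.2 r h)
    have h2 : 0 ≤ K.depth r y := by
      rcases eq_or_ne r s' with rfl | h'
      · exact hy.1.ge
      · exact (hy.2 r h').le
    have := mul_nonneg hb.le h2
    linarith

end Rect

/-! ### The equation of a straight line through two points -/

/-- The affine function which vanishes on the straight line through `P` and `P'`. -/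
def lineForm (P P' y : Plane) : ℝ := cross (P' - P) (y - P)

theorem lineForm_swap (P P' y : Plane) : lineForm P' P y = -lineForm P P' y := by
  simp [lineForm, cross]; ring

theorem lineForm_left (P P' : Plane) : lineForm P P' P = 0 := by simp [lineForm, cross]

theorem lineForm_right (P P' : Plane) : lineForm P P' P' = 0 := by simp [lineForm, cross]; ring

theorem continuous_lineForm (P P' : Plane) : Continuous (lineForm P P') := by
  unfold lineForm cross; fun_prop

theorem lineForm_combo (P P' x y : Plane) {a b : ℝ} (hab : a + b = 1) :
    lineForm P P' (a • x + b • y) = a * lineForm P P' x + b * lineForm P P' y := by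
  simp only [lineForm, cross, PiLp.add_apply, PiLp.sub_apply, PiLp.smul_apply, smul_eq_mul]
  linear_combination ((P' 0 - P 0) * P 1 - (P' 1 - P 1) * P 0) * hab

theorem exists_of_lineForm_eq_zero {P P' y : Plane} (hP : P ≠ P') (h : lineForm P P' y = 0) :
    ∃ t : ℝ, y = (1 - t) • P + t • P' := by
  have hd : (P' - P) 0 ^ 2 + (P' - P) 1 ^ 2 ≠ 0 := by
    rw [normSq_eq]; simpa [sub_eq_zero] using hP.symm
  refine ⟨((P' - P) 0 * (y - P) 0 + (P' - P) 1 * (y - P) 1) /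
    ((P' - P) 0 ^ 2 + (P' - P) 1 ^ 2), ?_⟩
  simp only [lineForm, cross, PiLp.sub_apply] at h hd ⊢
  ext i
  fin_cases i <;> simp <;> field_simp
  · linear_combination (-(P' 1 - P 1)) * h
  · linear_combination (P' 0 - P 0) * h

theorem exists_foot {P P' : Plane} (hP : P ≠ P') (y : Plane) :
    ∃ z ∈ (affineSpan ℝ {P, P'} : Set Plane), dist y z * dist P P' = |lineForm P P' y| := by
  have hd : (P' - P) 0 ^ 2 + (P' - P) 1 ^ 2 ≠ 0 := by
    rw [normSq_eq]; simpa [sub_eq_zero] using hP.symm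
  set t := ((P' - P) 0 * (y - P) 0 + (P' - P) 1 * (y - P) 1) /
    ((P' - P) 0 ^ 2 + (P' - P) 1 ^ 2) with ht
  refine ⟨AffineMap.lineMap P P' t, AffineMap.lineMap_mem_affineSpan_pair t P P', ?_⟩
  rw [← abs_of_nonneg (by positivity : 0 ≤ dist y (AffineMap.lineMap P P' t) * dist P P')]
  rw [← sq_eq_sq_iff_abs_eq_abs, mul_pow, dist_eq_norm, dist_comm P, dist_eq_norm, ← normSq_eq,
    ← normSq_eq, lineForm, cross]
  simp only [AffineMap.lineMap_apply, PiLp.sub_apply, vsub_eq_sub, vadd_eq_add, PiLp.add_apply,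
    PiLp.smul_apply, smul_eq_mul] at ht hd ⊢
  rw [ht]
  field_simp
  ring

/-- The distance from a straight line. -/
theorem abs_lineForm_eq {P P' : Plane} (hP : P ≠ P') (y : Plane) :
    |lineForm P P' y| = Metric.infDist y (affineSpan ℝ {P, P'} : Set Plane) * dist P P' := by
  have hd : 0 < dist P P' := dist_pos.2 hP
  apply le_antisymm
  · rw [← div_le_iff₀ hd]
    refine (Metric.le_infDist ⟨P, left_mem_affineSpan_pair ℝ P P'⟩).2 fun z hz => ?_
    rw [div_le_iff₀ hd]
    obtain ⟨t, rfl⟩ := mem_affineSpan_pair_iff_exists_lineMap_eq.1 hz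
    have : lineForm P P' y = cross (P' - P) (y - AffineMap.lineMap P P' t) := by
      simp [lineForm, cross, AffineMap.lineMap_apply]; ring
    rw [this, dist_comm P, dist_eq_norm, dist_eq_norm, mul_comm]
    exact abs_cross_le _ _
  · obtain ⟨z, hz, hzy⟩ := exists_foot hP y
    rw [← hzy]
    exact mul_le_mul_of_nonneg_right (Metric.infDist_le_dist_of_mem hz) hd.le

/-- The distance from a segment is at least the distance from the straight line. -/
theorem abs_lineForm_le {P P' : Plane} (hP : P ≠ P') (y : Plane) :
    |lineForm P P' y| ≤ Metric.infDist y (openSegment ℝ P P') * dist P P' := by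
  rw [abs_lineForm_eq hP]
  refine mul_le_mul_of_nonneg_right (Metric.infDist_le_infDist_of_subset ?_ ?_) dist_nonneg
  · exact (openSegment_subset_segment ℝ P P').trans (by
      rw [segment_eq_image_lineMap]
      rintro _ ⟨t, -, rfl⟩
      exact AffineMap.lineMap_mem_affineSpan_pair t P P')
  · exact ⟨_, midpoint_mem_openSegment P P'⟩

/-! ### The two open phases of the plane -/

namespace InterfaceGeometry

variable (G : InterfaceGeometry)

/-- The inside and the outside of the interface. -/
def phase (i : Fin 2) : Set Plane := if i = 0 then G.Ω₁ else (closure G.Ω₁)ᶜ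

theorem isOpen_phase (i : Fin 2) : IsOpen (G.phase i) := by
  fin_cases i
  · exact G.isOpen_Ω₁
  · exact isClosed_closure.isOpen_compl

theorem phase_inter {i j : Fin 2} {x : Plane} (hi : x ∈ G.phase i) (hj : x ∈ G.phase j) :
    i = j := by
  have key : ∀ x, x ∈ G.phase 0 → x ∉ G.phase 1 := fun x h h' => h' (subset_closure h)
  fin_cases i <;> fin_cases j
  · rfl
  · exact absurd hj (key x hi)
  · exact absurd hi (key x hj)
  · rfl

theorem mem_phase_or {x : Plane} (hx : x ∉ G.Γ) : x ∈ G.phase 0 ∨ x ∈ G.phase 1 := by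
  by_cases h : x ∈ closure G.Ω₁
  · left
    by_contra h0
    refine hx (G.frontier_eq ▸ ?_)
    rw [G.isOpen_Ω₁.frontier_eq]
    exact ⟨h, h0⟩
  · exact Or.inr h

theorem notMem_Γ_of_mem_phase {i : Fin 2} {x : Plane} (hx : x ∈ G.phase i) : x ∉ G.Γ := by
  rw [← G.frontier_eq]
  intro h
  fin_cases i
  · rw [G.isOpen_Ω₁.frontier_eq] at h
    exact h.2 hx
  · exact hx (frontier_subset_closure h)

theorem mem_sub_iff {i : Fin 2} {x : Plane} (hx : x ∈ G.Ω) : x ∈ G.sub i ↔ x ∈ G.phase i := by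
  fin_cases i
  · exact Iff.rfl
  · exact ⟨fun h => h.2, fun h => ⟨hx, h⟩⟩

theorem sub_subset_phase (i : Fin 2) : G.sub i ⊆ G.phase i := by
  fin_cases i
  · exact subset_rfl
  · exact fun x hx => hx.2

/-- A point of the closure of Ω in an open phase is a limit of points of Ω in that phase. So the
phases, which are open in the whole plane and suit connectedness arguments, may replace `region`
also for vertices and sides on ∂Ω. -/
theorem mem_region_iff {i : Fin 2} {x : Plane} (hx : x ∈ closure G.Ω) :
    x ∈ G.region i ↔ x ∈ G.phase i := by
  constructor
  · rintro ⟨h1, h2⟩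
    have : ∃ j, x ∈ G.phase j := by
      rcases G.mem_phase_or h2 with h | h
      exacts [⟨0, h⟩, ⟨1, h⟩]
    obtain ⟨j, hj⟩ := this
    obtain ⟨y, hyj, hyi⟩ := mem_closure_iff_nhds.1 h1 _ ((G.isOpen_phase j).mem_nhds hj)
    rwa [G.phase_inter (G.sub_subset_phase i hyi) hyj]
  · intro h
    refine ⟨?_, G.notMem_Γ_of_mem_phase h⟩
    rw [mem_closure_iff_nhds]
    intro U hU
    obtain ⟨y, hy, hyΩ⟩ := mem_closure_iff_nhds.1 hx _
      (Filter.inter_mem hU ((G.isOpen_phase i).mem_nhds h))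
    exact ⟨y, hy.1, (G.mem_sub_iff hyΩ).2 hy.2⟩

/-- A connected set which does not meet the interface lies on one side of it. -/
theorem subset_phase_of_isPreconnected {U : Set Plane} (hU : IsPreconnected U)
    (hΓ : Disjoint U G.Γ) {i : Fin 2} {A : Plane} (hA : A ∈ closure U) (hAi : A ∈ G.phase i) :
    U ⊆ G.phase i := by
  have hcov : U ⊆ G.phase 0 ∪ G.phase 1 := fun x hx =>
    G.mem_phase_or (disjoint_left.1 hΓ hx)
  have hdisj : Disjoint (G.phase 0) (G.phase 1) := disjoint_left.2 fun x h h' =>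
    zero_ne_one (G.phase_inter h h')
  obtain ⟨y, hy, hyU⟩ := mem_closure_iff_nhds.1 hA _ ((G.isOpen_phase i).mem_nhds hAi)
  fin_cases i
  · exact hU.subset_left_of_subset_union (G.isOpen_phase 0) (G.isOpen_phase 1) hdisj hcov
      ⟨y, hyU, hy⟩
  · exact hU.subset_right_of_subset_union (G.isOpen_phase 0) (G.isOpen_phase 1) hdisj hcov
      ⟨y, hyU, hy⟩

theorem exists_subset_phase {U : Set Plane} (hU : IsPreconnected U) (hΓ : Disjoint U G.Γ) :
    ∃ i, U ⊆ G.phase i := by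
  rcases U.eq_empty_or_nonempty with rfl | ⟨x, hx⟩
  · exact ⟨0, empty_subset _⟩
  · rcases G.mem_phase_or (disjoint_left.1 hΓ hx) with h | h
    · exact ⟨0, G.subset_phase_of_isPreconnected hU hΓ (subset_closure hx) h⟩
    · exact ⟨1, G.subset_phase_of_isPreconnected hU hΓ (subset_closure hx) h⟩

end InterfaceGeometry

/-! ### The boundary of a piece and the end points of the arc -/

namespace CutElement

variable {G : InterfaceGeometry} (K : CutElement G)

theorem closure_subset_closure : closure K.set ⊆ closure G.Ω := closure_mono K.subset_Ω

theorem mem_piece_iff {i : Fin 2} {x : Plane} : x ∈ K.piece i ↔ x ∈ K.set ∧ x ∈ G.phase i := by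
  constructor
  · rintro ⟨h1, h2⟩
    exact ⟨h1, (G.mem_sub_iff (K.subset_Ω h1)).1 h2⟩
  · rintro ⟨h1, h2⟩
    exact ⟨h1, (G.mem_sub_iff (K.subset_Ω h1)).2 h2⟩

theorem isOpen_piece (i : Fin 2) : IsOpen (K.piece i) := K.isOpen_set.inter (G.isOpen_sub i)

theorem subset_piece {U : Set Plane} (hUK : U ⊆ K.set) (hU : IsPreconnected U)
    (hΓ : Disjoint U G.Γ) {i : Fin 2} {A : Plane} (hA : A ∈ closure U) (hAi : A ∈ G.phase i) :
    U ⊆ K.piece i := fun _ hx =>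
  K.mem_piece_iff.2 ⟨hUK hx, G.subset_phase_of_isPreconnected hU hΓ hA hAi hx⟩

/-- The boundary of a piece consists of a part of the interface and of parts of the sides. -/
theorem frontier_piece_subset (i : Fin 2) :
    frontier (K.piece i) ⊆ closure K.set ∩ G.Γ ∪ frontier K.set ∩ G.phase i := by
  intro x hx
  have hxc := frontier_subset_closure hx
  have hxK : x ∈ closure K.set := closure_mono inter_subset_left hxc
  by_cases hxΓ : x ∈ G.Γ
  · exact Or.inl ⟨hxK, hxΓ⟩
  have : ∃ j, x ∈ G.phase j := by
    rcases G.mem_phase_or hxΓ with h | h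
    exacts [⟨0, h⟩, ⟨1, h⟩]
  obtain ⟨j, hj⟩ := this
  obtain ⟨y, hyj, hyi⟩ := mem_closure_iff_nhds.1 hxc _ ((G.isOpen_phase j).mem_nhds hj)
  have hij := G.phase_inter (K.mem_piece_iff.1 hyi).2 hyj
  subst hij
  refine Or.inr ⟨?_, hj⟩
  rw [frontier, K.isOpen_set.interior_eq]
  refine ⟨hxK, fun hxs => ?_⟩
  rw [(K.isOpen_piece i).frontier_eq] at hx
  exact hx.2 (K.mem_piece_iff.2 ⟨hxs, hj⟩)

theorem γ_mem_Γ {t : ℝ} (ht : t ∈ Icc (0 : ℝ) 1) : K.γ t ∈ G.Γ ∩ closure K.set := by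
  rw [← K.image_γ]
  exact mem_image_of_mem _ ht

theorem zero_ne_one : K.γ 0 ≠ K.γ 1 := fun h =>
  _root_.zero_ne_one (K.injOn_γ (left_mem_Icc.2 zero_le_one) (right_mem_Icc.2 zero_le_one) h)

theorem mem_ends_of_mem_frontier {y : Plane} (hy : y ∈ frontier K.set) (hyΓ : y ∈ G.Γ) :
    y = K.γ 0 ∨ y = K.γ 1 := by
  have : y ∈ K.γ '' Icc 0 1 := by
    rw [K.image_γ]; exact ⟨hyΓ, frontier_subset_closure hy⟩
  obtain ⟨t, ht, rfl⟩ := this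
  rcases ht.1.eq_or_lt with rfl | h0
  · exact Or.inl rfl
  rcases ht.2.eq_or_lt with rfl | h1
  · exact Or.inr rfl
  · rw [frontier, K.isOpen_set.interior_eq] at hy
    exact absurd (K.mapsTo_γ ⟨h0, h1⟩) hy.2

/-- On both sides of an end point of the arc the boundary of the rectangle lies in different
subdomains. -/
theorem not_eventually_mem_phase (i : Fin 2) :
    ¬ ∀ᶠ y in 𝓝 (K.γ 0), y ∈ frontier K.set → y ≠ K.γ 0 → y ∈ G.phase i := by
  -- Otherwise both halves of the side near B lie in one phase, so the Lipschitz graph stays on one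
  -- side of the straight line near B. If that is outside K, the arc cannot enter K; if it is
  -- inside, both branches of the graph belong to the arc, although B is an end point of a simple
  -- arc.
  intro hev
  obtain ⟨s, -, -, hBs, -⟩ := K.ends_γ
  set B := K.γ 0 with hB
  obtain ⟨hBs0, hBpos⟩ := K.mem_openSide_iff.1 hBs
  have hBΓ : B ∈ frontier G.Ω₁ := by
    rw [G.frontier_eq]; exact (K.γ_mem_Γ (left_mem_Icc.2 zero_le_one)).1
  obtain ⟨e, φ, L, r, hr, hφ, -, hch⟩ := G.exists_chart hBΓ
  have hgB : (e B) 1 = φ ((e B) 0) := ((hch B (Metric.mem_ball_self hr)).2.1).1 hBΓ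
  -- near `B` only the side through `B` matters
  have hnear : ∀ᶠ y in 𝓝 B, y ∈ Metric.ball B r ∧ (∀ s', s' ≠ s → 0 < K.depth s' y) ∧
      (y ∈ frontier K.set → y ≠ B → y ∈ G.phase i) := by
    have hb : ∀ᶠ y in 𝓝 B, y ∈ Metric.ball B r := Metric.ball_mem_nhds B hr
    refine hb.and (Filter.Eventually.and (Filter.eventually_all.2 fun s' => ?_) hev)
    by_cases h : s' = s
    · simp [h]
    · filter_upwards [(K.continuous_depth s').continuousAt.eventually_const_lt (hBpos s' h)]
        with y hy _ using hy
  set j := s.1 with hj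
  obtain ⟨k, hkj⟩ : ∃ k : Fin 2, k ≠ j := exists_ne j
  set τ : Plane := EuclideanSpace.single k 1 with hτ
  have hτj : τ j = 0 := by simp [hτ, hkj.symm]
  have hτk : τ k = 1 := by simp [hτ]
  -- the side near `B`
  have hside : ∀ᶠ t : ℝ in 𝓝 0, t ≠ 0 → B + t • τ ∈ Metric.ball B r ∧ B + t • τ ∈ G.phase i := by
    have hc : ContinuousAt (fun t : ℝ => B + t • τ) 0 := by fun_prop
    have hc' : Filter.Tendsto (fun t : ℝ => B + t • τ) (𝓝 0) (𝓝 B) := by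
      have := hc.tendsto; simpa using this
    filter_upwards [hc'.eventually hnear] with t ht ht0
    refine ⟨ht.1, ht.2.2 ?_ ?_⟩
    · rw [K.mem_frontier_iff]
      have h0 : K.depth s (B + t • τ) = 0 := by
        rw [← hBs0]
        unfold Rect.depth
        simp [← hj, hτj]
      refine ⟨fun s' => ?_, s, h0⟩
      by_cases h : s' = s
      · rw [h, h0]
      · exact (ht.2.1 s' h).le
    · intro h
      have : t • τ = 0 := by simpa using h
      rcases smul_eq_zero.1 this with h | h
      · exact ht0 h
      · rw [h] at hτk; simp at hτk
  set τ' := e.linearIsometryEquiv τ with hτ'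
  set ν := e.linearIsometryEquiv.symm (!₂[(0 : ℝ), 1]) with hν
  have heB : ∀ t : ℝ, e (B + t • τ) = e B + t • τ' := fun t => by
    rw [InterfaceGeometry.chart_add, map_smul]
  -- The height of the graph above the side, measured in the chart, has a constant sign for small t
  -- ≠ 0, given by the phase.
  obtain ⟨θ, hθ, hθev⟩ : ∃ θ : ℝ, θ ≠ 0 ∧ ∀ᶠ t : ℝ in 𝓝 0, t ≠ 0 →
      0 < θ * (φ ((e B) 0 + t * τ' 0) - φ ((e B) 0) - t * τ' 1) := by
    fin_cases i
    · refine ⟨1, one_ne_zero, ?_⟩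
      filter_upwards [hside] with t ht ht0
      have h1 := ((hch _ (ht ht0).1).1).1 (ht ht0).2
      rw [heB] at h1
      simp only [PiLp.add_apply, PiLp.smul_apply, smul_eq_mul, hgB] at h1
      linarith
    · refine ⟨-1, by norm_num, ?_⟩
      filter_upwards [hside] with t ht ht0
      have h1 := (hch _ (ht ht0).1)
      have h2 := (ht ht0).2
      have h3 : ¬ (B + t • τ ∈ G.Ω₁) := fun h => h2 (subset_closure h)
      have h4 : ¬ (B + t • τ ∈ frontier G.Ω₁) := fun h => h2 (frontier_subset_closure h)
      rw [h1.1] at h3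
      rw [h1.2.1] at h4
      rw [heB] at h3 h4
      simp only [PiLp.add_apply, PiLp.smul_apply, smul_eq_mul, hgB] at h3 h4
      have := lt_of_le_of_ne (not_lt.1 h3) (Ne.symm h4)
      linarith
  -- the side is not vertical in the chart
  have hτ0 : τ' 0 ≠ 0 := by
    intro h0
    obtain ⟨δ, hδ, hball⟩ := Metric.eventually_nhds_iff_ball.1 hθev
    have h1 := hball (δ / 2) (by simp [abs_of_pos hδ, hδ]) (by positivity)
    have h2 := hball (-(δ / 2)) (by simp [abs_of_pos hδ, hδ]) (by
      have : 0 < δ / 2 := by positivity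
      linarith)
    rw [h0] at h1 h2
    simp at h1 h2
    linarith
  -- If the vertical direction of the chart were parallel to the side, τ' would have first component
  -- 0.
  have hνj : ν j ≠ 0 := by
    intro h0
    have h1 : ν = ν k • τ := by
      ext l
      have hl : l = j ∨ l = k := by
        have key : ∀ j k l : Fin 2, k ≠ j → l = j ∨ l = k := by decide
        exact key j k l hkj
      rcases hl with rfl | rfl
      · rw [h0, PiLp.smul_apply, hτj, smul_zero]
      · rw [PiLp.smul_apply, hτk, smul_eq_mul, mul_one]
    have h2 : e.linearIsometryEquiv ν = ν k • τ' := by rw [h1, map_smul, hτ']; simp [hτk]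
    rw [hν, LinearIsometryEquiv.apply_symm_apply, ← hν] at h2
    have e0 : (0 : ℝ) = ν k * τ' 0 := by
      have := congrArg (fun z : Plane => z 0) h2; simpa using this
    have e1 : (1 : ℝ) = ν k * τ' 1 := by
      have := congrArg (fun z : Plane => z 1) h2; simpa using this
    rcases mul_eq_zero.1 e0.symm with h | h
    · rw [h, zero_mul] at e1; exact one_ne_zero e1
    · exact hτ0 h
  -- the graph
  set g : ℝ → Plane := fun t => B + t • τ +
    (φ ((e B) 0 + t * τ' 0) - φ ((e B) 0) - t * τ' 1) • ν with hg
  have hg0 : g 0 = B := by simp [hg]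
  have hgc : Continuous g := by
    have := hφ.continuous
    rw [hg]; fun_prop
  have heg : ∀ t, e (g t) = !₂[(e B) 0 + t * τ' 0, φ ((e B) 0 + t * τ' 0)] := by
    intro t
    rw [hg]
    simp only
    rw [InterfaceGeometry.chart_add, heB, map_smul, hν, LinearIsometryEquiv.apply_symm_apply]
    ext l
    fin_cases l
    · simp
    · simp [hgB]
  have hgraph : ∀ y, (e y) 1 = φ ((e y) 0) → y = g (((e y) 0 - (e B) 0) / τ' 0) := by
    intro y hy
    apply e.injective
    rw [heg, div_mul_cancel₀ _ hτ0]
    ext l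
    fin_cases l
    · simp
    · simp [hy]
  -- the arc near `B`
  set a : ℝ → ℝ := fun t => ((e (K.γ t)) 0 - (e B) 0) / τ' 0 with ha
  have hacont : ContinuousOn a (Icc 0 1) := by
    have h1 : ContinuousOn (fun t => (e (K.γ t)) 0) (Icc 0 1) :=
      ((by fun_prop : Continuous fun z : Plane => z 0).comp e.continuous).comp_continuousOn
        K.continuousOn_γ
    exact (h1.sub continuousOn_const).div_const _
  have ha0 : a 0 = 0 := by simp [ha, ← hB]
  have hγ0 : Filter.Tendsto K.γ (𝓝[Icc 0 1] 0) (𝓝 B) :=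
    K.continuousOn_γ 0 (left_mem_Icc.2 zero_le_one)
  obtain ⟨ε, hε, hε1, harc⟩ : ∃ ε > 0, ε < 1 ∧ ∀ t ∈ Ioc 0 ε, K.γ t = g (a t) := by
    have := hγ0.eventually (Metric.ball_mem_nhds B hr)
    rw [eventually_nhdsWithin_iff] at this
    obtain ⟨ε, hε, hball⟩ := Metric.eventually_nhds_iff_ball.1 this
    refine ⟨min (ε / 2) (1 / 2), by positivity, by
      have := min_le_right (ε / 2) (1 / 2); linarith, fun t ht => ?_⟩
    have ht1 : t ≤ ε / 2 := ht.2.trans (min_le_left _ _)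
    have ht2 : t ≤ 1 / 2 := ht.2.trans (min_le_right _ _)
    have htI : t ∈ Icc (0 : ℝ) 1 := ⟨ht.1.le, by linarith⟩
    have h1 := hball t (by rw [Metric.mem_ball, Real.dist_0_eq_abs, abs_of_pos ht.1]; linarith) htI
    apply hgraph
    refine ((hch _ h1).2.1).1 ?_
    rw [G.frontier_eq]
    exact (K.γ_mem_Γ htI).1
  have hane : ∀ t ∈ Ioc 0 ε, a t ≠ 0 := by
    intro t ht h
    have h1 := harc t ht
    rw [h, hg0, hB] at h1
    have := K.injOn_γ ⟨ht.1.le, by linarith [ht.2]⟩ (left_mem_Icc.2 zero_le_one) h1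
    linarith [ht.1]
  have hatend : Filter.Tendsto a (𝓝[Ioc 0 ε] 0) (𝓝 0) := by
    have := hacont 0 (left_mem_Icc.2 zero_le_one)
    rw [ContinuousWithinAt, ha0] at this
    exact this.mono_left (nhdsWithin_mono _ fun t ht => ⟨ht.1.le, by linarith [ht.2]⟩)
  have hnebot : (𝓝[Ioc 0 ε] (0 : ℝ)).NeBot := by
    rw [nhdsWithin_Ioc_eq_nhdsGT hε]; infer_instance
  -- the position of the graph relative to the side
  have hdepth : ∀ t, K.depth s (g t) =
      (if s.2 then -1 else 1) * ((φ ((e B) 0 + t * τ' 0) - φ ((e B) 0) - t * τ' 1) * ν j) := by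
    intro t
    have hb : K.depth s (g t) = K.depth s B +
      (if s.2 then -1 else 1) * ((φ ((e B) 0 + t * τ' 0) - φ ((e B) 0) - t * τ' 1) * ν j) := by
      unfold Rect.depth
      rw [hg]
      split_ifs
      · simp only [PiLp.add_apply, PiLp.smul_apply, smul_eq_mul, ← hj, hτj]; ring
      · simp only [PiLp.add_apply, PiLp.smul_apply, smul_eq_mul, ← hj, hτj]; ring
    rw [hb, hBs0, zero_add]
  -- The depth of the graph is its chart height times ±`ν j`, so it also has a constant sign; the
  -- sign of ϑ decides between outside and inside.
  obtain ⟨ϑ, hϑ, hϑev⟩ : ∃ ϑ : ℝ, ϑ ≠ 0 ∧ ∀ᶠ t : ℝ in 𝓝 0, t ≠ 0 →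
      0 < ϑ * K.depth s (g t) := by
    refine ⟨(if s.2 then -1 else 1) * (θ / ν j), ?_, ?_⟩
    · split_ifs <;> simp [hθ, hνj]
    · filter_upwards [hθev] with t ht ht0
      rw [hdepth]
      have h1 := ht ht0
      have h2 : (if s.2 then (-1 : ℝ) else 1) * (if s.2 then -1 else 1) = 1 := by
        split_ifs <;> norm_num
      calc 0 < θ * (φ ((e B) 0 + t * τ' 0) - φ ((e B) 0) - t * τ' 1) := h1
        _ = ((if s.2 then (-1 : ℝ) else 1) * (if s.2 then -1 else 1)) *
            (θ * (φ ((e B) 0 + t * τ' 0) - φ ((e B) 0) - t * τ' 1)) := by rw [h2, one_mul]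
        _ = _ := by field_simp
  rcases lt_or_gt_of_ne hϑ with hneg | hpos
  · -- the graph leaves the rectangle
    obtain ⟨t, ht, ht'⟩ := ((hatend.eventually hϑev).and self_mem_nhdsWithin).exists
    have h1 := ht (hane t ht')
    rw [← harc t ht'] at h1
    have h2 := K.mem_set_iff.1 (K.mapsTo_γ ⟨ht'.1, by linarith [ht'.2]⟩) s
    nlinarith
  · -- the graph runs inside the rectangle on both sides of `B`
    have hin : ∀ᶠ t : ℝ in 𝓝 0, t ≠ 0 → g t ∈ K.γ '' Icc 0 1 := by
      have hgt : Filter.Tendsto g (𝓝 0) (𝓝 B) := by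
        have := hgc.tendsto 0; rwa [hg0] at this
      filter_upwards [hϑev, hgt.eventually hnear] with t ht ht2 ht0
      rw [K.image_γ]
      constructor
      · rw [← G.frontier_eq]
        refine ((hch _ ht2.1).2.1).2 ?_
        rw [heg]; simp
      · rw [K.mem_closure_iff]
        intro s'
        by_cases h : s' = s
        · rw [h]
          exact (le_of_lt ((mul_pos_iff_of_pos_left hpos).1 (ht ht0)))
        · exact (ht2.2.1 s' h).le
    -- The graph parameter of the arc is continuous and nonzero on (0, ε], so the arc follows one
    -- branch only. Points g(-ωt) of the other branch near B must still lie on the arc, and not on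
    -- its far part: a contradiction.
    have hsign : (∀ t ∈ Ioc 0 ε, 0 < a t) ∨ ∀ t ∈ Ioc 0 ε, a t < 0 := by
      have hconn : IsPreconnected (a '' Ioc 0 ε) := isPreconnected_Ioc.image _
        (hacont.mono fun t ht => ⟨ht.1.le, by linarith [ht.2]⟩)
      have hcov : a '' Ioc 0 ε ⊆ Ioi 0 ∪ Iio 0 := by
        rintro _ ⟨t, ht, rfl⟩
        rcases lt_or_gt_of_ne (hane t ht) with h | h
        exacts [Or.inr h, Or.inl h]
      have hd : Disjoint (Ioi (0 : ℝ)) (Iio 0) := disjoint_left.2 fun x hx hx' => by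
        have h1 : (0 : ℝ) < x := hx
        have h2 : x < 0 := hx'
        linarith
      have hε' : a ε ∈ a '' Ioc 0 ε := ⟨ε, ⟨hε, le_rfl⟩, rfl⟩
      rcases hcov hε' with h | h
      · left
        intro t ht
        exact hconn.subset_left_of_subset_union isOpen_Ioi isOpen_Iio hd hcov ⟨_, hε', h⟩ ⟨t, ht, rfl⟩
      · right
        intro t ht
        exact hconn.subset_right_of_subset_union isOpen_Ioi isOpen_Iio hd hcov ⟨_, hε', h⟩
          ⟨t, ht, rfl⟩
    obtain ⟨ω, hω, hωa⟩ : ∃ ω : ℝ, ω ≠ 0 ∧ ∀ t ∈ Ioc 0 ε, 0 < ω * a t := by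
      rcases hsign with h | h
      · exact ⟨1, one_ne_zero, fun t ht => by have := h t ht; linarith⟩
      · exact ⟨-1, by norm_num, fun t ht => by have := h t ht; linarith⟩
    -- the far part of the arc stays away from `B`
    have hfar : ∀ᶠ y in 𝓝 B, y ∉ K.γ '' Icc ε 1 := by
      have hcl : IsClosed (K.γ '' Icc ε 1) := (isCompact_Icc.image_of_continuousOn
        (K.continuousOn_γ.mono (Icc_subset_Icc_left hε.le))).isClosed
      refine hcl.isOpen_compl.mem_nhds ?_
      rintro ⟨t, ht, hte⟩
      have := K.injOn_γ ⟨hε.le.trans ht.1, ht.2⟩ (left_mem_Icc.2 zero_le_one) hte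
      linarith [ht.1]
    have hgt : Filter.Tendsto (fun t : ℝ => g (-ω * t)) (𝓝 0) (𝓝 B) := by
      have := (hgc.comp (by fun_prop : Continuous fun t : ℝ => -ω * t)).tendsto 0
      rwa [Function.comp_apply, mul_zero, hg0] at this
    have hωt : Filter.Tendsto (fun t : ℝ => -ω * t) (𝓝 0) (𝓝 0) := by
      have := (by fun_prop : Continuous fun t : ℝ => -ω * t).tendsto 0
      simpa using this
    obtain ⟨t, ⟨ht1, ht2⟩, ht0⟩ := ((((hωt.eventually hin).and
      (hgt.eventually hfar)).filter_mono nhdsWithin_le_nhds).and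
      (self_mem_nhdsWithin (a := (0 : ℝ)) (s := Ioi 0))).exists
    have ht0' : (0 : ℝ) < t := ht0
    obtain ⟨q, hq, hqe⟩ := ht1 (mul_ne_zero (neg_ne_zero.2 hω) ht0'.ne')
    have hqε : q < ε := by
      by_contra h
      exact ht2 ⟨q, ⟨not_lt.1 h, hq.2⟩, hqe⟩
    have hginj : ∀ x y, g x = g y → x = y := by
      intro x y hxy
      have h1 := congrArg (fun z => (e z) 0) hxy
      simp only [heg] at h1
      simp at h1
      rcases h1 with h1 | h1
      · exact h1
      · exact absurd h1 hτ0
    rcases hq.1.eq_or_lt with h0 | h0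
    · rw [← h0, ← hB, ← hg0] at hqe
      have := hginj _ _ hqe
      have h2 : -ω * t ≠ 0 := mul_ne_zero (neg_ne_zero.2 hω) ht0'.ne'
      exact h2 this.symm
    · have hq' : q ∈ Ioc 0 ε := ⟨h0, hqε.le⟩
      rw [harc q hq'] at hqe
      have h1 := hginj _ _ hqe
      have h2 := hωa q hq'
      rw [h1] at h2
      nlinarith [mul_pos ht0' (sq_pos_of_ne_zero hω)]

end CutElement

/-! ### The chord and the two parts of the boundary of the rectangle -/

/-- The part of the boundary of a bounded convex open set on one side of a straight line through an
inner point is connected. -/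
theorem isPreconnected_frontier_inter {U : Set Plane} (hUo : IsOpen U) (hUc : Convex ℝ U)
    (hUb : Bornology.IsBounded U) {c : Plane} (hc : c ∈ U) (d : Plane) :
    IsPreconnected {y | y ∈ frontier U ∧ 0 < cross d (y - c)} := by
  set V : Set Plane := (fun w => c + w) ⁻¹' U with hV
  have hVo : IsOpen V := hUo.preimage (by fun_prop)
  have hVc : Convex ℝ V := hUc.translate_preimage_right c
  have hV0 : V ∈ 𝓝 (0 : Plane) := hVo.mem_nhds (by simpa [hV] using hc)
  have hVb : Bornology.IsBounded V := by
    have : V = (fun u => -c + u) '' U := by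
      ext w
      constructor
      · intro hw; exact ⟨c + w, hw, by simp⟩
      · rintro ⟨u, hu, rfl⟩; simpa [hV] using hu
    rw [this]
    exact (LipschitzWith.mk_one (f := fun u : Plane => -c + u)
      (fun x y => by simp)).isBounded_image hUb
  have hfr : ∀ y, y ∈ frontier U ↔ gauge V (y - c) = 1 := by
    intro y
    rw [gauge_eq_one_iff_mem_frontier hVc hV0]
    have h1 : V = (Homeomorph.addLeft c) ⁻¹' U := rfl
    rw [h1, ← (Homeomorph.addLeft c).preimage_frontier]
    simp
  have hgpos : ∀ w, 0 < cross d w → 0 < gauge V w := by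
    intro w hw
    refine (gauge_pos (absorbent_nhds_zero hV0) (NormedSpace.isVonNBounded_iff ℝ |>.2 hVb)).2 ?_
    rintro rfl
    simp [cross] at hw
  -- Radial projection from c, expressed by the gauge, maps an open half plane continuously onto
  -- this part of the boundary.
  have himage : {y | y ∈ frontier U ∧ 0 < cross d (y - c)} =
      (fun w => c + (gauge V w)⁻¹ • w) '' {w | 0 < cross d w} := by
    ext y
    constructor
    · rintro ⟨h1, h2⟩
      refine ⟨y - c, h2, ?_⟩
      simp [(hfr y).1 h1]
    · rintro ⟨w, hw, rfl⟩
      have hg := hgpos w hw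
      refine ⟨(hfr _).2 ?_, ?_⟩
      · rw [add_sub_cancel_left, gauge_smul_of_nonneg (inv_nonneg.2 hg.le), smul_eq_mul,
          inv_mul_cancel₀ hg.ne']
      · rw [add_sub_cancel_left, cross_smul]
        exact mul_pos (inv_pos.2 hg) hw
  rw [himage]
  refine IsPreconnected.image ?_ _ ?_
  · refine Convex.isPreconnected ?_
    intro x hx y hy a b ha hb hab
    have e : cross d (a • x + b • y) = a * cross d x + b * cross d y := by
      simp [cross]; ring
    rw [mem_ofPred_eq, e]
    have hx' : 0 < cross d x := hx
    have hy' : 0 < cross d y := hy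
    rcases ha.eq_or_lt with rfl | ha
    · have : b = 1 := by linarith
      rw [this]; linarith
    · have := mul_pos ha hx'
      have := mul_nonneg hb hy'.le
      linarith
  · have hgc : Continuous (gauge V) := continuous_gauge hVc hV0
    have hinv : ContinuousOn (fun w => (gauge V w)⁻¹) {w | 0 < cross d w} :=
      hgc.continuousOn.inv₀ fun w hw => (hgpos w hw).ne'
    fun_prop

namespace Rect

variable (K : Rect)

/-- The inner unit normal of a side. -/
def normal (s : Fin 2 × Bool) : Plane := EuclideanSpace.single s.1 (if s.2 then -1 else 1)

theorem norm_normal (s : Fin 2 × Bool) : ‖normal s‖ = 1 := by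
  unfold normal; split_ifs <;> simp

theorem depth_add_normal (s : Fin 2 × Bool) (y : Plane) (t : ℝ) :
    K.depth s (y + t • normal s) = K.depth s y + t := by
  unfold depth normal
  split_ifs <;> simp <;> ring

theorem depth_add_normal_of_ne {s s' : Fin 2 × Bool} (h : s'.1 ≠ s.1) (y : Plane) (t : ℝ) :
    K.depth s' (y + t • normal s) = K.depth s' y := by
  unfold depth normal
  split_ifs <;> simp [h]

theorem eq_add_normal {s s' : Fin 2 × Bool} (h : s'.1 ≠ s.1) {x y : Plane}
    (hxy : K.depth s' x = K.depth s' y) :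
    y = x + (K.depth s y - K.depth s x) • normal s := by
  have h1 : y s'.1 = x s'.1 := by
    unfold depth at hxy
    split_ifs at hxy <;> linarith
  have key : ∀ j k l : Fin 2, k ≠ j → l = j ∨ l = k := by decide
  ext l
  rcases key s.1 s'.1 l h with rfl | rfl
  · unfold depth normal
    split_ifs <;> simp
  · simp [normal, h, h1]

theorem mem_closure_of_depth {s s' : Fin 2 × Bool} (h : s'.1 ≠ s.1) {y : Plane}
    (hs : K.depth s y ∈ Icc 0 (K.width s.1)) (hs' : K.depth s' y ∈ Icc 0 (K.width s'.1)) :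
    y ∈ closure K.set := by
  rw [mem_closure_iff]
  have key : ∀ j k l : Fin 2, k ≠ j → l = j ∨ l = k := by decide
  intro r
  rcases key s.1 s'.1 r.1 h with hr | hr
  · by_cases hrs : r = s
    · rw [hrs]; exact hs.1
    · have := K.depth_add_depth hr hrs y
      linarith [hs.2]
  · by_cases hrs : r = s'
    · rw [hrs]; exact hs'.1
    · have := K.depth_add_depth hr hrs y
      linarith [hs'.2]

theorem depth_le_width (s : Fin 2 × Bool) {y : Plane} (hy : y ∈ closure K.set) :
    K.depth s y ≤ K.width s.1 := by
  obtain ⟨j, b⟩ := s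
  have h0 := (K.mem_closure_iff.1 hy) (j, !b)
  have := K.depth_add_depth (s := (j, b)) (s' := (j, !b)) rfl (by simp) y
  simp only at this ⊢
  linarith

theorem vertices_subset_frontier : K.vertices ⊆ frontier K.set := by
  intro y hy
  have hc : ∀ s, 0 ≤ K.depth s y := by
    rintro ⟨j, b⟩
    have := K.lo_lt_hi j
    unfold depth
    rcases hy j with h | h <;> cases b <;> simp [h, this.le]
  refine K.mem_frontier_iff.2 ⟨hc, ?_⟩
  rcases hy 0 with h | h
  · exact ⟨(0, false), by simp [depth, h]⟩
  · exact ⟨(0, true), by simp [depth, h]⟩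

theorem mem_vertices_of_depth {s s' : Fin 2 × Bool} (h : s'.1 ≠ s.1) {y : Plane}
    (hs : K.depth s y = 0) (hs' : K.depth s' y = 0) : y ∈ K.vertices := by
  have key : ∀ j k l : Fin 2, k ≠ j → l = j ∨ l = k := by decide
  have h0 : ∀ r : Fin 2 × Bool, K.depth r y = 0 → y r.1 = K.lo r.1 ∨ y r.1 = K.hi r.1 := by
    intro r hr
    unfold depth at hr
    split_ifs at hr
    · right; linarith
    · left; linarith
  intro l
  rcases key s.1 s'.1 l h with rfl | rfl
  · exact h0 s hs
  · exact h0 s' hs'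

theorem finite_vertices : K.vertices.Finite := by
  have : K.vertices ⊆ (fun b : Fin 2 → Bool =>
      (WithLp.toLp 2 fun j => if b j then K.hi j else K.lo j : Plane)) '' univ := by
    intro y hy
    refine ⟨fun j => decide (y j = K.hi j), trivial, ?_⟩
    ext j
    rcases hy j with h | h
    · have := K.lo_lt_hi j
      simp [h, this.ne]
    · simp [h]
  exact (finite_univ.image _).subset this

/-- The lengths of segments. -/
theorem hausdorffMeasure_segment_normal (x : Plane) {a b : ℝ} (hab : a ≤ b) (s : Fin 2 × Bool) :
    μH[1] (segment ℝ (x + a • normal s) (x + b • normal s)) = ENNReal.ofReal (b - a) := by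
  rw [hausdorffMeasure_segment, edist_dist, dist_comm, dist_eq_norm]
  congr 1
  rw [show x + b • normal s - (x + a • normal s) = (b - a) • normal s by module, norm_smul,
    norm_normal, mul_one, Real.norm_eq_abs, abs_of_nonneg (by linarith)]

theorem mem_segment_normal (x : Plane) {a b t : ℝ} (hat : a ≤ t) (htb : t ≤ b)
    (s : Fin 2 × Bool) : x + t • normal s ∈ segment ℝ (x + a • normal s) (x + b • normal s) := by
  have h : x + t • normal s = (AffineMap.lineMap x (x + normal s) : ℝ →ᵃ[ℝ] Plane) t := by
    simp [AffineMap.lineMap_apply, add_comm]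
  have h' : ∀ r, x + r • normal s = (AffineMap.lineMap x (x + normal s) : ℝ →ᵃ[ℝ] Plane) r := by
    intro r; simp [AffineMap.lineMap_apply, add_comm]
  rw [h' t, h' a, h' b, ← image_segment, segment_eq_Icc (hat.trans htb)]
  exact mem_image_of_mem _ ⟨hat, htb⟩

end Rect

namespace CutElement

variable {G : InterfaceGeometry} (K : CutElement G)

theorem mem_verticesIn_iff {i : Fin 2} {A : Plane} :
    A ∈ K.verticesIn i ↔ A ∈ K.vertices ∧ A ∈ G.phase i := by
  constructor
  · rintro ⟨h1, h2⟩
    exact ⟨h1, (G.mem_region_iff (K.closure_subset_closure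
      (frontier_subset_closure (K.vertices_subset_frontier h1)))).1 h2⟩
  · rintro ⟨h1, h2⟩
    exact ⟨h1, (G.mem_region_iff (K.closure_subset_closure
      (frontier_subset_closure (K.vertices_subset_frontier h1)))).2 h2⟩

/-- The arc joins the point `B` of the side `s` to the point `B'` of the side `s'`; the boundary of
the rectangle lies in the subdomain `i` where `ς i` times the equation of the chord is positive. -/
structure IsChord (B B' : Plane) (s s' : Fin 2 × Bool) (ς : Fin 2 → ℝ) : Prop where
  ne : s ≠ s'
  left_mem : B ∈ K.openSide s
  right_mem : B' ∈ K.openSide s'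
  eq_or_eq : ∀ y ∈ frontier K.set, y ∈ G.Γ → y = B ∨ y = B'
  sign : ∀ i, ς i = 1 ∨ ς i = -1
  mem_phase_iff : ∀ i, ∀ y ∈ frontier K.set, y ∈ G.phase i ↔ 0 < ς i * lineForm B B' y

variable {K}

theorem IsChord.symm {B B' : Plane} {s s' : Fin 2 × Bool} {ς : Fin 2 → ℝ}
    (h : K.IsChord B B' s s' ς) : K.IsChord B' B s' s (fun i => -ς i) where
  ne := h.ne.symm
  left_mem := h.right_mem
  right_mem := h.left_mem
  eq_or_eq y hy hyΓ := (h.eq_or_eq y hy hyΓ).symm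
  sign i := by rcases h.sign i with h | h <;> simp [h]
  mem_phase_iff i y hy := by rw [h.mem_phase_iff i y hy, lineForm_swap]; simp

/-- The chord meets the boundary of the rectangle at its end points only. -/
theorem eq_or_eq_of_lineForm_eq_zero {R : Rect} {B B' : Plane} {s s' : Fin 2 × Bool} (hne : s ≠ s')
    (hB : B ∈ R.openSide s) (hB' : B' ∈ R.openSide s') {y : Plane} (hy : y ∈ frontier R.set)
    (h : lineForm B B' y = 0) : y = B ∨ y = B' := by
  obtain ⟨hB0, hBp⟩ := R.mem_openSide_iff.1 hB
  obtain ⟨hB'0, hB'p⟩ := R.mem_openSide_iff.1 hB'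
  have hBB' : B ≠ B' := by
    rintro rfl
    exact (hB'p s hne).ne' hB0
  obtain ⟨t, rfl⟩ := exists_of_lineForm_eq_zero hBB' h
  have hyd := (R.mem_frontier_iff.1 hy).1
  have h1 := hyd s
  have h2 := hyd s'
  rw [R.depth_combo _ _ _ (by ring), hB0] at h1
  rw [R.depth_combo _ _ _ (by ring), hB'0] at h2
  have h3 := hB'p s hne
  have h4 := hBp s' hne.symm
  have ht0 : 0 ≤ t := by
    by_contra ht
    have := mul_pos_of_neg_of_neg (not_le.1 ht) (neg_neg_of_pos h3)
    linarith
  have ht1 : t ≤ 1 := by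
    by_contra ht
    have := mul_pos (sub_pos.2 (not_le.1 ht)) h4
    linarith
  rcases ht0.eq_or_lt with rfl | ht0
  · left; simp
  rcases ht1.eq_or_lt with rfl | ht1
  · right; simp
  · exfalso
    rw [frontier, R.isOpen_set.interior_eq] at hy
    exact hy.2 (R.combo_mem_set hne hB hB' (by linarith) ht0 (by ring))

variable (K)

/-- The line of the chord divides the boundary of K into two connected parts which do not meet Γ, so
each lies in one phase. The phases differ, since otherwise one phase would contain all boundary
points near γ(0) except γ(0) itself. -/
theorem exists_isChord : ∃ s s' ς, K.IsChord (K.γ 0) (K.γ 1) s s' ς := by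
  obtain ⟨s, s', hne, hB, hB'⟩ := K.ends_γ
  set B := K.γ 0 with hBdef
  set B' := K.γ 1 with hB'def
  set c : Plane := (1 / 2 : ℝ) • B + (1 / 2 : ℝ) • B' with hc
  have hcK : c ∈ K.set := K.combo_mem_set hne hB hB' (by norm_num) (by norm_num) (by norm_num)
  have hline : ∀ y, lineForm B B' y = cross (B' - B) (y - c) := by
    intro y; simp [lineForm, cross, hc]; ring
  have hphase : ∀ d : Plane, (d = B' - B ∨ d = -(B' - B)) → ∃ i, {y | y ∈ frontier K.set ∧
      0 < cross d (y - c)} ⊆ G.phase i := by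
    intro d hd
    refine G.exists_subset_phase (isPreconnected_frontier_inter K.isOpen_set K.convex_set
      K.isBounded_set hcK d) (disjoint_left.2 ?_)
    rintro y ⟨hy, hpos⟩ hyΓ
    have h0 : lineForm B B' y = 0 := by
      rcases K.mem_ends_of_mem_frontier hy hyΓ with rfl | rfl
      · exact lineForm_left _ _
      · exact lineForm_right _ _
    rw [hline] at h0
    rcases hd with rfl | rfl
    · exact hpos.ne' h0
    · have : cross (-(B' - B)) (y - c) = -cross (B' - B) (y - c) := by simp [cross]; ring
      rw [this, h0] at hpos
      simp at hpos
  obtain ⟨i, hi⟩ := hphase _ (Or.inl rfl)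
  obtain ⟨j, hj⟩ := hphase _ (Or.inr rfl)
  have hi' : ∀ y ∈ frontier K.set, 0 < lineForm B B' y → y ∈ G.phase i := fun y hy h =>
    hi ⟨hy, by rwa [← hline]⟩
  have hj' : ∀ y ∈ frontier K.set, lineForm B B' y < 0 → y ∈ G.phase j := fun y hy h =>
    hj ⟨hy, by
      have : cross (-(B' - B)) (y - c) = -cross (B' - B) (y - c) := by simp [cross]; ring
      rw [this, ← hline]; linarith⟩
  have hij : i ≠ j := by
    rintro rfl
    refine K.not_eventually_mem_phase i ?_
    filter_upwards [isOpen_ne.mem_nhds K.zero_ne_one] with y hy1 hy hy0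
    rcases lt_trichotomy (lineForm B B' y) 0 with h | h | h
    · exact hj' y hy h
    · rcases eq_or_eq_of_lineForm_eq_zero hne hB hB' hy h with h | h
      · exact absurd h hy0
      · exact absurd h hy1
    · exact hi' y hy h
  have hΓ0 : ∀ k, B ∉ G.phase k ∧ B' ∉ G.phase k := fun k =>
    ⟨fun h => G.notMem_Γ_of_mem_phase h (K.γ_mem_Γ (left_mem_Icc.2 zero_le_one)).1,
      fun h => G.notMem_Γ_of_mem_phase h (K.γ_mem_Γ (right_mem_Icc.2 zero_le_one)).1⟩
  refine ⟨s, s', fun k => if k = i then 1 else -1, hne, hB, hB',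
    fun y hy hyΓ => K.mem_ends_of_mem_frontier hy hyΓ, fun k => ?_, fun k y hy => ?_⟩
  · by_cases h : k = i <;> simp [h]
  · have hkj : k = i ∨ k = j := by
      have key : ∀ i j k : Fin 2, i ≠ j → k = i ∨ k = j := by decide
      exact key i j k hij
    have hsgn : y ∈ G.phase k → lineForm B B' y ≠ 0 := by
      intro hk h0
      rcases eq_or_eq_of_lineForm_eq_zero hne hB hB' hy h0 with rfl | rfl
      · exact (hΓ0 k).1 hk
      · exact (hΓ0 k).2 hk
    rcases hkj with rfl | rfl
    · simp only [if_true, one_mul]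
      refine ⟨fun hk => ?_, hi' y hy⟩
      rcases lt_or_gt_of_ne (hsgn hk) with h | h
      · exact absurd (G.phase_inter hk (hj' y hy h)) hij
      · exact h
    · simp only [hij.symm, if_false]
      refine ⟨fun hk => ?_, fun h => hj' y hy (by linarith)⟩
      rcases lt_or_gt_of_ne (hsgn hk) with h | h
      · linarith
      · exact absurd (G.phase_inter (hi' y hy h) hk) hij

variable {K}

namespace IsChord

variable {B B' : Plane} {s s' : Fin 2 × Bool} {ς : Fin 2 → ℝ} (h : K.IsChord B B' s s' ς)
include h

theorem left_ne_right : B ≠ B' := by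
  rintro rfl
  exact ((K.mem_openSide_iff.1 h.right_mem).2 s h.ne).ne' (K.mem_openSide_iff.1 h.left_mem).1

/-- The end points of the arc are not close to the end points of their sides. -/
theorem le_depth {δ₀ : ℝ} (hδ₁ : δ₀ ≤ 1) (hl : ∀ i, K.IsLarge δ₀ i) {r : Fin 2 × Bool} (hr : r ≠ s) :
    δ₀ * K.width r.1 ≤ K.depth r B := by
  obtain ⟨hB0, hBp⟩ := K.mem_openSide_iff.1 h.left_mem
  obtain ⟨hB'0, hB'p⟩ := K.mem_openSide_iff.1 h.right_mem
  have hw := K.width_pos r.1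
  by_cases hrs : r.1 = s.1
  · have := K.depth_add_depth hrs hr B
    rw [hB0, zero_add] at this
    rw [this, hrs]
    rw [hrs] at hw
    nlinarith
  have hrs' : s.1 ≠ r.1 := fun h => hrs h.symm
  have hBc : B ∈ closure K.set := K.openSide_subset_closure s h.left_mem
  -- The end of the side s which lies on r. Only the segment from P to B of this side is in the
  -- phase of P, so largeness with respect to that phase bounds its length, the depth of B, from
  -- below.
  set P : Plane := B + (-K.depth r B) • Rect.normal r with hP
  have hPr : K.depth r P = 0 := by rw [hP, K.depth_add_normal]; ring
  have hPs : K.depth s P = 0 := by rw [hP, K.depth_add_normal_of_ne hrs', hB0]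
  have hPc : P ∈ closure K.set := K.mem_closure_of_depth hrs'
    (by rw [hPr]; exact ⟨le_rfl, hw.le⟩) (by rw [hPs]; exact ⟨le_rfl, (K.width_pos _).le⟩)
  have hPf : P ∈ frontier K.set := K.mem_frontier_iff.2 ⟨K.mem_closure_iff.1 hPc, r, hPr⟩
  have hPB : P ≠ B := by
    intro e; rw [e] at hPr; exact (hBp r hr).ne' hPr
  have hPB' : P ≠ B' := by
    intro e; rw [e] at hPs; exact (hB'p s h.ne).ne' hPs
  have hPΓ : P ∉ G.Γ := by
    intro hΓ
    rcases h.eq_or_eq P hPf hΓ with e | e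
    exacts [hPB e, hPB' e]
  obtain ⟨i, hi⟩ : ∃ i, P ∈ G.phase i := by
    rcases G.mem_phase_or hPΓ with e | e
    exacts [⟨0, e⟩, ⟨1, e⟩]
  have hform : ∀ t : ℝ, lineForm B B' (B + t • Rect.normal r) =
      t * cross (B' - B) (Rect.normal r) := by
    intro t; simp [lineForm, cross]; ring
  have hm : ς i * cross (B' - B) (Rect.normal r) < 0 := by
    have h1 := (h.mem_phase_iff i P hPf).1 hi
    rw [hP, hform] at h1
    have h2 := hBp r hr
    by_contra hcon
    have := mul_nonneg h2.le (not_lt.1 hcon)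
    linarith
  have hsub : K.side s ∩ G.region i ⊆ segment ℝ P B := by
    rintro y ⟨hy, hyi⟩
    obtain ⟨hyc, hys⟩ := K.mem_side_iff.1 hy
    have hyf : y ∈ frontier K.set := K.mem_frontier_iff.2 ⟨K.mem_closure_iff.1 hyc, s, hys⟩
    have hyi' := (G.mem_region_iff (K.closure_subset_closure hyc)).1 hyi
    have hye : y = B + (K.depth r y - K.depth r B) • Rect.normal r :=
      K.eq_add_normal hrs' (hB0.trans hys.symm)
    have h1 := (h.mem_phase_iff i y hyf).1 hyi'
    rw [hye, hform] at h1
    have h2 : K.depth r y - K.depth r B ≤ 0 := by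
      by_contra hcon
      have := mul_pos_of_neg_of_neg hm (neg_neg_of_pos (not_le.1 hcon))
      linarith
    have h3 := K.mem_closure_iff.1 hyc r
    have h4 := Rect.mem_segment_normal B (by linarith : -K.depth r B ≤ K.depth r y - K.depth r B)
      h2 r
    rwa [← hye, zero_smul, add_zero] at h4
  have hside : segment ℝ P (B + (K.width r.1 - K.depth r B) • Rect.normal r) ⊆ K.side s := by
    have hcv : Convex ℝ (K.side s) := by
      intro x hx y hy a b ha hb hab
      rw [K.mem_side_iff, K.mem_closure_iff] at hx hy ⊢
      refine ⟨fun q => ?_, ?_⟩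
      · rw [K.depth_combo _ _ _ hab]
        have := mul_nonneg ha (hx.1 q)
        have := mul_nonneg hb (hy.1 q)
        linarith
      · rw [K.depth_combo _ _ _ hab, hx.2, hy.2]; ring
    refine hcv.segment_subset (K.mem_side_iff.2 ⟨hPc, hPs⟩) (K.mem_side_iff.2 ⟨?_, ?_⟩)
    · refine K.mem_closure_of_depth hrs' ?_ ?_
      · rw [K.depth_add_normal]; exact ⟨by linarith, by linarith⟩
      · rw [K.depth_add_normal_of_ne hrs', hB0]; exact ⟨le_rfl, (K.width_pos _).le⟩
    · rw [K.depth_add_normal_of_ne hrs', hB0]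
  have hdw := K.depth_le_width r hBc
  have hd0 := K.mem_closure_iff.1 hBc r
  have hlarge := (hl i).1 s ⟨P, K.mem_side_iff.2 ⟨hPc, hPs⟩,
    (G.mem_region_iff (K.closure_subset_closure hPc)).2 hi⟩
  have h1 : ENNReal.ofReal δ₀ * ENNReal.ofReal (K.width r.1) ≤ ENNReal.ofReal (K.depth r B) := by
    have e1 := Rect.hausdorffMeasure_segment_normal B
      (by linarith : -K.depth r B ≤ K.width r.1 - K.depth r B) r
    have e2 := Rect.hausdorffMeasure_segment_normal B (by linarith : -K.depth r B ≤ 0) r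
    rw [← hP] at e1 e2
    rw [zero_smul, add_zero] at e2
    rw [show K.width r.1 - K.depth r B - -K.depth r B = K.width r.1 by ring] at e1
    rw [show 0 - -K.depth r B = K.depth r B by ring] at e2
    calc ENNReal.ofReal δ₀ * ENNReal.ofReal (K.width r.1)
        ≤ ENNReal.ofReal δ₀ * μH[1] (K.side s) := by
          rw [← e1]; exact mul_le_mul_right (measure_mono hside) _
      _ ≤ μH[1] (K.side s ∩ G.region i) := hlarge
      _ ≤ μH[1] (segment ℝ P B) := measure_mono hsub
      _ = _ := e2
  rw [← ENNReal.ofReal_mul' hw.le] at h1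
  exact (ENNReal.ofReal_le_ofReal_iff hd0).1 h1

end IsChord

end CutElement

/-! ### Regular elements: extrapolation across the interface from a vertex -/

/-- An open convex set is star-shaped about each point of its closure, so a vertex of K can serve as
centre of dilation. -/
theorem subset_dilation {A : Plane} {U : Set Plane} (hUo : IsOpen U) (hUc : Convex ℝ U)
    (hA : A ∈ closure U) {s : ℝ} (hs : 0 < s) (hs1 : s ≤ 1) {y : Plane} (hy : y ∈ U) :
    dilation (fun _ => 1) A s y ∈ U := by
  have h := hUc.combo_closure_interior_mem_interior hA (hUo.interior_eq.symm ▸ hy)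
    (a := 1 - s) (b := s) (by linarith) hs (by ring)
  rw [hUo.interior_eq] at h
  convert! h using 1
  ext j
  rw [dilation_apply]
  simp
  ring

namespace CutElement

variable {G : InterfaceGeometry} {K : CutElement G}

/-- The inverse trace inequality where the interface is close to a level line of an affine function
on a convex subset of the element. -/
theorem lintegral_curve_le_of_affine {p : ℕ} (hp : 1 ≤ p) {v : Plane → ℝ} (hv : v ∈ Qp p)
    {U : Set Plane} (hUo : IsOpen U) (hUc : Convex ℝ U) (hUK : U ⊆ K.set) {A : Plane}
    (hA : A ∈ closure U) {i : Fin 2} (hAi : A ∈ G.phase i) {g : Plane → ℝ} (hgc : Continuous g)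
    (hg : ∀ x y : Plane, ∀ a b : ℝ, a + b = 1 → g (a • x + b • y) = a * g x + b * g y)
    (hgA : g A = 0) {M : ℝ} (hM : 1 ≤ M) (hgM : ∀ u ∈ U, g u ≤ M) {η : ℝ} (hη : 0 ≤ η)
    (hη1 : η < 1) (hΓ : ∀ y ∈ U ∩ G.Γ, 1 - η ≤ g y) {z : Plane} {r : ℝ} (hz : Metric.ball z r ⊆ U)
    {c : ℝ} (hc : 0 < c) (hc1 : c ≤ 1) (hcr : 2 * M * (c * K.h) ≤ r) {S : Set Plane}
    (hS : ∀ x ∈ S, x ∈ closure U ∧ g x ≤ 1 + η) {τ : Plane} {ε : ℝ} (hflat : IsFlat ε τ S)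
    (hε0 : 0 ≤ ε) (hε : ε ≤ c / 24) :
    ∫⁻ x in S, sqE v x ∂μH[1] ≤ ENNReal.ofReal (convexConst c * p ^ 2 / K.h *
      T ((1 + 3 * η) / (1 - η)) ^ ((2 * p + 1) * 2)) * ∫⁻ x in K.piece i, sqE v x := by
  have hlevel : ∀ m : ℝ, IsOpen {y | g y < m} := fun m => isOpen_lt hgc continuous_const
  have hlevelc : ∀ m : ℝ, Convex ℝ {y | g y < m} := by
    intro m x hx y hy a b ha hb hab
    have hx' : g x < m := hx
    have hy' : g y < m := hy
    rw [mem_ofPred_eq, hg x y a b hab]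
    rcases ha.eq_or_lt with rfl | ha
    · have : b = 1 := by linarith
      rw [this]; linarith
    · have e : m = a * m + b * m := by rw [← add_mul, hab, one_mul]
      rw [e]
      exact add_lt_add_of_lt_of_le (mul_lt_mul_of_pos_left hx' ha)
        (mul_le_mul_of_nonneg_left hy'.le hb)
  have hclos : ∀ m, 0 < m → A ∈ closure (U ∩ {y | g y < m}) := fun m hm => by
    rw [inter_comm]
    exact (hlevel m).inter_closure ⟨by simpa [hgA] using hm, hA⟩
  -- D lies below all interface points of U and is attached to A, hence contained in K_i; E is large
  -- enough to have S in its closure.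
  set D := U ∩ {y | g y < 1 - η} with hD
  set E := U ∩ {y | g y < 1 + η} with hE
  have hEo : IsOpen E := hUo.inter (hlevel _)
  have hDo : IsOpen D := hUo.inter (hlevel _)
  have hEc : Convex ℝ E := hUc.inter (hlevelc _)
  have hDc : Convex ℝ D := hUc.inter (hlevelc _)
  have hDp : D ⊆ K.piece i := K.subset_piece (inter_subset_left.trans hUK) hDc.isPreconnected
    (disjoint_left.2 fun y hy hyΓ => (hΓ y ⟨hy.1, hyΓ⟩).not_gt hy.2) (hclos _ (by linarith)) hAi
  -- As g vanishes at A, dilation about A multiplies g by ρ and carries the level 1-η to 1+η.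
  set ρ := (1 + η) / (1 - η) with hρ
  have hρ1 : 1 ≤ ρ := by rw [hρ, le_div_iff₀ (by linarith)]; linarith
  have hρpos : 0 < ρ := by linarith
  have hgdil : ∀ (s : ℝ) (y : Plane), g (dilation (fun _ => 1) A s y) = s * g y := by
    intro s y
    have : dilation (fun _ => 1) A s y = (1 - s) • A + s • y := by
      ext j
      rw [dilation_apply]
      simp
      ring
    rw [this, hg _ _ _ _ (by ring), hgA]
    ring
  have hext := lintegral_dilation_le hv (k := fun _ => 1) (by norm_num) (A := A) (D := D)
    ((K.isBounded_set.subset hUK).subset inter_subset_left) hDo.measurableSet (by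
      rintro s ⟨hs0, hs1⟩ y ⟨hy, hyg⟩
      refine ⟨subset_dilation hUo hUc hA hs0 hs1 hy, ?_⟩
      rw [mem_ofPred_eq, hgdil]
      have hyg' : g y < 1 - η := hyg
      rcases le_or_gt (g y) 0 with h | h
      · have := mul_nonneg hs0.le (neg_nonneg.2 h)
        linarith
      · have := mul_le_of_le_one_left h.le hs1
        linarith) hρ1
  have hED : E ⊆ dilation (fun _ => 1) A ρ '' D := by
    rintro y ⟨hy, hyg⟩
    refine ⟨dilation (fun _ => 1) A ρ⁻¹ y,
      ⟨subset_dilation hUo hUc hA (inv_pos.2 hρpos) (inv_le_one_of_one_le₀ hρ1) hy, ?_⟩, ?_⟩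
    · rw [mem_ofPred_eq, hgdil, inv_mul_lt_iff₀ hρpos, hρ, div_mul_cancel₀ _ (by linarith)]
      exact hyg
    · ext j
      rw [dilation_apply, dilation_apply]
      simp [hρpos.ne']
  have h2ρ : 2 * ρ - 1 = (1 + 3 * η) / (1 - η) := by
    have : 1 - η ≠ 0 := by linarith
    rw [hρ]; field_simp; ring
  rw [h2ρ] at hext
  -- a ball in `E`
  have hMpos : 0 < M := by linarith
  -- Contracting the ball in U about A by 1/(2M) makes g ≤ 1/2 on it and leaves radius at least ch.
  set κ := (2 * M)⁻¹ with hκ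
  have hκpos : 0 < κ := by positivity
  have hκ1 : κ ≤ 1 := inv_le_one_of_one_le₀ (by linarith)
  have hball : Metric.ball (dilation (fun _ => 1) A κ z) (c * K.h) ⊆ E := by
    intro y hy
    obtain ⟨u, hyu⟩ : ∃ u, y = dilation (fun _ => 1) A κ u := by
      refine ⟨dilation (fun _ => 1) A κ⁻¹ y, ?_⟩
      ext j
      rw [dilation_apply, dilation_apply]
      simp [hκpos.ne']
    have hdist : dist y (dilation (fun _ => 1) A κ z) = κ * dist u z := by
      have e : dilation (fun _ => 1) A κ u - dilation (fun _ => 1) A κ z = κ • (u - z) := by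
        ext j
        rw [PiLp.sub_apply, dilation_apply, dilation_apply, PiLp.smul_apply, PiLp.sub_apply]
        simp
        ring
      rw [hyu, dist_eq_norm, dist_eq_norm, e, norm_smul, Real.norm_eq_abs, abs_of_pos hκpos]
    have huU : u ∈ U := by
      apply hz
      rw [Metric.mem_ball] at hy ⊢
      rw [hdist, hκ, inv_mul_lt_iff₀ (by positivity)] at hy
      linarith
    refine ⟨hyu ▸ subset_dilation hUo hUc hA hκpos hκ1 huU, ?_⟩
    rw [mem_ofPred_eq, hyu, hgdil]
    have h1 := mul_le_mul_of_nonneg_left (hgM u huU) hκpos.le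
    have h2 : κ * M = 1 / 2 := by rw [hκ]; field_simp
    linarith
  have hSE : S ⊆ closure E := by
    intro x hx
    obtain ⟨hxU, hxg⟩ := hS x hx
    refine mem_closure_of_tendsto (b := 𝓝[>] (0 : ℝ)) (f := fun t => (1 - t) • x + t •
      dilation (fun _ => 1) A κ z) ?_ ?_
    · have : ContinuousAt (fun t : ℝ => (1 - t) • x + t • dilation (fun _ => 1) A κ z) 0 := by
        fun_prop
      have h := this.tendsto
      simp only [sub_zero, one_smul, zero_smul, add_zero] at h
      exact h.mono_left nhdsWithin_le_nhds
    · have hzE : dilation (fun _ => 1) A κ z ∈ E :=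
        hball (Metric.mem_ball_self (mul_pos hc K.h_pos))
      filter_upwards [Ioo_mem_nhdsGT (zero_lt_one (α := ℝ))] with t ht
      constructor
      · have h := hUc.combo_closure_interior_mem_interior hxU (hUo.interior_eq.symm ▸ hzE.1)
          (a := 1 - t) (b := t) (by linarith [ht.2]) ht.1 (by ring)
        rwa [hUo.interior_eq] at h
      · rw [mem_ofPred_eq, hg _ _ _ _ (by ring)]
        have h1 := mul_le_mul_of_nonneg_left hxg (by linarith [ht.2] : 0 ≤ 1 - t)
        have h2 := mul_lt_mul_of_pos_left (show g (dilation (fun _ => 1) A κ z) < 1 + η from hzE.2)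
          ht.1
        linarith
  have hbox : ∀ x ∈ E, ∀ j, x j ∈ Icc (K.lo j) (K.lo j + K.h) := by
    intro x hx j
    have h1 := hUK hx.1 j
    have h2 := K.width_le_h j
    rw [Rect.width] at h2
    exact ⟨h1.1.le, by linarith [h1.2]⟩
  calc ∫⁻ x in S, sqE v x ∂μH[1]
      ≤ ENNReal.ofReal (convexConst c * p ^ 2 / K.h) * ∫⁻ x in E, sqE v x :=
        lintegral_curve_le_of_convex hp hv hEo hEc hc hc1 K.h_pos hball hbox hSE hflat hε0 hε
    _ ≤ ENNReal.ofReal (convexConst c * p ^ 2 / K.h) * (ENNReal.ofReal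
        (T ((1 + 3 * η) / (1 - η)) ^ ((2 * p + 1) * (1 + 1))) * ∫⁻ x in K.piece i, sqE v x) := by
        gcongr
        refine (lintegral_mono_set hED).trans (hext.trans ?_)
        gcongr
    _ = _ := by
        rw [← mul_assoc, ← ENNReal.ofReal_mul]
        have := convexConst_pos hc
        have := K.h_pos
        positivity

/-- Summation over the parts of a curve which consists of parts of the interface and of sides. -/
theorem lintegral_le_of_flat {ε : ℝ} {𝓕 : Set (Set Plane)} (h𝓕 : 𝓕.Finite) (hΓ : G.Γ ⊆ ⋃₀ 𝓕)
    (hflat : ∀ F ∈ 𝓕, ∃ τ, IsFlat ε τ F) (hε : 0 ≤ ε) {S : Set Plane}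
    (hS : S ⊆ G.Γ ∪ frontier K.set) {f : Plane → ℝ≥0∞} {M : ℝ≥0∞}
    (hM : ∀ F τ, IsFlat ε τ (S ∩ F) → ∫⁻ x in S ∩ F, f x ∂μH[1] ≤ M) :
    ∫⁻ x in S, f x ∂μH[1] ≤ (𝓕.ncard + 4 : ℕ) * M := by
  have h1 : ∫⁻ x in S ∩ G.Γ, f x ∂μH[1] ≤ 𝓕.ncard * M := by
    refine lintegral_le_of_sUnion h𝓕 (inter_subset_right.trans hΓ) fun F hF => ?_
    obtain ⟨τ, hτ⟩ := hflat F hF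
    refine le_trans (lintegral_mono_set ?_) (hM F τ (hτ.mono le_rfl inter_subset_right))
    exact inter_subset_inter_left _ inter_subset_left
  have h2 : ∫⁻ x in S ∩ frontier K.set, f x ∂μH[1] ≤ 4 * M := by
    have := lintegral_le_of_iUnion (μ := μH[1]) (S := S ∩ frontier K.set) (F := K.side) (f := f)
      (M := M) (by rw [← K.frontier_eq_iUnion_side]; exact inter_subset_right) fun s => ?_
    · refine this.trans (le_of_eq ?_)
      simp
    · obtain ⟨τ, hτ⟩ := K.isFlat_side s
      refine le_trans (lintegral_mono_set ?_) (hM (K.side s) τ (hτ.mono hε inter_subset_right))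
      exact inter_subset_inter_left _ inter_subset_left
  calc ∫⁻ x in S, f x ∂μH[1] ≤ ∫⁻ x in (S ∩ G.Γ) ∪ (S ∩ frontier K.set), f x ∂μH[1] := by
        refine lintegral_mono_set fun x hx => ?_
        rcases hS hx with h | h
        exacts [Or.inl ⟨hx, h⟩, Or.inr ⟨hx, h⟩]
    _ ≤ _ := lintegral_union_le _ _ _
    _ ≤ 𝓕.ncard * M + 4 * M := add_le_add h1 h2
    _ = _ := by push_cast; ring

variable (K)

theorem infDist_le_distH {s t : ℝ} (hs : 0 ≤ s) (ht : t ≤ 1) {T : Set Plane} (hT : T.Nonempty)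
    {u : ℝ} (hu : u ∈ Ioo s t) : Metric.infDist (K.γ u) T ≤ distH (K.γ '' Ioo s t) T := by
  obtain ⟨q, hq⟩ := hT
  -- The supremum in `distH` is over a bounded set, since the arc stays in the closed rectangle; for
  -- an unbounded set it would have the default value 0.
  refine le_csSup ⟨K.h + dist K.center q, ?_⟩ ⟨K.γ u, mem_image_of_mem _ hu, rfl⟩
  rintro _ ⟨_, ⟨r, hr, rfl⟩, rfl⟩
  have h1 : K.γ r ∈ closure K.set := (K.γ_mem_Γ ⟨hs.trans hr.1.le, hr.2.le.trans ht⟩).2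
  have h2 := K.dist_le_h h1 (subset_closure K.center_mem)
  exact (Metric.infDist_le_dist_of_mem hq).trans ((dist_triangle _ K.center _).trans (by linarith))

theorem distH_nonneg (S T : Set Plane) : 0 ≤ distH S T := by
  refine Real.sSup_nonneg ?_
  rintro _ ⟨x, -, rfl⟩
  exact Metric.infDist_nonneg

theorem height_nonneg (i : Fin 2) (P P' : Plane) : 0 ≤ K.height i P P' := by
  refine Real.sSup_nonneg ?_
  rintro _ ⟨x, -, rfl⟩
  exact Metric.infDist_nonneg

theorem relDeviation_nonneg (i : Fin 2) (s t : ℝ) : 0 ≤ K.relDeviation i s t :=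
  div_nonneg (distH_nonneg _ _) (K.height_nonneg _ _ _)

theorem etaSide_nonneg (i : Fin 2) : 0 ≤ K.etaSide i := by
  unfold etaSide
  split_ifs
  · exact (K.relDeviation_nonneg _ _ _).trans (le_max_left _ _)
  · exact K.relDeviation_nonneg _ _ _

theorem etaSide_le_eta (i : Fin 2) : K.etaSide i ≤ K.eta := by
  fin_cases i
  · exact le_max_left _ _
  · exact le_max_right _ _

theorem eta_nonneg : 0 ≤ K.eta := (K.etaSide_nonneg 0).trans (K.etaSide_le_eta 0)

/-- The deviation of the arc from its chord bounds the values of the equation of the chord. -/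
theorem abs_lineForm_le_of_relDeviation {i : Fin 2} {s t : ℝ} (hs : 0 ≤ s) (hst : s < t)
    (ht : t ≤ 1) {η : ℝ} (hη0 : 0 ≤ η) (hη : K.relDeviation i s t ≤ η)
    (hpos : 0 < K.height i (K.γ s) (K.γ t)) {u : ℝ} (hu : u ∈ Icc s t) :
    |lineForm (K.γ s) (K.γ t) (K.γ u)| ≤
      η * (K.height i (K.γ s) (K.γ t) * dist (K.γ s) (K.γ t)) := by
  have hR : 0 ≤ η * (K.height i (K.γ s) (K.γ t) * dist (K.γ s) (K.γ t)) := by positivity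
  have hne : K.γ s ≠ K.γ t := fun e =>
    hst.ne (K.injOn_γ ⟨hs, hst.le.trans ht⟩ ⟨hs.trans hst.le, ht⟩ e)
  rcases hu.1.eq_or_lt with rfl | h0
  · rwa [lineForm_left, abs_zero]
  rcases hu.2.eq_or_lt with rfl | h1
  · rwa [lineForm_right, abs_zero]
  refine (abs_lineForm_le hne _).trans ?_
  rw [← mul_assoc]
  refine mul_le_mul_of_nonneg_right ?_ dist_nonneg
  refine (K.infDist_le_distH hs ht ⟨_, midpoint_mem_openSegment _ _⟩ ⟨h0, h1⟩).trans ?_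
  rwa [relDeviation, div_le_iff₀ hpos] at hη

theorem finite_verticesIn (i : Fin 2) : (K.verticesIn i).Finite :=
  K.finite_vertices.subset inter_subset_left

/-- The height is attained at a vertex. -/
theorem exists_height_eq {i : Fin 2} (hne : (K.verticesIn i).Nonempty) {P P' : Plane} (hP : P ≠ P') :
    ∃ A ∈ K.verticesIn i, K.height i P P' * dist P P' = |lineForm P P' A| ∧
      ∀ A' ∈ K.verticesIn i, |lineForm P P' A'| ≤ |lineForm P P' A| := by
  have hfin := (K.finite_verticesIn i).image
    (fun A => Metric.infDist A (affineSpan ℝ {P, P'} : Set Plane))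
  obtain ⟨A, hA, hAe⟩ := (hne.image _).csSup_mem hfin
  refine ⟨A, hA, ?_, fun A' hA' => ?_⟩
  · rw [abs_lineForm_eq hP, height, ← hAe]
  · rw [abs_lineForm_eq hP, abs_lineForm_eq hP]
    refine mul_le_mul_of_nonneg_right ?_ dist_nonneg
    refine le_trans (le_csSup hfin.bddAbove (mem_image_of_mem _ hA')) hAe.ge

variable {K}

namespace IsChord

variable {B B' : Plane} {s s' : Fin 2 × Bool} {ς : Fin 2 → ℝ}

/-- Each subdomain contains a vertex which is not close to the chord. -/
theorem exists_vertex (h : K.IsChord B B' s s' ς) {δ₀ : ℝ} (hδ₀ : 0 ≤ δ₀) (hδ₁ : δ₀ ≤ 1)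
    (hl : ∀ i, K.IsLarge δ₀ i) (i : Fin 2) :
    ∃ A ∈ K.verticesIn i, K.depth s A = 0 ∧
      δ₀ ^ 2 * (K.width 0 * K.width 1) ≤ |lineForm B B' A| := by
  obtain ⟨hB0, hBp⟩ := K.mem_openSide_iff.1 h.left_mem
  obtain ⟨hB'0, hB'p⟩ := K.mem_openSide_iff.1 h.right_mem
  obtain ⟨k, hk⟩ := exists_ne s.1
  have hcr : ∀ b, |cross (B' - B) (Rect.normal (k, b))| = K.depth s B' := by
    intro b
    have h1 : |cross (B' - B) (Rect.normal (k, b))| = |K.depth s B' - K.depth s B| := by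
      have e : |K.depth s B' - K.depth s B| = |B' s.1 - B s.1| := by
        unfold Rect.depth
        split_ifs
        · rw [abs_sub_comm]; congr 1; ring
        · congr 1; ring
      rw [e]
      unfold cross Rect.normal
      obtain ⟨j, b'⟩ := s
      simp only at hk ⊢
      have key : (j = 0 ∧ k = 1) ∨ (j = 1 ∧ k = 0) := by
        revert hk; clear * -; revert j k; decide
      rcases key with ⟨rfl, rfl⟩ | ⟨rfl, rfl⟩ <;> cases b <;> simp
      · rw [abs_sub_comm]
      · rw [abs_sub_comm]
    rw [h1, hB0, sub_zero, abs_of_pos (hB'p s h.ne)]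
  have hneg : cross (B' - B) (Rect.normal (k, true)) =
      -cross (B' - B) (Rect.normal (k, false)) := by
    simp only [cross, Rect.normal, if_true]
    have e : ∀ l : Fin 2, (EuclideanSpace.single k (-1) : Plane) l =
        -(EuclideanSpace.single k 1 : Plane) l := by
      intro l
      by_cases hl : l = k <;> simp [hl]
    rw [e, e]
    simp
    ring
  -- Starting at B the equation of the chord has opposite signs towards the two ends of the side s,
  -- so exactly one end lies in Ω_i.
  obtain ⟨b, hb⟩ : ∃ b, ς i * cross (B' - B) (Rect.normal (k, b)) < 0 := by
    have h1 : cross (B' - B) (Rect.normal (k, false)) ≠ 0 := by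
      rw [← abs_pos, hcr]; exact hB'p s h.ne
    have h2 : ς i * cross (B' - B) (Rect.normal (k, false)) ≠ 0 := by
      refine mul_ne_zero ?_ h1
      rcases h.sign i with e | e <;> simp [e]
    rcases lt_or_gt_of_ne h2 with h3 | h3
    · exact ⟨false, h3⟩
    · exact ⟨true, by rw [hneg]; linarith⟩
  have hrs : s.1 ≠ (k, b).1 := hk.symm
  have hr : (k, b) ≠ s := fun e => hk (by rw [← e])
  set A : Plane := B + (-K.depth (k, b) B) • Rect.normal (k, b) with hA
  -- In absolute value this is the depth of B from the side (k, b) times the depth of B' from s;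
  -- both depths are at least δ₀ times a side length.
  have hform : lineForm B B' A = -K.depth (k, b) B * cross (B' - B) (Rect.normal (k, b)) := by
    rw [hA]; simp [lineForm, cross]; ring
  have hAv : A ∈ K.vertices := by
    refine K.mem_vertices_of_depth hrs ?_ ?_
    · rw [hA, K.depth_add_normal]; ring
    · rw [hA, K.depth_add_normal_of_ne hrs, hB0]
  have hd := hBp _ hr
  have hAs : K.depth s A = 0 := by rw [hA, K.depth_add_normal_of_ne hrs, hB0]
  refine ⟨A, K.mem_verticesIn_iff.2 ⟨hAv,
    (h.mem_phase_iff i A (K.vertices_subset_frontier hAv)).2 ?_⟩, hAs, ?_⟩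
  · rw [hform]
    have := mul_pos hd (neg_pos.2 hb)
    linarith
  · rw [hform, abs_mul, abs_neg, abs_of_pos hd, hcr]
    have h1 := h.le_depth hδ₁ hl hr
    have h2 := h.symm.le_depth hδ₁ hl h.ne
    have hw := K.width_pos
    have key : K.width 0 * K.width 1 = K.width k * K.width s.1 := by
      have : (s.1 = 0 ∧ k = 1) ∨ (s.1 = 1 ∧ k = 0) := by
        revert hk; generalize s.1 = j; clear * -; revert j k; decide
      rcases this with ⟨e1, e2⟩ | ⟨e1, e2⟩ <;> rw [e1, e2]
      ring
    rw [key]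
    calc δ₀ ^ 2 * (K.width k * K.width s.1) = (δ₀ * K.width k) * (δ₀ * K.width s.1) := by ring
      _ ≤ _ := mul_le_mul h1 h2 (mul_nonneg hδ₀ (hw _).le) hd.le

end IsChord

theorem ball_center_subset (R : Rect) {r : ℝ} (hr : ∀ j, r ≤ R.width j / 2) :
    Metric.ball R.center r ⊆ R.set := by
  intro y hy
  rw [R.mem_set_iff]
  intro s
  have h1 := R.abs_depth_sub_le s y R.center
  rw [R.depth_center] at h1
  have h2 := hr s.1
  rw [Metric.mem_ball] at hy
  linarith [(abs_le.1 h1).1]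

/-- The constant of the balls in the regular case. -/
def regularConst (δ₀ σ : ℝ) : ℝ := δ₀ ^ 2 / (8 * (1 + σ) ^ 3)

/-- The inverse trace inequality if the deviation of the whole arc is small. -/
theorem lintegral_frontier_le_of_regular {δ₀ σ : ℝ} (hδ₀ : 0 < δ₀) (hδ₁ : δ₀ ≤ 1) (hσ : 1 ≤ σ)
    (hK : ∀ j, K.h ≤ (1 + σ) * K.width j) (hl : ∀ i, K.IsLarge δ₀ i) {i : Fin 2} {η : ℝ}
    (hη0 : 0 ≤ η) (hη1 : η < 1) (hη : K.relDeviation i 0 1 ≤ η)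
    {ε : ℝ} {𝓕 : Set (Set Plane)} (h𝓕 : 𝓕.Finite) (hΓ : G.Γ ⊆ ⋃₀ 𝓕)
    (hflat : ∀ F ∈ 𝓕, ∃ τ, IsFlat ε τ F) (hε0 : 0 ≤ ε) (hε : ε ≤ regularConst δ₀ σ / 24)
    {p : ℕ} (hp : 1 ≤ p) {v : Plane → ℝ} (hv : v ∈ Qp p) :
    ∫⁻ x in frontier (K.piece i), sqE v x ∂μH[1] ≤ (𝓕.ncard + 4 : ℕ) *
      (ENNReal.ofReal (convexConst (regularConst δ₀ σ) * p ^ 2 / K.h *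
        T ((1 + 3 * η) / (1 - η)) ^ ((2 * p + 1) * 2)) * ∫⁻ x in K.piece i, sqE v x) := by
  obtain ⟨s, s', ς, h⟩ := K.exists_isChord
  set B := K.γ 0 with hB
  set B' := K.γ 1 with hB'
  obtain ⟨A₀, hA₀, -, hA₀le⟩ := h.exists_vertex hδ₀.le hδ₁ hl i
  obtain ⟨A, hA, hAh, hAmax⟩ := K.exists_height_eq ⟨A₀, hA₀⟩ h.left_ne_right
  have hAle := hA₀le.trans (hAmax A₀ hA₀)
  have hw := K.width_pos
  have hhp := K.h_pos
  have hww : 0 < δ₀ ^ 2 * (K.width 0 * K.width 1) :=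
    mul_pos (by positivity) (mul_pos (hw 0) (hw 1))
  have hLpos : 0 < |lineForm B B' A| := hww.trans_le hAle
  have hd : 0 < dist B B' := dist_pos.2 h.left_ne_right
  have hH : 0 < K.height i B B' := by
    by_contra hcon
    have := mul_nonpos_of_nonpos_of_nonneg (not_lt.1 hcon) hd.le
    linarith
  obtain ⟨hAv, hAi⟩ := K.mem_verticesIn_iff.1 hA
  have hAf := K.vertices_subset_frontier hAv
  have hAς := (h.mem_phase_iff i A hAf).1 hAi
  have hςL : ς i * lineForm B B' A = |lineForm B B' A| := by
    rcases h.sign i with e | e <;> rw [e] at hAς ⊢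
    · rw [one_mul] at *; rw [abs_of_pos hAς]
    · rw [neg_one_mul] at *; rw [abs_of_neg (by linarith)]
  set L := |lineForm B B' A| with hL
  have hς2 : ς i * ς i = 1 := by rcases h.sign i with e | e <;> rw [e] <;> norm_num
  -- Zero at A and one on the chord. The deviation gives |g-1| ≤ η on the arc, and g < 1 on the part
  -- of the boundary in phase i.
  set g : Plane → ℝ := fun y => 1 - ς i * lineForm B B' y / L with hg
  have hBc : B ∈ closure K.set := K.openSide_subset_closure s h.left_mem
  have hB'c : B' ∈ closure K.set := K.openSide_subset_closure s' h.right_mem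
  have hς1 : |ς i| = 1 := by rcases h.sign i with e | e <;> rw [e] <;> norm_num
  have hΓle : ∀ y ∈ closure K.set, y ∈ G.Γ → |lineForm B B' y| ≤ η * L := by
    intro y hy hyΓ
    have : y ∈ K.γ '' Icc 0 1 := by rw [K.image_γ]; exact ⟨hyΓ, hy⟩
    obtain ⟨u, hu, rfl⟩ := this
    rw [← hAh]
    exact K.abs_lineForm_le_of_relDeviation le_rfl zero_lt_one le_rfl hη0 hη hH hu
  have hgΓ : ∀ y ∈ closure K.set, y ∈ G.Γ → |g y - 1| ≤ η := by
    intro y hy hyΓ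
    have h1 := hΓle y hy hyΓ
    have : g y - 1 = -(ς i * lineForm B B' y / L) := by simp only [hg]; ring
    rw [this, abs_neg, abs_div, abs_mul, hς1, one_mul, abs_of_pos hLpos, div_le_iff₀ hLpos]
    exact h1
  -- On K the equation of the chord is at most h² in absolute value, while L ≥ δ₀² times the area of
  -- K, hence L ≥ δ₀²h²/(1+σ)².
  set M : ℝ := 2 * (1 + σ) ^ 2 / δ₀ ^ 2 with hM
  have hhw : K.h ^ 2 ≤ (1 + σ) ^ 2 * (K.width 0 * K.width 1) := by
    calc K.h ^ 2 = K.h * K.h := sq _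
      _ ≤ ((1 + σ) * K.width 0) * ((1 + σ) * K.width 1) :=
        mul_le_mul (hK 0) (hK 1) hhp.le (mul_nonneg (by linarith) (hw 0).le)
      _ = _ := by ring
  have hσ2 : 1 ≤ (1 + σ) ^ 2 / δ₀ ^ 2 := by
    rw [one_le_div (by positivity)]
    exact pow_le_pow_left₀ hδ₀.le (by linarith) 2
  have hM1 : 1 ≤ M := by
    rw [hM, mul_div_assoc]; linarith
  have hgM : ∀ u ∈ K.set, g u ≤ M := by
    intro u hu
    have h1 : |ς i * lineForm B B' u| ≤ K.h ^ 2 := by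
      rw [abs_mul, hς1, one_mul, sq, lineForm]
      refine (abs_cross_le _ _).trans ?_
      rw [← dist_eq_norm, ← dist_eq_norm]
      exact mul_le_mul (K.dist_le_h hB'c hBc) (K.dist_le_h (subset_closure hu) hBc) dist_nonneg
        hhp.le
    have h2 : -(ς i * lineForm B B' u) / L ≤ (1 + σ) ^ 2 / δ₀ ^ 2 := by
      rw [div_le_div_iff₀ hLpos (by positivity)]
      calc -(ς i * lineForm B B' u) * δ₀ ^ 2 ≤ K.h ^ 2 * δ₀ ^ 2 :=
            mul_le_mul_of_nonneg_right ((neg_le_abs _).trans h1) (by positivity)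
        _ ≤ ((1 + σ) ^ 2 * (K.width 0 * K.width 1)) * δ₀ ^ 2 :=
            mul_le_mul_of_nonneg_right hhw (by positivity)
        _ = (1 + σ) ^ 2 * (δ₀ ^ 2 * (K.width 0 * K.width 1)) := by ring
        _ ≤ (1 + σ) ^ 2 * L := mul_le_mul_of_nonneg_left hAle (by positivity)
    have h3 : g u = 1 + -(ς i * lineForm B B' u) / L := by simp only [hg]; ring
    rw [h3, hM, mul_div_assoc]
    linarith
  have hc : 0 < regularConst δ₀ σ := by unfold regularConst; positivity
  have hσ3 : 1 ≤ (1 + σ) ^ 3 := one_le_pow₀ (by linarith)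
  have hc1 : regularConst δ₀ σ ≤ 1 := by
    unfold regularConst
    rw [div_le_one (by positivity)]
    nlinarith
  have hsub : frontier (K.piece i) ⊆ G.Γ ∪ frontier K.set := fun x hx => by
    rcases K.frontier_piece_subset i hx with e | e
    exacts [Or.inl e.2, Or.inr e.1]
  refine lintegral_le_of_flat h𝓕 hΓ hflat hε0 hsub fun F τ hτ => ?_
  refine lintegral_curve_le_of_affine hp hv K.isOpen_set K.convex_set subset_rfl
    (frontier_subset_closure hAf) hAi (g := g) ?_ ?_ ?_ hM1 hgM hη0 hη1 ?_
    (ball_center_subset K.toRect (r := K.h / (2 * (1 + σ))) fun j => ?_) hc hc1 ?_ ?_ hτ hε0 hε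
  · have := continuous_lineForm B B'
    simp only [hg]
    fun_prop
  · intro x y a b hab
    simp only [hg]
    rw [lineForm_combo _ _ _ _ hab]
    have : L ≠ 0 := hLpos.ne'
    field_simp
    linear_combination (-L) * hab
  · simp only [hg]
    rw [hςL, div_self hLpos.ne', sub_self]
  · rintro y ⟨hy, hyΓ⟩
    linarith [(abs_le.1 (hgΓ y (subset_closure hy) hyΓ)).1]
  · rw [div_le_div_iff₀ (by linarith) (by norm_num)]
    linarith [hK j]
  -- `regularConst` is r/(2Mh) for the ball of radius r = h/(2(1+σ)) about the centre of K.
  · rw [hM, regularConst]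
    apply le_of_eq
    have : 1 + σ ≠ 0 := by linarith
    field_simp
    ring
  · rintro x ⟨hx, -⟩
    rcases K.frontier_piece_subset i hx with ⟨e1, e2⟩ | ⟨e1, e2⟩
    · exact ⟨e1, by linarith [(abs_le.1 (hgΓ x e1 e2)).2]⟩
    · refine ⟨frontier_subset_closure e1, ?_⟩
      have := div_pos ((h.mem_phase_iff i x e1).1 e2) hLpos
      simp only [hg]
      linarith

end CutElement

/-! ### Boxes at a vertex and dilations in one direction -/

namespace Rect

variable (K : Rect)

theorem mem_set_of_depth {s s' : Fin 2 × Bool} (h : s'.1 ≠ s.1) {y : Plane}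
    (hs : K.depth s y ∈ Ioo 0 (K.width s.1)) (hs' : K.depth s' y ∈ Ioo 0 (K.width s'.1)) :
    y ∈ K.set := by
  rw [mem_set_iff]
  have key : ∀ j k l : Fin 2, k ≠ j → l = j ∨ l = k := by decide
  intro r
  rcases key s.1 s'.1 r.1 h with hr | hr
  · by_cases hrs : r = s
    · rw [hrs]; exact hs.1
    · have := K.depth_add_depth hr hrs y
      linarith [hs.2]
  · by_cases hrs : r = s'
    · rw [hrs]; exact hs'.1
    · have := K.depth_add_depth hr hrs y
      linarith [hs'.2]

theorem depth_dilation (s r : Fin 2 × Bool) {A : Plane} (hA : K.depth r A = 0) (ρ : ℝ) (y : Plane) :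
    K.depth r (dilation (fun j => if j = s.1 then 1 else 0) A ρ y) =
      (if r.1 = s.1 then ρ else 1) * K.depth r y := by
  unfold depth at hA ⊢
  split_ifs at hA ⊢ with h1 h2 h2
  · rw [dilation_apply]; simp [h2] at hA ⊢; linear_combination (1 - ρ) * hA
  · rw [dilation_apply]; simp [h2]
  · rw [dilation_apply]; simp [h2] at hA ⊢; linear_combination (1 - ρ) * hA
  · rw [dilation_apply]; simp [h2]

/-- The rectangle with side lengths `m` and `r` at the common vertex of the sides `s` and `s'`. -/
def box (s s' : Fin 2 × Bool) (m r : ℝ) : Set Plane :=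
  {y | K.depth s y ∈ Ioo 0 m ∧ K.depth s' y ∈ Ioo 0 r}

variable {s s' : Fin 2 × Bool} {m r : ℝ}

theorem isOpen_box : IsOpen (K.box s s' m r) :=
  (isOpen_Ioo.preimage (K.continuous_depth s)).inter (isOpen_Ioo.preimage (K.continuous_depth s'))

theorem convex_preimage_depth (s : Fin 2 × Bool) {I : Set ℝ} (hI : Convex ℝ I) :
    Convex ℝ (K.depth s ⁻¹' I) := by
  intro x hx y hy a b ha hb hab
  rw [mem_preimage, K.depth_combo _ _ _ hab]
  exact hI hx hy ha hb hab

theorem convex_box : Convex ℝ (K.box s s' m r) :=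
  (K.convex_preimage_depth s (convex_Ioo 0 m)).inter (K.convex_preimage_depth s' (convex_Ioo 0 r))

theorem box_subset_set (h : s'.1 ≠ s.1) (hm : m ≤ K.width s.1) (hr : r ≤ K.width s'.1) :
    K.box s s' m r ⊆ K.set := fun _ hy =>
  K.mem_set_of_depth h ⟨hy.1.1, hy.1.2.trans_le hm⟩ ⟨hy.2.1, hy.2.2.trans_le hr⟩

theorem mem_closure_box (h : s'.1 ≠ s.1) {A : Plane} (hA : K.depth s A = 0) (hA' : K.depth s' A = 0)
    (hm : 0 < m) (hr : 0 < r) : A ∈ closure (K.box s s' m r) := by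
  refine mem_closure_of_tendsto (b := 𝓝[>] (0 : ℝ))
    (f := fun t => (A + t • normal s) + t • normal s') ?_ ?_
  · have : ContinuousAt (fun t : ℝ => (A + t • normal s) + t • normal s') 0 := by fun_prop
    have h := this.tendsto
    simp only [zero_smul, add_zero] at h
    exact h.mono_left nhdsWithin_le_nhds
  · filter_upwards [Ioo_mem_nhdsGT hm, Ioo_mem_nhdsGT hr] with t ht ht'
    constructor
    · rw [K.depth_add_normal_of_ne h.symm, K.depth_add_normal, hA, zero_add]; exact ht
    · rw [K.depth_add_normal, K.depth_add_normal_of_ne h, hA', zero_add]; exact ht'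

theorem ball_subset_box (h : s'.1 ≠ s.1) {A : Plane} (hA : K.depth s A = 0)
    (hA' : K.depth s' A = 0) (hrm : r ≤ m) :
    Metric.ball ((A + (r / 2) • normal s) + (r / 2) • normal s') (r / 2) ⊆ K.box s s' m r := by
  intro y hy
  rw [Metric.mem_ball] at hy
  have h1 := abs_lt.1 ((K.abs_depth_sub_le s y _).trans_lt hy)
  have h2 := abs_lt.1 ((K.abs_depth_sub_le s' y _).trans_lt hy)
  rw [K.depth_add_normal_of_ne h.symm, K.depth_add_normal, hA, zero_add] at h1
  rw [K.depth_add_normal, K.depth_add_normal_of_ne h, hA', zero_add] at h2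
  exact ⟨⟨by linarith, by linarith⟩, ⟨by linarith, by linarith⟩⟩

/-- Only one coordinate is dilated, so the exponent is 2p+1, half of that for a dilation of both.
The larger box may leave K, which is harmless because v is a polynomial on the whole plane. -/
theorem lintegral_box_le {p : ℕ} {v : Plane → ℝ} (hv : v ∈ Qp p) (h : s'.1 ≠ s.1) {A : Plane}
    (hA : K.depth s A = 0) (hA' : K.depth s' A = 0) (hm : m ≤ K.width s.1)
    (hr : r ≤ K.width s'.1) {ρ : ℝ} (hρ : 1 ≤ ρ) :
    ∫⁻ x in K.box s s' (ρ * m) r, sqE v x ≤ ENNReal.ofReal (T (2 * ρ - 1) ^ (2 * p + 1)) *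
      ∫⁻ x in K.box s s' m r, sqE v x := by
  set k : Fin 2 → ℕ := fun j => if j = s.1 then 1 else 0 with hk
  have hk1 : k 0 + k 1 = 1 := by
    rw [hk]; generalize s.1 = j; revert j; decide
  have hρ0 : 0 < ρ := by linarith
  have hd : ∀ ρ y, K.depth s (dilation k A ρ y) = ρ * K.depth s y := fun ρ y => by
    rw [hk, K.depth_dilation s s hA]; simp
  have hd' : ∀ ρ y, K.depth s' (dilation k A ρ y) = K.depth s' y := fun ρ y => by
    rw [hk, K.depth_dilation s s' hA']; simp [h]
  have h1 := lintegral_dilation_le hv (k := k) hk1.ge (A := A) (D := K.box s s' m r)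
    (K.isBounded_set.subset (K.box_subset_set h hm hr)) K.isOpen_box.measurableSet (by
      rintro t ⟨ht0, ht1⟩ y ⟨hy1, hy2⟩
      refine ⟨?_, by rwa [hd']⟩
      rw [hd]
      exact ⟨mul_pos ht0 hy1.1, (mul_le_of_le_one_left hy1.1.le ht1).trans_lt hy1.2⟩) hρ
  rw [hk1, mul_one] at h1
  refine (lintegral_mono_set ?_).trans h1
  rintro y ⟨hy1, hy2⟩
  refine ⟨dilation k A ρ⁻¹ y, ⟨?_, by rwa [hd']⟩, ?_⟩
  · rw [hd]
    exact ⟨mul_pos (inv_pos.2 hρ0) hy1.1, by rw [inv_mul_lt_iff₀ hρ0]; exact hy1.2⟩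
  · ext j
    rw [dilation_apply, dilation_apply, hk]
    by_cases hj : j = s.1 <;> simp [hj, hρ0.ne']

end Rect

/-! ### Irregular elements: the strips at the vertex and the rest of the arc -/

namespace CutElement

variable {G : InterfaceGeometry} (K : CutElement G)

/-- Only one vertex `A` lies in the subdomain `i`; the arc joins the sides `s` and `s'` which meet
there, and its parts `Γ₁` and `Γ₂` are close to straight lines. -/
structure IsCorner (i : Fin 2) (A : Plane) (s s' : Fin 2 × Bool) (Γ₁ Γ₂ : Set Plane)
    (b b' α β η κ : ℝ) : Prop where
  ne : s'.1 ≠ s.1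
  mem_phase : A ∈ G.phase i
  depth_left : K.depth s A = 0
  depth_right : K.depth s' A = 0
  mem_phase_iff : ∀ y ∈ frontier K.set, y ∈ G.phase i ↔
    (K.depth s y = 0 ∧ K.depth s' y < b) ∨ (K.depth s' y = 0 ∧ K.depth s y < b')
  frontier_inter : ∀ y ∈ frontier K.set, y ∈ G.Γ →
    (K.depth s y = 0 ∧ K.depth s' y = b) ∨ (K.depth s' y = 0 ∧ K.depth s y = b')
  mem_or_mem : ∀ y ∈ closure K.set, y ∈ G.Γ → y ∈ Γ₁ ∨ y ∈ Γ₂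
  -- In the application these affine functions vanish at A and are 1 on the chords from the end
  -- points of the arc to the singular point; b and b' are the distances of these end points from A.
  abs_left_le : ∀ y ∈ Γ₁, |K.depth s' y / b + β * K.depth s y - 1| ≤ η
  abs_right_le : ∀ y ∈ Γ₂, |K.depth s y / b' + α * K.depth s' y - 1| ≤ η
  le_depth_left : ∀ y ∈ Γ₁, (κ - η) * K.h ≤ K.depth s' y
  le_depth_right : ∀ y ∈ Γ₂, (κ - η) * K.h ≤ K.depth s y
  le_left : κ * K.h ≤ b
  le_right : κ * K.h ≤ b'
  left_le : b + κ * K.h ≤ K.width s'.1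
  right_le : b' + κ * K.h ≤ K.width s.1
  coeff_left : |β| * (κ ^ 2 * K.h) ≤ 1
  coeff_right : |α| * (κ ^ 2 * K.h) ≤ 1

namespace IsCorner

variable {K}
variable {i : Fin 2} {A : Plane} {s s' : Fin 2 × Bool} {Γ₁ Γ₂ : Set Plane} {b b' α β η κ : ℝ}

theorem symm (h : K.IsCorner i A s s' Γ₁ Γ₂ b b' α β η κ) :
    K.IsCorner i A s' s Γ₂ Γ₁ b' b β α η κ where
  ne := h.ne.symm
  mem_phase := h.mem_phase
  depth_left := h.depth_right
  depth_right := h.depth_left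
  mem_phase_iff y hy := (h.mem_phase_iff y hy).trans or_comm
  frontier_inter y hy hΓ := (h.frontier_inter y hy hΓ).symm
  mem_or_mem y hy hΓ := (h.mem_or_mem y hy hΓ).symm
  abs_left_le := h.abs_right_le
  abs_right_le := h.abs_left_le
  le_depth_left := h.le_depth_right
  le_depth_right := h.le_depth_left
  le_left := h.le_right
  le_right := h.le_left
  left_le := h.right_le
  right_le := h.left_le
  coeff_left := h.coeff_right
  coeff_right := h.coeff_left

/-- The inverse trace inequality near a side at the vertex, for small deviations. -/
theorem lintegral_strip_le_of_small (h : K.IsCorner i A s s' Γ₁ Γ₂ b b' α β η κ) (hκ : 0 < κ)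
    (hκ1 : κ ≤ 1) (hη0 : 0 ≤ η) (hη1 : η < 1) {e : ℝ} (he : 0 < e) (heκ : e + η ≤ κ)
    (heκ2 : e ≤ κ ^ 2) {S : Set Plane}
    (hS : S ⊆ {x ∈ frontier (K.piece i) | K.depth s' x < e * K.h}) {τ : Plane} {ε : ℝ}
    (hflat : IsFlat ε τ S) (hε0 : 0 ≤ ε) (hε : ε ≤ e * κ ^ 2 / 8 / 24)
    {p : ℕ} (hp : 1 ≤ p) {v : Plane → ℝ} (hv : v ∈ Qp p) :
    ∫⁻ x in S, sqE v x ∂μH[1] ≤ ENNReal.ofReal (convexConst (e * κ ^ 2 / 8) * p ^ 2 / K.h *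
      T ((1 + 3 * η) / (1 - η)) ^ ((2 * p + 1) * 2)) * ∫⁻ x in K.piece i, sqE v x := by
  have hh := K.h_pos
  have hκh : 0 < κ * K.h := mul_pos hκ hh
  have hb : 0 < b := hκh.trans_le h.le_left
  have hb' : 0 < b' := hκh.trans_le h.le_right
  have heκ' : e ≤ κ := by linarith
  have hek : e * K.h ≤ κ * K.h := mul_le_mul_of_nonneg_right heκ' hh.le
  have hr1 : e * K.h ≤ K.width s'.1 := by linarith [h.left_le]
  have hr2 : e * K.h ≤ K.width s.1 := by linarith [h.right_le]
  have hκsq : κ ^ 2 ≤ 1 := pow_le_one₀ hκ.le hκ1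
  have hopen : IsOpen {y | K.depth s' y < e * K.h} :=
    isOpen_lt (K.continuous_depth s') continuous_const
  have hcl : ∀ x ∈ closure K.set, K.depth s' x < e * K.h →
      x ∈ closure (K.set ∩ {y | K.depth s' y < e * K.h}) := fun x hx hx' => by
    rw [inter_comm]; exact hopen.inter_closure ⟨hx', hx⟩
  -- By e + η ≤ κ the strip is narrower than the distance of Γ₁ from the side s', so it sees Γ₂ only
  -- and one affine function suffices.
  have hΓs : ∀ y ∈ closure K.set, y ∈ G.Γ → K.depth s' y < e * K.h → y ∈ Γ₂ := by
    intro y hy hyΓ hlt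
    rcases h.mem_or_mem y hy hyΓ with h1 | h1
    · have h2 := h.le_depth_left y h1
      have h3 : e * K.h ≤ (κ - η) * K.h := mul_le_mul_of_nonneg_right (by linarith) hh.le
      linarith
    · exact h1
  have hAf : A ∈ frontier K.set :=
    K.vertices_subset_frontier (K.mem_vertices_of_depth h.ne h.depth_left h.depth_right)
  have hα : |α| * K.h ≤ 1 / κ ^ 2 := by
    rw [le_div_iff₀ (by positivity)]
    linarith [h.coeff_right]
  refine lintegral_curve_le_of_affine hp hv (K.isOpen_set.inter hopen)
    (K.convex_set.inter (K.convex_preimage_depth s' (convex_Iio _))) inter_subset_left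
    (hcl A (frontier_subset_closure hAf) ?_) h.mem_phase
    (g := fun y => K.depth s y / b' + α * K.depth s' y) ?_ ?_ ?_ (M := 2 / κ ^ 2) ?_ ?_ hη0 hη1 ?_
    (z := (A + (e * K.h / 2) • Rect.normal s) + (e * K.h / 2) • Rect.normal s')
    (r := e * K.h / 2) ?_ (by positivity) ?_ ?_ ?_ hflat hε0 hε
  · rw [h.depth_right]; positivity
  · have := K.continuous_depth s
    have := K.continuous_depth s'
    fun_prop
  · intro x y a c hac
    rw [K.depth_combo _ _ _ hac, K.depth_combo _ _ _ hac]
    ring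
  · rw [h.depth_left, h.depth_right]; simp
  · rw [one_le_div (by positivity)]; linarith
  · rintro u ⟨hu, -⟩
    have h1 := K.depth_le_h s (subset_closure hu)
    have h2 := K.depth_le_h s' (subset_closure hu)
    have h3 := K.mem_set_iff.1 hu s'
    have h4 : K.depth s u / b' ≤ 1 / κ ^ 2 := by
      rw [div_le_div_iff₀ hb' (by positivity)]
      have : K.depth s u * κ ^ 2 ≤ K.h * κ := by
        calc K.depth s u * κ ^ 2 ≤ K.h * κ ^ 2 := mul_le_mul_of_nonneg_right h1 (by positivity)
          _ = K.h * κ * κ := by ring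
          _ ≤ K.h * κ := mul_le_of_le_one_right (by positivity) hκ1
      linarith [h.le_right]
    have h5 : α * K.depth s' u ≤ |α| * K.h :=
      mul_le_mul (le_abs_self _) h2 h3.le (abs_nonneg _)
    have h6 : 2 / κ ^ 2 = 1 / κ ^ 2 + 1 / κ ^ 2 := by ring
    linarith
  · rintro y ⟨⟨hy1, hy2⟩, hyΓ⟩
    have := (abs_le.1 (h.abs_right_le y (hΓs y (subset_closure hy1) hyΓ hy2))).1
    linarith
  · intro y hy
    have h1 := K.ball_subset_box h.ne h.depth_left h.depth_right (le_refl (e * K.h)) hy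
    exact ⟨K.box_subset_set h.ne hr2 hr1 h1, h1.2.2⟩
  · have : e * κ ^ 2 ≤ 1 := mul_le_one₀ (by linarith) (by positivity) hκsq
    linarith
  -- The constant eκ²/8 is r/(2Mh) with r = eh/2 and M = 2/κ².
  · apply le_of_eq
    field_simp
    ring
  · intro x hx
    obtain ⟨hxf, hxlt⟩ := hS hx
    rcases K.frontier_piece_subset i hxf with ⟨h1, h2⟩ | ⟨h1, h2⟩
    · refine ⟨hcl x h1 hxlt, ?_⟩
      linarith [(abs_le.1 (h.abs_right_le x (hΓs x h1 h2 hxlt))).2]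
    · refine ⟨hcl x (frontier_subset_closure h1) hxlt, ?_⟩
      rcases (h.mem_phase_iff x h1).1 h2 with ⟨h3, h4⟩ | ⟨h3, h4⟩
      · rw [h3, zero_div, zero_add]
        have h5 := K.mem_closure_iff.1 (frontier_subset_closure h1) s'
        have h6 : α * K.depth s' x ≤ |α| * (κ ^ 2 * K.h) :=
          mul_le_mul (le_abs_self _)
            (hxlt.le.trans (mul_le_mul_of_nonneg_right heκ2 hh.le)) h5 (abs_nonneg _)
        linarith [h.coeff_right]
      · rw [h3, mul_zero, add_zero]
        have := (div_lt_one hb').2 h4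
        linarith

/-- The inverse trace inequality near a side at the vertex, for deviations bounded below. -/
theorem lintegral_strip_le_of_large (h : K.IsCorner i A s s' Γ₁ Γ₂ b b' α β η κ) (hκ : 0 < κ)
    (hκ1 : κ ≤ 1) (hη0 : 0 ≤ η) (hη1 : η < 1) {e ξ : ℝ} (he : 0 < e) (hξ : 4 * ξ ≤ η * (1 - η))
    (heξ : e ≤ ξ * κ ^ 2) {S : Set Plane}
    (hS : S ⊆ {x ∈ closure K.set | K.depth s' x < e * K.h ∧ K.depth s x < b' + e * K.h}) {τ : Plane}
    {ε : ℝ} (hflat : IsFlat ε τ S) (hε0 : 0 ≤ ε) (hε : ε ≤ e / 2 / 24)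
    {p : ℕ} (hp : 1 ≤ p) {v : Plane → ℝ} (hv : v ∈ Qp p) :
    ∫⁻ x in S, sqE v x ∂μH[1] ≤ ENNReal.ofReal (2 * convexConst (e / 2) * p ^ 2 / K.h *
      T ((1 + 3 * η) / (1 - η)) ^ ((2 * p + 1) * 2)) * ∫⁻ x in K.piece i, sqE v x := by
  have hh := K.h_pos
  have hκh : 0 < κ * K.h := mul_pos hκ hh
  have hb : 0 < b := hκh.trans_le h.le_left
  have hb' : 0 < b' := hκh.trans_le h.le_right
  have hκsq : κ ^ 2 ≤ κ := by rw [sq]; exact mul_le_of_le_one_left hκ.le hκ1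
  have hξ0 : 0 < ξ := by
    by_contra hcon
    have := mul_nonpos_of_nonpos_of_nonneg (not_lt.1 hcon) (sq_nonneg κ)
    linarith
  have hξ1 : 4 * ξ ≤ 1 - η := hξ.trans (mul_le_of_le_one_left (by linarith) hη1.le)
  have heκ : e ≤ κ := heξ.trans ((mul_le_of_le_one_left (sq_nonneg κ) (by linarith)).trans hκsq)
  set r := e * K.h with hr
  have hr0 : 0 < r := mul_pos he hh
  have hrκ : r ≤ κ * K.h := mul_le_mul_of_nonneg_right heκ hh.le
  have hrξ : r ≤ ξ * (κ ^ 2 * K.h) := by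
    rw [hr, ← mul_assoc]; exact mul_le_mul_of_nonneg_right heξ hh.le
  have hrξκ : r ≤ ξ * (κ * K.h) := hrξ.trans (mul_le_mul_of_nonneg_left
    (mul_le_mul_of_nonneg_right hκsq hh.le) hξ0.le)
  have hrb : r ≤ ξ * b := hrξκ.trans (mul_le_mul_of_nonneg_left h.le_left hξ0.le)
  have hrb' : r ≤ ξ * b' := hrξκ.trans (mul_le_mul_of_nonneg_left h.le_right hξ0.le)
  have hαr : |α| * r ≤ ξ := by
    calc |α| * r ≤ |α| * (ξ * (κ ^ 2 * K.h)) := mul_le_mul_of_nonneg_left hrξ (abs_nonneg _)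
      _ = ξ * (|α| * (κ ^ 2 * K.h)) := by ring
      _ ≤ ξ := mul_le_of_le_one_right hξ0.le h.coeff_right
  have hr1 : r ≤ K.width s'.1 := by linarith [h.left_le]
  have hbr : b' + r ≤ K.width s.1 := by linarith [h.right_le]
  -- In a strip of width r the terms α·depth from s' and (depth from s')/b are at most ξ. So Γ₂ has
  -- depth at least qb' from s, and Γ₁ can occur only where q ≤ β·depth ≤ 1+η.
  set q := 1 - η - ξ with hq
  have hq0 : 0 < q := by rw [hq]; linarith
  set c := q * b' with hc
  have hc0 : 0 < c := mul_pos hq0 hb'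
  have hcb : c ≤ b' := mul_le_of_le_one_left hb'.le (by rw [hq]; linarith)
  -- The factor ρ₁ carries q to 1+η+ξ, beyond the band of Γ₁; ρ₂ carries the height c = qb' to
  -- (1+ξ)b', which is at least b'+r.
  set ρ₁ := (1 + η + ξ) / q with hρ₁
  have hρ₁1 : 1 ≤ ρ₁ := by rw [hρ₁, one_le_div hq0, hq]; linarith
  set ρ₂ := (1 + ξ) / q with hρ₂
  have hρ₂1 : 1 ≤ ρ₂ := by rw [hρ₂, one_le_div hq0, hq]; linarith
  set I := ∫⁻ x in K.piece i, sqE v x with hI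
  have hT1 : 1 ≤ T (2 * ρ₁ - 1) ^ (2 * p + 1) := one_le_pow₀ (one_le_T (by linarith))
  -- no part of `Γ₂` is in the box of height `c`
  have hΓ₂ : ∀ y ∈ Γ₂, K.depth s' y ∈ Ioo 0 r → c ≤ K.depth s y := by
    intro y hy hyr
    have h1 := (abs_le.1 (h.abs_right_le y hy)).1
    have h2 : α * K.depth s' y ≤ ξ :=
      (mul_le_mul (le_abs_self _) hyr.2.le hyr.1.le (abs_nonneg _)).trans hαr
    have h3 : q ≤ K.depth s y / b' := by rw [hq]; linarith
    rwa [le_div_iff₀ hb'] at h3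
  have hΓ₁ : ∀ y ∈ Γ₁, K.depth s' y ∈ Ioo 0 r →
      q ≤ β * K.depth s y ∧ β * K.depth s y ≤ 1 + η := by
    intro y hy hyr
    have h1 := abs_le.1 (h.abs_left_le y hy)
    have h2 : 0 < K.depth s' y / b := div_pos hyr.1 hb
    have h3 : K.depth s' y / b ≤ ξ := by
      rw [div_le_iff₀ hb]; linarith [hyr.2]
    constructor
    · rw [hq]; linarith
    · linarith
  have hpiece : ∀ m, 0 < m → m ≤ c → (∀ y ∈ K.box s s' m r, y ∈ Γ₁ → False) →
      K.box s s' m r ⊆ K.piece i := by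
    intro m hm hmc hno
    have hsub : K.box s s' m r ⊆ K.set := K.box_subset_set h.ne (by linarith) hr1
    refine K.subset_piece hsub K.convex_box.isPreconnected (disjoint_left.2 fun y hy hyΓ => ?_)
      (K.mem_closure_box h.ne h.depth_left h.depth_right hm hr0) h.mem_phase
    rcases h.mem_or_mem y (subset_closure (hsub hy)) hyΓ with h1 | h1
    · exact hno y hy h1
    · have := hΓ₂ y h1 hy.2
      linarith [hy.1.2]
  -- The box of height c is in K_i except possibly for the band of Γ₁. Below the band it is attached
  -- to A, above it to the side s'; the band itself is covered by dilating the lower box by ρ₁. The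
  -- factor 2 adds the two contributions.
  have hboxc : ∫⁻ x in K.box s s' c r, sqE v x ≤
      ENNReal.ofReal (2 * T (2 * ρ₁ - 1) ^ (2 * p + 1)) * I := by
    by_cases hno : ∀ y ∈ K.box s s' c r, y ∈ Γ₁ → False
    · refine (lintegral_mono_set (hpiece c hc0 le_rfl hno)).trans ?_
      calc I = ENNReal.ofReal 1 * I := by simp
        _ ≤ _ := by gcongr; linarith
    push Not at hno
    obtain ⟨y₀, hy₀, hy₀Γ, -⟩ := hno
    have hβ : 0 < β := by
      have h1 := (hΓ₁ y₀ hy₀Γ hy₀.2).1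
      by_contra hcon
      have := mul_nonpos_of_nonpos_of_nonneg (not_lt.1 hcon) hy₀.1.1.le
      linarith
    set m := min (q / β) c with hm
    have hm0 : 0 < m := lt_min (div_pos hq0 hβ) hc0
    have h1 : K.box s s' m r ⊆ K.piece i := by
      refine hpiece m hm0 (min_le_right _ _) fun y hy hyΓ => ?_
      have h2 := (hΓ₁ y hyΓ hy.2).1
      have h3 := hy.1.2.trans_le (min_le_left _ _)
      rw [lt_div_iff₀ hβ] at h3
      linarith
    have h2 := K.lintegral_box_le hv h.ne h.depth_left h.depth_right
      (m := m) (r := r) ((min_le_right _ _).trans (by linarith)) hr1 hρ₁1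
    have h3 : K.box s s' c r ⊆ K.box s s' (ρ₁ * m) r ∪ K.piece i := by
      by_cases hmc : c ≤ q / β
      · intro y hy
        left
        refine ⟨⟨hy.1.1, ?_⟩, hy.2⟩
        have : m = c := min_eq_right hmc
        rw [this]
        exact hy.1.2.trans_le (le_mul_of_one_le_left hc0.le hρ₁1)
      · have hmeq : ρ₁ * m = (1 + η + ξ) / β := by
          rw [hm, min_eq_left (not_le.1 hmc).le, hρ₁]
          field_simp
        intro y hy
        by_cases hylt : K.depth s y < ρ₁ * m
        · exact Or.inl ⟨⟨hy.1.1, hylt⟩, hy.2⟩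
        right
        set U : Set Plane := {y | K.depth s y ∈ Ioo ((1 + η) / β) c ∧ K.depth s' y ∈ Ioo 0 r} with hU
        have hlow : 0 < (1 + η) / β := div_pos (by linarith) hβ
        have hUb : U ⊆ K.box s s' c r := fun z hz => ⟨⟨hlow.trans hz.1.1, hz.1.2⟩, hz.2⟩
        have hUK : U ⊆ K.set := hUb.trans (K.box_subset_set h.ne (by linarith) hr1)
        have hUc : Convex ℝ U := (K.convex_preimage_depth s (convex_Ioo _ c)).inter
          (K.convex_preimage_depth s' (convex_Ioo 0 r))
        have hyU : y ∈ U := by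
          refine ⟨⟨?_, hy.1.2⟩, hy.2⟩
          refine lt_of_lt_of_le ?_ (not_lt.1 hylt)
          rw [hmeq]
          exact div_lt_div_of_pos_right (by linarith) hβ
        -- The foot of y on the side s' has depth less than b' from s, so it lies in phase i and
        -- connects the upper part of the box to K_i.
        set y' : Plane := y + (-K.depth s' y) • Rect.normal s' with hy'
        have hy'1 : K.depth s' y' = 0 := by rw [hy', K.depth_add_normal]; ring
        have hy'2 : K.depth s y' = K.depth s y := K.depth_add_normal_of_ne h.ne.symm _ _
        have hy'U : y' ∈ closure U := by
          refine mem_closure_of_tendsto (b := 𝓝[<] (K.depth s' y))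
            (f := fun t => y + (-t) • Rect.normal s') ?_ ?_
          · have : ContinuousAt (fun t : ℝ => y + (-t) • Rect.normal s') (K.depth s' y) := by
              fun_prop
            exact this.tendsto.mono_left nhdsWithin_le_nhds
          · filter_upwards [Ioo_mem_nhdsLT hy.2.1] with t ht
            refine ⟨?_, ?_⟩
            · rw [K.depth_add_normal_of_ne h.ne.symm]; exact hyU.1
            · rw [K.depth_add_normal]; exact ⟨by linarith [ht.2], by linarith [ht.1, hy.2.2]⟩
        have hy'f : y' ∈ frontier K.set := K.mem_frontier_iff.2
          ⟨K.mem_closure_iff.1 (closure_mono hUK hy'U), s', hy'1⟩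
        refine K.subset_piece hUK hUc.isPreconnected (disjoint_left.2 fun z hz hzΓ => ?_) hy'U
          ((h.mem_phase_iff y' hy'f).2 (Or.inr ⟨hy'1, by rw [hy'2]; linarith [hy.1.2]⟩)) hyU
        rcases h.mem_or_mem z (subset_closure (hUK hz)) hzΓ with h4 | h4
        · have h5 := (hΓ₁ z h4 hz.2).2
          have h6 := hz.1.1
          rw [div_lt_iff₀ hβ] at h6
          linarith
        · have := hΓ₂ z h4 hz.2
          linarith [hz.1.2]
    calc ∫⁻ x in K.box s s' c r, sqE v x
        ≤ ∫⁻ x in K.box s s' (ρ₁ * m) r ∪ K.piece i, sqE v x := lintegral_mono_set h3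
      _ ≤ (∫⁻ x in K.box s s' (ρ₁ * m) r, sqE v x) + I := lintegral_union_le _ _ _
      _ ≤ ENNReal.ofReal (T (2 * ρ₁ - 1) ^ (2 * p + 1)) * I +
          ENNReal.ofReal (T (2 * ρ₁ - 1) ^ (2 * p + 1)) * I := by
          refine add_le_add (h2.trans (mul_le_mul_right (lintegral_mono_set h1) _)) ?_
          calc I = ENNReal.ofReal 1 * I := by simp
            _ ≤ _ := by gcongr
      _ = _ := by
          rw [← add_mul, ← ENNReal.ofReal_add (by linarith) (by linarith), ← two_mul]
  have hboxE : ∫⁻ x in K.box s s' (b' + r) r, sqE v x ≤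
      ENNReal.ofReal (2 * T ((1 + 3 * η) / (1 - η)) ^ ((2 * p + 1) * 2)) * I := by
    have h1 := K.lintegral_box_le hv h.ne h.depth_left h.depth_right
      (m := c) (r := r) (by linarith) hr1 hρ₂1
    have h2 : b' + r ≤ ρ₂ * c := by
      have : ρ₂ * c = (1 + ξ) * b' := by rw [hρ₂, hc]; field_simp
      rw [this]; linarith
    have h3 : K.box s s' (b' + r) r ⊆ K.box s s' (ρ₂ * c) r := fun y hy =>
      ⟨⟨hy.1.1, hy.1.2.trans_le h2⟩, hy.2⟩
    -- Midpoint concavity of log T reduces the product to the mean of the arguments,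
    -- (1+2η+3ξ)/(1-η-ξ). It is at most (1+3η)/(1-η) exactly when 4ξ ≤ η(1-η).
    have h4 : T (2 * ρ₂ - 1) * T (2 * ρ₁ - 1) ≤ T ((1 + 3 * η) / (1 - η)) ^ 2 := by
      refine (T_mul_T_le (by linarith) (by linarith)).trans ?_
      have h5 : (2 * ρ₂ - 1 + (2 * ρ₁ - 1)) / 2 ≤ (1 + 3 * η) / (1 - η) := by
        have e1 : (2 * ρ₂ - 1 + (2 * ρ₁ - 1)) / 2 = (2 + η + 2 * ξ - q) / q := by
          rw [hρ₁, hρ₂]; field_simp; ring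
        rw [e1, div_le_div_iff₀ hq0 (by linarith), hq]
        nlinarith
      have h6 := T_mono (by linarith : 1 ≤ (2 * ρ₂ - 1 + (2 * ρ₁ - 1)) / 2) h5
      have h7 := one_le_T (by linarith : 1 ≤ (2 * ρ₂ - 1 + (2 * ρ₁ - 1)) / 2)
      exact pow_le_pow_left₀ (by linarith) h6 2
    have hT0 : 0 ≤ T (2 * ρ₂ - 1) := by linarith [one_le_T (by linarith : 1 ≤ 2 * ρ₂ - 1)]
    have hT0' : 0 ≤ T (2 * ρ₁ - 1) := by linarith [one_le_T (by linarith : 1 ≤ 2 * ρ₁ - 1)]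
    calc ∫⁻ x in K.box s s' (b' + r) r, sqE v x
        ≤ ∫⁻ x in K.box s s' (ρ₂ * c) r, sqE v x := lintegral_mono_set h3
      _ ≤ ENNReal.ofReal (T (2 * ρ₂ - 1) ^ (2 * p + 1)) *
          (ENNReal.ofReal (2 * T (2 * ρ₁ - 1) ^ (2 * p + 1)) * I) := h1.trans (by gcongr)
      _ = ENNReal.ofReal (2 * (T (2 * ρ₂ - 1) * T (2 * ρ₁ - 1)) ^ (2 * p + 1)) * I := by
          rw [← mul_assoc, ← ENNReal.ofReal_mul (by positivity)]
          congr 2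
          rw [mul_pow]; ring
      _ ≤ _ := by
          rw [mul_comm (2 * p + 1) 2, pow_mul (T ((1 + 3 * η) / (1 - η)))]
          gcongr
  have hbox : ∀ x ∈ K.box s s' (b' + r) r, ∀ j, x j ∈ Icc (K.lo j) (K.lo j + K.h) := by
    intro x hx j
    have h1 := K.box_subset_set h.ne hbr hr1 hx j
    have h2 := K.width_le_h j
    rw [Rect.width] at h2
    exact ⟨h1.1.le, by linarith [h1.2]⟩
  have hSE : S ⊆ closure (K.box s s' (b' + r) r) := by
    intro x hx
    obtain ⟨h1, h2, h3⟩ := hS hx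
    have hopen : IsOpen {y | K.depth s' y < r ∧ K.depth s y < b' + r} :=
      (isOpen_lt (K.continuous_depth s') continuous_const).inter
        (isOpen_lt (K.continuous_depth s) continuous_const)
    refine closure_mono ?_ (hopen.inter_closure ⟨⟨h2, h3⟩, h1⟩)
    rintro y ⟨⟨h4, h5⟩, h6⟩
    exact ⟨⟨K.mem_set_iff.1 h6 s, h5⟩, ⟨K.mem_set_iff.1 h6 s', h4⟩⟩
  have hball := K.ball_subset_box h.ne h.depth_left h.depth_right (by linarith : r ≤ b' + r)
  have hr2 : r / 2 = e / 2 * K.h := by rw [hr]; ring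
  rw [hr2] at hball
  refine (lintegral_curve_le_of_convex hp hv K.isOpen_box K.convex_box (by positivity)
    (by linarith) hh hball hbox hSE hflat hε0 hε).trans ?_
  calc _ ≤ ENNReal.ofReal (convexConst (e / 2) * p ^ 2 / K.h) *
        (ENNReal.ofReal (2 * T ((1 + 3 * η) / (1 - η)) ^ ((2 * p + 1) * 2)) * I) := by gcongr
    _ = _ := by
      have := convexConst_pos (half_pos he)
      rw [← mul_assoc, ← ENNReal.ofReal_mul (by positivity)]
      congr 2
      ring

end IsCorner

end CutElement

/-- A direction close to a given one and transversal to a flat curve. -/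
theorem exists_transversal {τ d : Plane} (hτ : ‖τ‖ = 1) (hd : ‖d‖ = 1) {α : ℝ} (hα : 0 ≤ α)
    (hα1 : α ≤ 1) : ∃ u, dist u d ≤ α ∧ ‖u‖ ≤ 2 ∧ α / 2 ≤ |cross τ u| := by
  have hτ2 : τ 0 ^ 2 + τ 1 ^ 2 = 1 := by rw [normSq_eq, hτ]; norm_num
  by_cases h : α / 2 ≤ |cross τ d|
  · exact ⟨d, by simpa using hα, by linarith, h⟩
  set ν : Plane := !₂[-τ 1, τ 0] with hν
  have hν1 : ‖ν‖ = 1 := by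
    have h1 : ‖ν‖ ^ 2 = 1 := by rw [← normSq_eq, hν]; simp; linarith
    exact (pow_eq_one_iff_of_nonneg (norm_nonneg ν) two_ne_zero).1 h1
  have hnorm : ‖α • ν‖ = α := by rw [norm_smul, hν1, mul_one, Real.norm_eq_abs, abs_of_nonneg hα]
  refine ⟨d + α • ν, ?_, ?_, ?_⟩
  · rw [dist_eq_norm, add_sub_cancel_left, hnorm]
  · exact (norm_add_le _ _).trans (by linarith)
  · have e : cross τ (d + α • ν) = cross τ d + α := by
      simp [cross, hν]; linear_combination α * hτ2
    rw [e]
    have := abs_lt.1 (not_le.1 h)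
    rw [abs_of_nonneg (by linarith)]
    linarith

namespace CutElement

variable {G : InterfaceGeometry} {K : CutElement G}

namespace IsCorner

variable {i : Fin 2} {A : Plane} {s s' : Fin 2 × Bool} {Γ₁ Γ₂ : Set Plane} {b b' α β η κ : ℝ}

/-- The inverse trace inequality away from the sides which meet at the vertex. -/
theorem lintegral_cone_le (h : K.IsCorner i A s s' Γ₁ Γ₂ b b' α β η κ) {r : ℝ} (hr : 0 < r)
    {a l : ℝ} (ha : 0 < a) (ha1 : a ≤ 1) {F : Set Plane} (hF : G.HasCone a l F) {t₀ : ℝ}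
    (ht₀ : 0 < t₀) (htl : t₀ ≤ l) (htr : 2 * t₀ ≤ r) {S : Set Plane}
    (hS : S ⊆ F ∩ {x | x ∈ closure K.set ∧ x ∈ G.Γ ∧ ¬(K.depth s' x < r ∧ K.depth s x < b' + r) ∧
      ¬(K.depth s x < r ∧ K.depth s' x < b + r)}) {τ : Plane} {ε : ℝ}
    (hflat : IsFlat ε τ S) (hε : ε ≤ a / 16)
    {p : ℕ} (hp : 1 ≤ p) {v : Plane → ℝ} (hv : v ∈ Qp p) :
    ∫⁻ x in S, sqE v x ∂μH[1] ≤ ENNReal.ofReal (50 * p ^ 2 / (a * t₀ / 8)) *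
      ∫⁻ x in K.piece i, sqE v x := by
  obtain ⟨d₀, hd₀, hcone⟩ := hF
  obtain ⟨u, hud, hu2, hτu⟩ := exists_transversal hflat.1 hd₀ ha.le ha1
  obtain ⟨d, hd, hdτ, hdir⟩ : ∃ d : Plane, ‖d‖ ≤ 2 * t₀ ∧ a * t₀ / 2 ≤ |cross τ d| ∧
      ∀ x ∈ F, ∀ t ∈ Ioo (0 : ℝ) 1, x + t • d ∈ G.sub i := by
    have htt : ∀ t ∈ Ioo (0 : ℝ) 1, t * t₀ ∈ Ioo 0 l := fun t ht =>
      ⟨mul_pos ht.1 ht₀, (mul_lt_of_lt_one_left ht₀ ht.2).trans_le htl⟩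
    have hn : ‖t₀ • u‖ ≤ 2 * t₀ := by
      rw [norm_smul, Real.norm_eq_abs, abs_of_pos ht₀]
      linarith [mul_le_mul_of_nonneg_left hu2 ht₀.le]
    have hc : a * t₀ / 2 ≤ |cross τ (t₀ • u)| := by
      rw [cross_smul, abs_mul, abs_of_pos ht₀]
      linarith [mul_le_mul_of_nonneg_left hτu ht₀.le]
    fin_cases i
    · refine ⟨t₀ • u, hn, hc, fun x hx t ht => ?_⟩
      rw [smul_smul]
      exact (hcone x hx u hud _ (htt t ht)).1
    · refine ⟨-(t₀ • u), by rwa [norm_neg], ?_, fun x hx t ht => ?_⟩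
      · have : cross τ (-(t₀ • u)) = -cross τ (t₀ • u) := by simp [cross]; ring
        rwa [this, abs_neg]
      · rw [smul_neg, smul_smul, ← sub_eq_add_neg]
        exact (hcone x hx u hud _ (htt t ht)).2
  have hflat' : ∀ x ∈ S, ∀ y ∈ S, a * t₀ / 8 * dist x y ≤ |cross d (x - y)| := by
    intro x hx y hy
    have h1 := hflat.2 x hx y hy
    rw [dist_eq_norm] at h1 ⊢
    have h2 := le_abs_cross_of_flat hflat.1 h1 (by linarith) hdτ (by
      calc ε * ‖d‖ ≤ a / 16 * (2 * t₀) := mul_le_mul hε hd (norm_nonneg _) (by linarith)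
        _ = a * t₀ / 2 / 4 := by ring)
    linarith
  refine lintegral_curve_le hp hv (K.isOpen_piece i).measurableSet (by positivity) hflat' ?_
  intro x hx t ht
  obtain ⟨hxF, hxK, hxΓ, hn1, hn2⟩ := hS hx
  refine ⟨?_, hdir x hxF t ht⟩
  have hdist : ∀ t ∈ Ioo (0 : ℝ) 1, dist x (x + t • d) < r := by
    intro t ht
    rw [dist_eq_norm, sub_add_cancel_left, norm_neg, norm_smul, Real.norm_eq_abs, abs_of_pos ht.1]
    calc t * ‖d‖ ≤ t * (2 * t₀) := mul_le_mul_of_nonneg_left hd ht.1.le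
      _ < 2 * t₀ := mul_lt_of_lt_one_left (by linarith) ht.2
      _ ≤ r := htr
  -- Interface points on the boundary of K are end points of the arc, and both belong to the
  -- excluded strips.
  have hxs : x ∈ K.set := by
    by_contra hcon
    have hxf : x ∈ frontier K.set := by
      rw [frontier, K.isOpen_set.interior_eq]; exact ⟨hxK, hcon⟩
    rcases h.frontier_inter x hxf hxΓ with ⟨h1, h2⟩ | ⟨h1, h2⟩
    · exact hn2 ⟨by rw [h1]; exact hr, by rw [h2]; linarith⟩
    · exact hn1 ⟨by rw [h1]; exact hr, by rw [h2]; linarith⟩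
  -- A segment that leaves K crosses ∂K at a point of phase i, on one of the two sides at A. This
  -- point is closer than r to x, which would put x into an excluded strip.
  by_contra hcon
  set P : Set Plane := (fun q : ℝ => x + q • d) '' Icc 0 t with hP
  have hPc : IsPreconnected P := isPreconnected_Icc.image _ (by fun_prop)
  have hPf : ∃ y ∈ P, y ∈ frontier K.set := by
    by_contra hno
    push Not at hno
    have hcov : P ⊆ K.set ∪ (closure K.set)ᶜ := by
      intro y hy
      by_cases hyK : y ∈ closure K.set
      · left
        by_contra hys
        refine hno y hy ?_
        rw [frontier, K.isOpen_set.interior_eq]; exact ⟨hyK, hys⟩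
      · exact Or.inr hyK
    have hdisj : Disjoint K.set (closure K.set)ᶜ := disjoint_left.2 fun y hy hy' =>
      hy' (subset_closure hy)
    exact hcon (hPc.subset_left_of_subset_union K.isOpen_set isClosed_closure.isOpen_compl hdisj
      hcov ⟨x, ⟨0, left_mem_Icc.2 ht.1.le, by simp⟩, hxs⟩ ⟨t, right_mem_Icc.2 ht.1.le, rfl⟩)
  obtain ⟨_, ⟨q, hq, rfl⟩, hqf⟩ := hPf
  have hq0 : 0 < q := by
    rcases hq.1.eq_or_lt with e | e
    · exfalso
      rw [← e] at hqf
      simp only [zero_smul, add_zero] at hqf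
      rw [frontier, K.isOpen_set.interior_eq] at hqf
      exact hqf.2 hxs
    · exact e
  have hq1 : q ∈ Ioo (0 : ℝ) 1 := ⟨hq0, hq.2.trans_lt ht.2⟩
  have hqd := hdist q hq1
  have e1 := abs_lt.1 ((K.abs_depth_sub_le s x (x + q • d)).trans_lt hqd)
  have e2 := abs_lt.1 ((K.abs_depth_sub_le s' x (x + q • d)).trans_lt hqd)
  rcases (h.mem_phase_iff _ hqf).1 (G.sub_subset_phase i (hdir x hxF q hq1)) with
    ⟨h1, h2⟩ | ⟨h1, h2⟩
  · exact hn2 ⟨by linarith, by linarith⟩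
  · exact hn1 ⟨by linarith, by linarith⟩

/-- The inverse trace inequality for an element with a corner. -/
theorem lintegral_frontier_le (h : K.IsCorner i A s s' Γ₁ Γ₂ b b' α β η κ) (hκ : 0 < κ)
    (hκ1 : κ ≤ 1) (hη0 : 0 ≤ η) {ηm : ℝ} (hη : η ≤ ηm) (hηm : ηm < 1) {ξ e : ℝ}
    (hξ : ξ = κ * (1 - ηm) / 8) (he : e = ξ * κ ^ 2) {a l : ℝ} (ha : 0 < a) (ha1 : a ≤ 1)
    {𝓒 : Set (Set Plane)} (h𝓒 : 𝓒.Finite) (hΓ𝓒 : G.Γ ⊆ ⋃₀ 𝓒) (hcone : ∀ F ∈ 𝓒, G.HasCone a l F)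
    {t₀ : ℝ} (ht₀ : 0 < t₀) (htl : t₀ * K.h ≤ l) (hte : 2 * t₀ ≤ e)
    {ε : ℝ} {𝓕 : Set (Set Plane)} (h𝓕 : 𝓕.Finite) (hΓ : G.Γ ⊆ ⋃₀ 𝓕)
    (hflat : ∀ F ∈ 𝓕, ∃ τ, IsFlat ε τ F) (hε0 : 0 ≤ ε) (hεe : ε ≤ e * κ ^ 2 / 8 / 24)
    (hεa : ε ≤ a / 16) {p : ℕ} (hp : 1 ≤ p) {v : Plane → ℝ} (hv : v ∈ Qp p) :
    ∫⁻ x in frontier (K.piece i), sqE v x ∂μH[1] ≤ (𝓕.ncard + 4 : ℕ) *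
      (ENNReal.ofReal ((2 * (convexConst (e * κ ^ 2 / 8) + 2 * convexConst (e / 2)) +
        𝓒.ncard * (400 / (a * t₀))) * p ^ 2 / K.h * T ((1 + 3 * η) / (1 - η)) ^ ((2 * p + 1) * 2)) *
        ∫⁻ x in K.piece i, sqE v x) := by
  have hh := K.h_pos
  have hη1 : η < 1 := hη.trans_lt hηm
  have hξ0 : 0 < ξ := by rw [hξ]; have : 0 < 1 - ηm := by linarith
                         positivity
  have hκsq : κ ^ 2 ≤ κ := by rw [sq]; exact mul_le_of_le_one_left hκ.le hκ1
  have hξκ : ξ ≤ κ / 8 := by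
    rw [hξ]
    have : κ * (1 - ηm) ≤ κ := mul_le_of_le_one_right hκ.le (by linarith)
    linarith
  have he0 : 0 < e := by rw [he]; positivity
  have heκ2 : e ≤ κ ^ 2 := by
    rw [he]; exact mul_le_of_le_one_left (sq_nonneg κ) (by linarith)
  have heκ : e ≤ κ / 2 := by
    rw [he]
    exact (mul_le_of_le_one_right hξ0.le (by linarith)).trans (by linarith)
  have hc1 := convexConst_pos (by positivity : 0 < e * κ ^ 2 / 8)
  have hc2 := convexConst_pos (by positivity : 0 < e / 2)
  set I := ∫⁻ x in K.piece i, sqE v x with hI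
  set Θ := T ((1 + 3 * η) / (1 - η)) ^ ((2 * p + 1) * 2) with hΘ
  have hΘ1 : 1 ≤ Θ := one_le_pow₀ (one_le_T (by rw [le_div_iff₀ (by linarith)]; linarith))
  set Ms := convexConst (e * κ ^ 2 / 8) + 2 * convexConst (e / 2) with hMs
  -- The data are universally quantified so that the second strip follows by `IsCorner.symm`. The
  -- threshold η = κ/2 separates the two strip estimates.
  have hstrip : ∀ {A : Plane} {s s' : Fin 2 × Bool} {Γ₁ Γ₂ : Set Plane} {b b' α β : ℝ},
      K.IsCorner i A s s' Γ₁ Γ₂ b b' α β η κ → ∀ S τ, IsFlat ε τ S →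
      S ⊆ {x ∈ frontier (K.piece i) | K.depth s' x < e * K.h ∧ K.depth s x < b' + e * K.h} →
      ∫⁻ x in S, sqE v x ∂μH[1] ≤ ENNReal.ofReal (Ms * p ^ 2 / K.h * Θ) * I := by
    intro A s s' Γ₁ Γ₂ b b' α β h S τ hτ hS
    by_cases hηκ : η ≤ κ / 2
    · refine (h.lintegral_strip_le_of_small hκ hκ1 hη0 hη1 he0 (by linarith) heκ2
        (fun x hx => ⟨(hS hx).1, (hS hx).2.1⟩) hτ hε0 hεe hp hv).trans ?_
      gcongr
      linarith
    · refine (h.lintegral_strip_le_of_large hκ hκ1 hη0 hη1 he0 (ξ := ξ) ?_ he.le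
        (fun x hx => ⟨?_, (hS hx).2⟩) hτ hε0 (hεe.trans ?_) hp hv).trans ?_
      -- Here ξ is used: 4ξ = (κ/2)(1-ηm), a lower bound for η(1-η) when κ/2 < η ≤ ηm.
      · have : κ / 2 * (1 - ηm) ≤ η * (1 - η) :=
          mul_le_mul (not_le.1 hηκ).le (by linarith) (by linarith) hη0
        rw [hξ]; linarith
      · exact closure_mono inter_subset_left (frontier_subset_closure (hS hx).1)
      · have : e * κ ^ 2 ≤ e := mul_le_of_le_one_right he0.le (hκsq.trans hκ1)
        linarith
      · gcongr
        linarith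
  have hsub : frontier (K.piece i) ⊆ G.Γ ∪ frontier K.set := fun x hx => by
    rcases K.frontier_piece_subset i hx with e | e
    exacts [Or.inl e.2, Or.inr e.1]
  refine lintegral_le_of_flat h𝓕 hΓ hflat hε0 hsub fun F τ hτ => ?_
  set S := frontier (K.piece i) ∩ F with hSdef
  set S₁ := {x ∈ S | K.depth s' x < e * K.h ∧ K.depth s x < b' + e * K.h} with hS₁
  set S₂ := {x ∈ S | K.depth s x < e * K.h ∧ K.depth s' x < b + e * K.h} with hS₂
  set S₃ := {x ∈ S | x ∈ closure K.set ∧ x ∈ G.Γ ∧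
    ¬(K.depth s' x < e * K.h ∧ K.depth s x < b' + e * K.h) ∧
    ¬(K.depth s x < e * K.h ∧ K.depth s' x < b + e * K.h)} with hS₃
  have heh : 0 < e * K.h := mul_pos he0 hh
  -- Boundary points of K in phase i lie on one of the two sides at A, hence in a strip, so the rest
  -- consists of interface points only.
  have hcover : S ⊆ S₁ ∪ S₂ ∪ S₃ := by
    intro x hx
    by_cases h1 : K.depth s' x < e * K.h ∧ K.depth s x < b' + e * K.h
    · exact Or.inl (Or.inl ⟨hx, h1⟩)
    by_cases h2 : K.depth s x < e * K.h ∧ K.depth s' x < b + e * K.h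
    · exact Or.inl (Or.inr ⟨hx, h2⟩)
    rcases K.frontier_piece_subset i hx.1 with ⟨h3, h4⟩ | ⟨h3, h4⟩
    · exact Or.inr ⟨hx, h3, h4, h1, h2⟩
    · rcases (h.mem_phase_iff x h3).1 h4 with ⟨h5, h6⟩ | ⟨h5, h6⟩
      · exact absurd ⟨by rw [h5]; exact heh, by linarith⟩ h2
      · exact absurd ⟨by rw [h5]; exact heh, by linarith⟩ h1
  have hb1 := hstrip h S₁ τ (hτ.mono le_rfl fun x hx => hx.1) fun x hx => ⟨hx.1.1, hx.2⟩
  have hb2 := hstrip h.symm S₂ τ (hτ.mono le_rfl fun x hx => hx.1) fun x hx => ⟨hx.1.1, hx.2⟩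
  have hb3 : ∫⁻ x in S₃, sqE v x ∂μH[1] ≤
      𝓒.ncard * (ENNReal.ofReal (400 / (a * t₀) * p ^ 2 / K.h * Θ) * I) := by
    refine lintegral_le_of_sUnion h𝓒 (fun x hx => hΓ𝓒 hx.2.2.1) fun F' hF' => ?_
    refine (h.lintegral_cone_le heh ha ha1 (hcone F' hF') (mul_pos ht₀ hh) htl ?_
      (fun x hx => ⟨hx.2, hx.1.2⟩) (hτ.mono le_rfl fun x hx => hx.1.1) hεa hp hv).trans ?_
    · rw [← mul_assoc]; exact mul_le_mul_of_nonneg_right hte hh.le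
    · refine mul_le_mul_left (ENNReal.ofReal_le_ofReal ?_) _
      calc 50 * (p : ℝ) ^ 2 / (a * (t₀ * K.h) / 8) = 400 / (a * t₀) * p ^ 2 / K.h * 1 := by
            field_simp; norm_num
        _ ≤ _ := by gcongr
  calc ∫⁻ x in S, sqE v x ∂μH[1] ≤ ∫⁻ x in S₁ ∪ S₂ ∪ S₃, sqE v x ∂μH[1] := lintegral_mono_set hcover
    _ ≤ (∫⁻ x in S₁ ∪ S₂, sqE v x ∂μH[1]) + ∫⁻ x in S₃, sqE v x ∂μH[1] := lintegral_union_le _ _ _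
    _ ≤ ((∫⁻ x in S₁, sqE v x ∂μH[1]) + ∫⁻ x in S₂, sqE v x ∂μH[1]) +
        ∫⁻ x in S₃, sqE v x ∂μH[1] := by gcongr; exact lintegral_union_le _ _ _
    _ ≤ (ENNReal.ofReal (Ms * p ^ 2 / K.h * Θ) * I + ENNReal.ofReal (Ms * p ^ 2 / K.h * Θ) * I) +
        𝓒.ncard * (ENNReal.ofReal (400 / (a * t₀) * p ^ 2 / K.h * Θ) * I) :=
        add_le_add (add_le_add hb1 hb2) hb3
    _ = _ := by
      rw [← add_mul, ← mul_assoc, ← add_mul, ← ENNReal.ofReal_add (by positivity) (by positivity),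
        ← ENNReal.ofReal_natCast, ← ENNReal.ofReal_mul (by positivity),
        ← ENNReal.ofReal_add (by positivity) (by positivity)]
      congr 2
      ring

end IsCorner

end CutElement

/-! ### Existence of the corner data for irregular elements -/

namespace Rect

variable (K : Rect)

theorem infDist_side_le {Q : Plane} (hQ : Q ∈ closure K.set) (s : Fin 2 × Bool) :
    Metric.infDist Q (K.side s) ≤ K.depth s Q := by
  have h0 := K.mem_closure_iff.1 hQ
  set F : Plane := Q + (-K.depth s Q) • normal s with hF
  have hFs : K.depth s F = 0 := by rw [hF, K.depth_add_normal]; ring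
  have hFm : F ∈ K.side s := by
    rw [K.mem_side_iff, K.mem_closure_iff]
    refine ⟨fun r => ?_, hFs⟩
    by_cases hr : r.1 = s.1
    · by_cases hrs : r = s
      · rw [hrs, hFs]
      · have := K.depth_add_depth hr hrs F
        linarith [K.width_pos s.1]
    · rw [hF, K.depth_add_normal_of_ne hr]; exact h0 r
  refine (Metric.infDist_le_dist_of_mem hFm).trans (le_of_eq ?_)
  rw [dist_comm, dist_eq_norm, hF, add_sub_cancel_left, norm_smul, norm_normal, mul_one,
    Real.norm_eq_abs, abs_neg, abs_of_nonneg (h0 s)]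

/-- The equation of a straight line in the coordinates of a vertex. -/
theorem exists_coeff {s s' : Fin 2 × Bool} (h : s'.1 ≠ s.1) {A : Plane} (hA : K.depth s A = 0)
    (hA' : K.depth s' A = 0) {P P' : Plane} (hL : lineForm P P' A ≠ 0) {B : Plane}
    (hB : lineForm P P' B = 0) (hBs : K.depth s B = 0) :
    ∃ β, ∀ y, lineForm P P' y =
      lineForm P P' A * (1 - (K.depth s' y / K.depth s' B + β * K.depth s y)) := by
  set L := lineForm P P' A with hLdef
  have hcoord : ∀ y, lineForm P P' y = L + K.depth s' y * cross (P' - P) (normal s') +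
      K.depth s y * cross (P' - P) (normal s) := by
    intro y
    set F : Plane := A + K.depth s' y • normal s' with hF
    have hy : y = F + (K.depth s y - K.depth s F) • normal s := by
      refine K.eq_add_normal h ?_
      rw [hF, K.depth_add_normal, hA', zero_add]
    have hFs : K.depth s F = 0 := by rw [hF, K.depth_add_normal_of_ne h.symm, hA]
    rw [hFs, sub_zero, hF] at hy
    conv_lhs => rw [hy]
    simp [hLdef, lineForm, cross]
    ring
  have hB1 := hcoord B
  rw [hB, hBs, zero_mul, add_zero] at hB1
  have hBne : K.depth s' B ≠ 0 := by
    intro e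
    rw [e, zero_mul, add_zero] at hB1
    exact hL hB1.symm
  refine ⟨-cross (P' - P) (normal s) / L, fun y => ?_⟩
  rw [hcoord y]
  have e : cross (P' - P) (normal s') = -L / K.depth s' B := by
    field_simp; linarith
  rw [e]
  field_simp
  ring

end Rect

namespace CutElement

variable {G : InterfaceGeometry} {K : CutElement G}

/-- Coordinates of an arc which is close to a chord from a side at the vertex to an inner point. -/
theorem exists_coeff_of_deviation {s s' : Fin 2 × Bool} (hne : s'.1 ≠ s.1) {A : Plane}
    (hA : K.depth s A = 0) (hA' : K.depth s' A = 0) {P P' B Q : Plane}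
    (hPP' : (P = B ∧ P' = Q) ∨ (P = Q ∧ P' = B)) (hBs : K.depth s B = 0) {κ η : ℝ} (hκ : 0 < κ)
    (hκ1 : κ ≤ 1) (hη0 : 0 ≤ η) (hBs' : κ * K.h ≤ K.depth s' B) (hQs : κ * K.h ≤ K.depth s Q)
    (hQs' : κ * K.h ≤ K.depth s' Q) (hAc : A ∈ closure K.set) (hBc : B ∈ closure K.set)
    (hQc : Q ∈ closure K.set) {t t' : ℝ} (ht : 0 ≤ t) (htt' : t < t') (ht' : t' ≤ 1)
    (htP : K.γ t = P) (htP' : K.γ t' = P') {i : Fin 2} (hAi : K.verticesIn i = {A})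
    (hdev : K.relDeviation i t t' ≤ η) :
    ∃ β, (∀ u ∈ Icc t t', |K.depth s' (K.γ u) / K.depth s' B + β * K.depth s (K.γ u) - 1| ≤ η) ∧
      (∀ u ∈ Icc t t', (κ - η) * K.h ≤ K.depth s' (K.γ u)) ∧ |β| * (κ ^ 2 * K.h) ≤ 1 := by
  have hh := K.h_pos
  have hκh : 0 < κ * K.h := mul_pos hκ hh
  have hBpos : 0 < K.depth s' B := hκh.trans_le hBs'
  have hQpos : 0 < K.depth s Q := hκh.trans_le hQs
  have hBQ : B ≠ Q := by
    rintro rfl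
    exact hQpos.ne' hBs
  have hline0 : lineForm P P' B = 0 ∧ lineForm P P' Q = 0 := by
    rcases hPP' with ⟨rfl, rfl⟩ | ⟨rfl, rfl⟩
    · exact ⟨lineForm_left _ _, lineForm_right _ _⟩
    · exact ⟨lineForm_right _ _, lineForm_left _ _⟩
  have hPne : P ≠ P' := by
    rcases hPP' with ⟨rfl, rfl⟩ | ⟨rfl, rfl⟩
    exacts [hBQ, hBQ.symm]
  have hL : lineForm P P' A ≠ 0 := by
    intro h0
    have h1 : lineForm B Q A = 0 := by
      rcases hPP' with ⟨rfl, rfl⟩ | ⟨rfl, rfl⟩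
      · exact h0
      · rw [lineForm_swap, h0, neg_zero]
    obtain ⟨q, hq⟩ := exists_of_lineForm_eq_zero hBQ h1
    have h2 := K.depth_combo s B Q (a := 1 - q) (b := q) (by ring)
    rw [← hq, hA, hBs, mul_zero, zero_add] at h2
    have h3 : q = 0 := by
      rcases mul_eq_zero.1 h2.symm with h | h
      · exact h
      · exact absurd h hQpos.ne'
    rw [h3] at hq
    simp at hq
    rw [hq] at hA'
    exact hBpos.ne' hA'
  obtain ⟨β, hβ⟩ := K.exists_coeff hne hA hA' hL hline0.1 hBs
  obtain ⟨A₁, hA₁, hAh, -⟩ := K.exists_height_eq (i := i) (by rw [hAi]; exact singleton_nonempty A) hPne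
  rw [hAi, mem_singleton_iff] at hA₁
  subst hA₁
  have hd : 0 < dist P P' := dist_pos.2 hPne
  have hLpos : 0 < |lineForm P P' A₁| := abs_pos.2 hL
  have hH : 0 < K.height i P P' := by
    by_contra hcon
    have := mul_nonpos_of_nonpos_of_nonneg (not_lt.1 hcon) hd.le
    linarith
  -- Since the height is at most h, the relative deviation bounds the distance from the chord by ηh.
  -- The chord has depth at least κh from s', hence the arc at least (κ-η)h.
  have hHh : K.height i P P' ≤ K.h := by
    rw [height, hAi, image_singleton, csSup_singleton]
    have hmem : P ∈ (affineSpan ℝ {P, P'} : Set Plane) := left_mem_affineSpan_pair ℝ P P'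
    refine (Metric.infDist_le_dist_of_mem hmem).trans (K.dist_le_h hAc ?_)
    rcases hPP' with ⟨rfl, rfl⟩ | ⟨rfl, rfl⟩
    exacts [hBc, hQc]
  have hseg : ∀ z ∈ segment ℝ P P', κ * K.h ≤ K.depth s' z := by
    have hcv := K.convex_preimage_depth s' (convex_Ici (κ * K.h))
    rcases hPP' with ⟨rfl, rfl⟩ | ⟨rfl, rfl⟩
    · exact fun z hz => hcv.segment_subset hBs' hQs' hz
    · exact fun z hz => hcv.segment_subset hQs' hBs' hz
  refine ⟨β, fun u hu => ?_, fun u hu => ?_, ?_⟩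
  · have h1 := K.abs_lineForm_le_of_relDeviation ht htt' ht' hη0 hdev (by rwa [htP, htP']) hu
    rw [htP, htP', hAh, hβ, abs_mul, mul_comm] at h1
    rw [abs_sub_comm]
    exact le_of_mul_le_mul_right h1 hLpos
  · have hend : ∀ z ∈ segment ℝ P P', (κ - η) * K.h ≤ K.depth s' z := fun z hz => by
      have := hseg z hz
      have := mul_nonneg hη0 hh.le
      linarith
    rcases hu.1.eq_or_lt with rfl | h0
    · rw [htP]; exact hend _ (left_mem_segment ℝ P P')
    rcases hu.2.eq_or_lt with rfl | h1
    · rw [htP']; exact hend _ (right_mem_segment ℝ P P')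
    have hne : (openSegment ℝ P P').Nonempty := ⟨_, midpoint_mem_openSegment P P'⟩
    have h2 : Metric.infDist (K.γ u) (openSegment ℝ P P') ≤ η * K.h := by
      have h3 := K.infDist_le_distH ht ht' hne ⟨h0, h1⟩
      rw [relDeviation, htP, htP', div_le_iff₀ hH] at hdev
      exact h3.trans (hdev.trans (mul_le_mul_of_nonneg_left hHh hη0))
    have h3 : κ * K.h - K.depth s' (K.γ u) ≤ Metric.infDist (K.γ u) (openSegment ℝ P P') := by
      refine (Metric.le_infDist hne).2 fun z hz => ?_
      have h4 := hseg z (openSegment_subset_segment ℝ P P' hz)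
      have h5 := (abs_le.1 (K.abs_depth_sub_le s' (K.γ u) z)).1
      linarith
    linarith
  · have h1 := hβ Q
    rw [hline0.2] at h1
    have h2 : β * K.depth s Q = 1 - K.depth s' Q / K.depth s' B := by
      rcases mul_eq_zero.1 h1.symm with h | h
      · exact absurd h hL
      · linarith
    have h3 : 0 ≤ K.depth s' Q / K.depth s' B := div_nonneg (hκh.le.trans hQs') hBpos.le
    have h4 : K.depth s' Q / K.depth s' B * κ ≤ 1 := by
      rw [div_mul_eq_mul_div, div_le_one hBpos]
      refine le_trans ?_ hBs'
      rw [mul_comm]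
      exact mul_le_mul_of_nonneg_left (K.depth_le_h s' hQc) hκ.le
    have h5 : |β * K.depth s Q| * κ ≤ 1 := by
      have h6 : |β * K.depth s Q| * κ = |(1 - K.depth s' Q / K.depth s' B) * κ| := by
        rw [h2, abs_mul (1 - _) κ, abs_of_pos hκ]
      have h7 := mul_nonneg h3 hκ.le
      rw [h6, abs_le, sub_mul]
      constructor <;> linarith
    calc |β| * (κ ^ 2 * K.h) = |β| * (κ * K.h) * κ := by ring
      _ ≤ |β| * K.depth s Q * κ := by gcongr
      _ = |β * K.depth s Q| * κ := by rw [abs_mul, abs_of_pos hQpos]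
      _ ≤ 1 := h5

/-- The constant of the corner of an irregular element. -/
def cornerConst (δ₀ σ : ℝ) : ℝ := δ₀ / (2 * (1 + σ))

/-- Each of the sides which carry an end point of the arc has a vertex in Ω_i. There is only one
such vertex, so the two sides are adjacent and meet at A. Largeness keeps the end points and the
singular point away from the sides on the scale h. -/
theorem exists_isCorner {δ₀ σ : ℝ} (hδ₀ : 0 < δ₀) (hδ₁ : δ₀ ≤ 1) (hσ : 1 ≤ σ)
    (hK : ∀ j, K.h ≤ (1 + σ) * K.width j) (hl : ∀ i, K.IsLarge δ₀ i) {i : Fin 2}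
    (hirr : K.Irregular i) {η : ℝ} (hη0 : 0 ≤ η) (hη : K.etaSide i ≤ η) :
    ∃ A s s' Γ₁ Γ₂ b b' α β, K.IsCorner i A s s' Γ₁ Γ₂ b b' α β η (cornerConst δ₀ σ) := by
  obtain ⟨s, s', ς, h⟩ := K.exists_isChord
  have hh := K.h_pos
  set κ := cornerConst δ₀ σ with hκdef
  have hκ : 0 < κ := by rw [hκdef, cornerConst]; positivity
  have hκ1 : κ ≤ 1 := by rw [hκdef, cornerConst, div_le_one (by linarith)]; linarith
  have hκw : ∀ j, κ * K.h ≤ δ₀ / 2 * K.width j := fun j => by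
    have e : κ * (1 + σ) = δ₀ / 2 := by
      rw [hκdef, cornerConst]
      have : 1 + σ ≠ 0 := by linarith
      field_simp
    calc κ * K.h ≤ κ * ((1 + σ) * K.width j) := mul_le_mul_of_nonneg_left (hK j) hκ.le
      _ = _ := by rw [← mul_assoc, e]
  have hκw2 : ∀ j, κ * K.h ≤ δ₀ * K.width j := fun j => by
    have := mul_pos hδ₀ (K.width_pos j)
    linarith [hκw j]
  -- the vertex
  obtain ⟨A, hAi⟩ := ncard_eq_one.1 hirr.1
  obtain ⟨A₁, hA₁, hAs, -⟩ := h.exists_vertex hδ₀.le hδ₁ hl i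
  obtain ⟨A₂, hA₂, hAs', -⟩ := h.symm.exists_vertex hδ₀.le hδ₁ hl i
  have hAmem : A ∈ K.verticesIn i := by rw [hAi]; exact mem_singleton A
  rw [hAi, mem_singleton_iff] at hA₁ hA₂
  rw [hA₁] at hAs
  rw [hA₂] at hAs'
  obtain ⟨hAv, hAp⟩ := K.mem_verticesIn_iff.1 hAmem
  have hAf := K.vertices_subset_frontier hAv
  have hAc := frontier_subset_closure hAf
  have hne : s'.1 ≠ s.1 := by
    intro e
    have := K.depth_add_depth e h.ne.symm A
    rw [hAs, hAs', add_zero] at this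
    exact (K.width_pos s.1).ne this
  -- the singular point
  obtain ⟨Q, hQsing, hQK⟩ := hirr.2
  have hQc := subset_closure hQK
  obtain ⟨t, ht, htQ⟩ : Q ∈ K.γ '' Icc 0 1 := by
    rw [K.image_γ]; exact ⟨hQsing.1, hQc⟩
  have hfr : ∀ y ∈ frontier K.set, y ∉ K.set := fun y hy hyK => by
    rw [frontier, K.isOpen_set.interior_eq] at hy
    exact hy.2 hyK
  have ht0 : 0 < t := by
    rcases ht.1.eq_or_lt with e | e
    · exfalso
      rw [← e] at htQ
      exact hfr _ (K.openSide_subset_frontier s h.left_mem) (htQ ▸ hQK)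
    · exact e
  have ht1 : t < 1 := by
    rcases ht.2.eq_or_lt with e | e
    · exfalso
      rw [e] at htQ
      exact hfr _ (K.openSide_subset_frontier s' h.right_mem) (htQ ▸ hQK)
    · exact e
  -- The set of singular parameters is a singleton, so its supremum in `etaSide` is the parameter of
  -- Q and not a default value.
  have hparam : K.singularParams = {t} := by
    ext u
    constructor
    · rintro ⟨hu, hus⟩
      have h1 := K.singular_subsingleton ⟨hus, K.mapsTo_γ hu⟩ ⟨hQsing, hQK⟩
      exact K.injOn_γ ⟨hu.1.le, hu.2.le⟩ ht (h1.trans htQ.symm)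
    · rintro rfl
      exact ⟨⟨ht0, ht1⟩, htQ ▸ hQsing⟩
  rw [etaSide, if_pos hirr, hparam, csSup_singleton] at hη
  have hη1 := (le_max_left _ _).trans hη
  have hη2 := (le_max_right _ _).trans hη
  have hQdepth : ∀ r, A ∈ K.side r → κ * K.h ≤ K.depth r Q := by
    intro r hr
    have h1 := (hl i).2 hirr A hAmem Q ⟨hQsing, hQK⟩ r hr
    refine le_trans ?_ (h1.trans (K.infDist_side_le hQc r))
    rcases min_choice (K.width 0) (K.width 1) with e | e <;> rw [e]
    · linarith [hκw 0]
    · linarith [hκw 1]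
  have hQs := hQdepth s (K.mem_side_iff.2 ⟨hAc, hAs⟩)
  have hQs' := hQdepth s' (K.mem_side_iff.2 ⟨hAc, hAs'⟩)
  -- the end points
  obtain ⟨hB0, -⟩ := K.mem_openSide_iff.1 h.left_mem
  obtain ⟨hB'0, -⟩ := K.mem_openSide_iff.1 h.right_mem
  have hBc := K.openSide_subset_closure s h.left_mem
  have hB'c := K.openSide_subset_closure s' h.right_mem
  have hb : κ * K.h ≤ K.depth s' (K.γ 0) :=
    (hκw2 _).trans (h.le_depth hδ₁ hl h.ne.symm)
  have hb' : κ * K.h ≤ K.depth s (K.γ 1) :=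
    (hκw2 _).trans (h.symm.le_depth hδ₁ hl h.ne)
  have hbpos : 0 < K.depth s' (K.γ 0) := (mul_pos hκ hh).trans_le hb
  have hb'pos : 0 < K.depth s (K.γ 1) := (mul_pos hκ hh).trans_le hb'
  have hopp : ∀ r : Fin 2 × Bool, ((r.1, !r.2) : Fin 2 × Bool) ≠ r := by decide
  have hbw : K.depth s' (K.γ 0) + κ * K.h ≤ K.width s'.1 := by
    have h1 := K.depth_add_depth (s := s') (s' := (s'.1, !s'.2)) rfl (hopp s') (K.γ 0)
    have h2 := h.le_depth hδ₁ hl (r := (s'.1, !s'.2)) (fun e => hne (by rw [← e]))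
    have h3 := hκw2 s'.1
    simp only at h2
    linarith
  have hb'w : K.depth s (K.γ 1) + κ * K.h ≤ K.width s.1 := by
    have h1 := K.depth_add_depth (s := s) (s' := (s.1, !s.2)) rfl (hopp s) (K.γ 1)
    have h2 := h.symm.le_depth hδ₁ hl (r := (s.1, !s.2)) (fun e => hne (by rw [← e]))
    have h3 := hκw2 s.1
    simp only at h2
    linarith
  -- the chord
  have hLς := (h.mem_phase_iff i A hAf).1 hAp
  have hL : lineForm (K.γ 0) (K.γ 1) A ≠ 0 := by
    intro e; rw [e, mul_zero] at hLς; exact lt_irrefl _ hLς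
  obtain ⟨ω, hω⟩ := K.exists_coeff hne hAs hAs' hL (lineForm_left _ _) hB0
  have hω' : ω * K.depth s (K.γ 1) = 1 := by
    have h1 := hω (K.γ 1)
    rw [lineForm_right, hB'0, zero_div, zero_add] at h1
    rcases mul_eq_zero.1 h1.symm with e | e
    · exact absurd e hL
    · linarith
  have hωpos : 0 < ω := by
    by_contra hcon
    have := mul_nonpos_of_nonpos_of_nonneg (not_lt.1 hcon) hb'pos.le
    linarith
  have hphase : ∀ y ∈ frontier K.set, y ∈ G.phase i ↔
      K.depth s' y / K.depth s' (K.γ 0) + ω * K.depth s y < 1 := by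
    intro y hy
    rw [h.mem_phase_iff i y hy, hω y, ← mul_assoc, mul_pos_iff_of_pos_left hLς, sub_pos]
  obtain ⟨β, hβ1, hβ2, hβ3⟩ := exists_coeff_of_deviation hne hAs hAs' (Or.inl ⟨rfl, rfl⟩) hB0 hκ hκ1
    hη0 hb hQs hQs' hAc hBc hQc le_rfl ht0 ht1.le rfl htQ hAi hη1
  obtain ⟨α, hα1, hα2, hα3⟩ := exists_coeff_of_deviation hne.symm hAs' hAs (Or.inr ⟨rfl, rfl⟩) hB'0
    hκ hκ1 hη0 hb' hQs' hQs hAc hB'c hQc ht0.le ht1 le_rfl htQ rfl hAi hη2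
  refine ⟨A, s, s', K.γ '' Icc 0 t, K.γ '' Icc t 1, K.depth s' (K.γ 0), K.depth s (K.γ 1), α, β,
    ?_⟩
  refine
    { ne := hne
      mem_phase := hAp
      depth_left := hAs
      depth_right := hAs'
      mem_phase_iff := fun y hy => ?_
      frontier_inter := fun y hy hyΓ => ?_
      mem_or_mem := fun y hy hyΓ => ?_
      abs_left_le := by rintro _ ⟨u, hu, rfl⟩; exact hβ1 u hu
      abs_right_le := by rintro _ ⟨u, hu, rfl⟩; exact hα1 u hu
      le_depth_left := by rintro _ ⟨u, hu, rfl⟩; exact hβ2 u hu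
      le_depth_right := by rintro _ ⟨u, hu, rfl⟩; exact hα2 u hu
      le_left := hb
      le_right := hb'
      left_le := hbw
      right_le := hb'w
      coeff_left := hβ3
      coeff_right := hα3 }
  · have hyd := (K.mem_frontier_iff.1 hy).1
    have hX : 0 ≤ K.depth s' y / K.depth s' (K.γ 0) := div_nonneg (hyd s') hbpos.le
    have hY : 0 ≤ ω * K.depth s y := mul_nonneg hωpos.le (hyd s)
    have hYlt : ω * K.depth s y < 1 ↔ K.depth s y < K.depth s (K.γ 1) := by
      have e := mul_lt_mul_iff_right₀ hωpos (b := K.depth s y) (c := K.depth s (K.γ 1))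
      rwa [hω'] at e
    rw [hphase y hy]
    constructor
    · intro hlt
      have h1 : K.depth s' y < K.depth s' (K.γ 0) := (div_lt_one hbpos).1 (by linarith)
      have h2 : K.depth s y < K.depth s (K.γ 1) := hYlt.1 (by linarith)
      have h3 : K.depth s y = 0 ∨ K.depth s' y = 0 := by
        by_contra hcon
        push Not at hcon
        refine hfr y hy (K.mem_set_of_depth hne ⟨lt_of_le_of_ne (hyd s) hcon.1.symm, ?_⟩
          ⟨lt_of_le_of_ne (hyd s') hcon.2.symm, ?_⟩)
        · linarith [mul_pos hκ hh]
        · linarith [mul_pos hκ hh]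
      rcases h3 with h3 | h3
      exacts [Or.inl ⟨h3, h1⟩, Or.inr ⟨h3, h2⟩]
    · rintro (⟨h1, h2⟩ | ⟨h1, h2⟩)
      · rw [h1, mul_zero, add_zero]; exact (div_lt_one hbpos).2 h2
      · rw [h1, zero_div, zero_add]; exact hYlt.2 h2
  · rcases h.eq_or_eq y hy hyΓ with rfl | rfl
    exacts [Or.inl ⟨hB0, rfl⟩, Or.inr ⟨hB'0, rfl⟩]
  · have : y ∈ K.γ '' Icc 0 1 := by rw [K.image_γ]; exact ⟨hyΓ, hy⟩
    obtain ⟨u, hu, rfl⟩ := this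
    rcases le_total u t with e | e
    exacts [Or.inl ⟨u, ⟨hu.1, e⟩, rfl⟩, Or.inr ⟨u, ⟨e, hu.2⟩, rfl⟩]

end CutElement

/-! ### Choice of the constants and conclusion -/

theorem eLpNorm_two_eq (v : Plane → ℝ) (μ : Measure Plane) :
    eLpNorm v 2 μ = (∫⁻ x, sqE v x ∂μ) ^ (1 / 2 : ℝ) := by
  rw [eLpNorm_eq_lintegral_rpow_enorm_toReal (by norm_num) (by norm_num)]
  simp only [ENNReal.toReal_ofNat]
  congr 1
  refine lintegral_congr fun x => ?_
  rw [sqE, ← sq_abs, ENNReal.ofReal_pow (abs_nonneg _), ← Real.norm_eq_abs, ofReal_norm]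
  norm_cast

theorem curveL2_le_of_sq {S D : Set Plane} {v : Plane → ℝ} {M : ℝ} (hM : 0 ≤ M)
    (h : ∫⁻ x in S, sqE v x ∂μH[1] ≤ ENNReal.ofReal (M ^ 2) * ∫⁻ x in D, sqE v x) :
    curveL2 S v ≤ ENNReal.ofReal M * areaL2 D v := by
  rw [curveL2, areaL2, eLpNorm_two_eq, eLpNorm_two_eq]
  refine (ENNReal.rpow_le_rpow h (by norm_num)).trans (le_of_eq ?_)
  rw [ENNReal.mul_rpow_of_nonneg _ _ (by norm_num), ENNReal.ofReal_rpow_of_nonneg (by positivity)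
    (by norm_num), ← Real.sqrt_eq_rpow, Real.sqrt_sq hM]

namespace CutElement

/-- The inverse trace inequality for the squares of the norms. -/
theorem exists_lintegral_frontier_le (G : InterfaceGeometry) {δ₀ σ ηm : ℝ} (hδ₀ : 0 < δ₀)
    (hδ₁ : δ₀ ≤ 1) (hσ : 1 ≤ σ) (hηm : ηm < 1) :
    ∃ C : ℝ, 0 < C ∧ ∀ K : CutElement G, K.ShapeRegular σ → (∀ i, K.IsLarge δ₀ i) → K.eta ≤ ηm →
      ∀ i : Fin 2, ∀ p : ℕ, 1 ≤ p → ∀ v ∈ Qp p,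
        ∫⁻ x in frontier (K.piece i), sqE v x ∂μH[1] ≤ ENNReal.ofReal (C * p ^ 2 / K.h *
          T ((1 + 3 * K.eta) / (1 - K.eta)) ^ ((2 * p + 1) * 2)) * ∫⁻ x in K.piece i, sqE v x := by
  obtain ⟨𝓒, a', ha', l, hl, h𝓒, hΓ𝓒, hcone'⟩ := G.exists_cone_cover
  set a := min a' 1 with ha
  have ha0 : 0 < a := lt_min ha' one_pos
  have hcone : ∀ F ∈ 𝓒, G.HasCone a l F := fun F hF => by
    obtain ⟨d, hd, hd'⟩ := hcone' F hF
    exact ⟨d, hd, fun x hx u hu => hd' x hx u (hu.trans (min_le_left _ _))⟩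
  by_cases hηm0 : ηm < 0
  · exact ⟨1, one_pos, fun K _ _ hK => absurd (K.eta_nonneg.trans hK) (not_le.2 hηm0)⟩
  have hηm0 := not_lt.1 hηm0
  set κ := cornerConst δ₀ σ with hκdef
  have hκ : 0 < κ := by rw [hκdef, cornerConst]; positivity
  have hκ1 : κ ≤ 1 := by rw [hκdef, cornerConst, div_le_one (by linarith)]; linarith
  set ξ := κ * (1 - ηm) / 8 with hξ
  have hξ0 : 0 < ξ := by
    have : 0 < 1 - ηm := by linarith
    positivity
  set e := ξ * κ ^ 2 with he
  have he0 : 0 < e := by positivity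
  set D := Metric.diam G.Ω with hD
  have hD0 : 0 ≤ D := Metric.diam_nonneg
  -- The cone length is scaled with h; dividing by the diameter of Ω ensures t₀h ≤ l for every
  -- element.
  set t₀ := min (l / (D + 1)) (e / 2) with ht₀
  have ht₀0 : 0 < t₀ := lt_min (by positivity) (by positivity)
  have hreg : 0 < regularConst δ₀ σ := by unfold regularConst; positivity
  -- The flatness tolerance, and with it the cover 𝓕, depends on δ₀, σ, ηm and the interface only
  -- and is fixed before K.
  set ε := min (regularConst δ₀ σ / 24) (min (e * κ ^ 2 / 8 / 24) (a / 16)) with hε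
  have hε0 : 0 < ε := lt_min (by positivity) (lt_min (by positivity) (by positivity))
  obtain ⟨𝓕, h𝓕, hΓ, hflat⟩ : FlatCover ε G.Γ := IsPiecewiseC2Curve.flatCover G.piecewiseC2 hε0
  set Cirr := 2 * (convexConst (e * κ ^ 2 / 8) + 2 * convexConst (e / 2)) +
    𝓒.ncard * (400 / (a * t₀)) with hCirr
  have hc1 := convexConst_pos hreg
  have hc2 := convexConst_pos (by positivity : 0 < e * κ ^ 2 / 8)
  have hc3 := convexConst_pos (by positivity : 0 < e / 2)
  have hCirr0 : 0 < Cirr := by positivity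
  refine ⟨(𝓕.ncard + 4 : ℕ) * (convexConst (regularConst δ₀ σ) + Cirr), by positivity, ?_⟩
  intro K hshape hlarge hη i p hp v hv
  have hh := K.h_pos
  have hη0 := K.eta_nonneg
  have hη1 : K.eta < 1 := hη.trans_lt hηm
  have hK : ∀ j, K.h ≤ (1 + σ) * K.width j := fun j => by
    have h1 := K.h_le
    have h2 := hshape 0 j
    have h3 := hshape 1 j
    fin_cases j
    · simp only [Fin.zero_eta] at *; linarith
    · simp only [Fin.mk_one] at *; linarith
  have hhD : K.h ≤ D := Metric.diam_mono K.subset_Ω G.isBounded_Ω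
  have hΘ : 1 ≤ T ((1 + 3 * K.eta) / (1 - K.eta)) :=
    one_le_T (by rw [le_div_iff₀ (by linarith)]; linarith)
  set Θ := T ((1 + 3 * K.eta) / (1 - K.eta)) ^ ((2 * p + 1) * 2) with hΘdef
  have hΘ0 : 0 < Θ := by positivity
  have hmul : ∀ x y : ℝ, 0 ≤ x → x ≤ y → ∀ I : ℝ≥0∞,
      (𝓕.ncard + 4 : ℕ) * (ENNReal.ofReal (x * p ^ 2 / K.h * Θ) * I) ≤
        ENNReal.ofReal ((𝓕.ncard + 4 : ℕ) * y * p ^ 2 / K.h * Θ) * I := by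
    intro x y hx hxy I
    rw [← mul_assoc, ← ENNReal.ofReal_natCast, ← ENNReal.ofReal_mul (by positivity)]
    refine mul_le_mul_left (ENNReal.ofReal_le_ofReal ?_) _
    calc ((𝓕.ncard + 4 : ℕ) : ℝ) * (x * p ^ 2 / K.h * Θ) =
          (𝓕.ncard + 4 : ℕ) * x * p ^ 2 / K.h * Θ := by ring
      _ ≤ _ := by gcongr
  by_cases hirr : K.Irregular i
  · obtain ⟨A, s, s', Γ₁, Γ₂, b, b', α, β, hcor⟩ := exists_isCorner hδ₀ hδ₁ hσ hK hlarge hirr hη0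
      (K.etaSide_le_eta i)
    refine (hcor.lintegral_frontier_le hκ hκ1 hη0 hη hηm hξ he ha0 (min_le_right _ _) h𝓒 hΓ𝓒 hcone
      ht₀0 ?_ ?_ h𝓕 hΓ hflat hε0.le ((min_le_right _ _).trans (min_le_left _ _))
      ((min_le_right _ _).trans (min_le_right _ _)) hp hv).trans (hmul _ _ hCirr0.le
        (by linarith) _)
    · calc t₀ * K.h ≤ l / (D + 1) * (D + 1) :=
            mul_le_mul (min_le_left _ _) (by linarith) hh.le (by positivity)
        _ = l := by field_simp
    · linarith [min_le_right (l / (D + 1)) (e / 2)]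
  · have hdev : K.relDeviation i 0 1 ≤ K.eta := by
      have := K.etaSide_le_eta i
      rwa [etaSide, if_neg hirr] at this
    exact (lintegral_frontier_le_of_regular hδ₀ hδ₁ hσ hK hlarge hη0 hη1 hdev h𝓕 hΓ hflat hε0.le
      (min_le_left _ _) hp hv).trans (hmul _ _ hc1.le (by linarith) _)

end CutElement

end CutFEM

end

theorem lemma2p7 (G : CutFEM.InterfaceGeometry) (δ₀ σ : ℝ) (hδ₀ : 0 < δ₀) (hδ₀' : δ₀ < 1 / 2) :
    ∃ C : ℝ, 0 < C ∧
      ∀ K : CutFEM.CutElement G, K.ShapeRegular σ → K.ResolvesInterface δ₀ →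
        ∀ i : Fin 2, ∀ p : ℕ, 1 ≤ p → ∀ v ∈ CutFEM.Qp p,
          CutFEM.curveL2 (frontier (K.piece i)) v ≤
            ENNReal.ofReal (C * p * K.h ^ (-(1 / 2) : ℝ) *
              CutFEM.T ((1 + 3 * K.eta) / (1 - K.eta)) ^ (2 * p)) *
            CutFEM.areaL2 (K.piece i) v := by
  set ηm := max (1 / 2) ((1 - δ₀) / (1 + δ₀)) with hηm
  have hηm0 : 0 ≤ ηm := le_trans (by norm_num) (le_max_left _ _)
  have hηm1 : ηm < 1 := max_lt (by norm_num) (by rw [div_lt_one (by linarith)]; linarith)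
  -- Replacing σ by max σ 1 weakens shape regularity and provides σ ≥ 1.
  obtain ⟨C, hC, hbound⟩ := CutFEM.CutElement.exists_lintegral_frontier_le G hδ₀ (by linarith)
    (le_max_right σ 1) hηm1
  have harg : ∀ η : ℝ, 0 ≤ η → η < 1 → 1 ≤ (1 + 3 * η) / (1 - η) := fun η h0 h1 => by
    rw [le_div_iff₀ (by linarith)]; linarith
  set Tm := CutFEM.T ((1 + 3 * ηm) / (1 - ηm)) with hTm
  have hTm1 : 1 ≤ Tm := CutFEM.one_le_T (harg _ hηm0 hηm1)
  -- The squared estimate has exponent 4p+2 instead of 4p; the surplus t² is at most Tm², since η ≤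
  -- ηm < 1.
  refine ⟨Real.sqrt C * Tm, by positivity, fun K hσ hK i p hp v hv => ?_⟩
  have hh := K.h_pos
  have hη0 := K.eta_nonneg
  have hη : K.eta ≤ ηm := hK.eta_le
  have hη1 : K.eta < 1 := hη.trans_lt hηm1
  have hshape : K.ShapeRegular (max σ 1) := fun j k =>
    (hσ j k).trans (mul_le_mul_of_nonneg_right (le_max_left _ _) (K.width_pos k).le)
  have hT1 := CutFEM.one_le_T (harg _ hη0 hη1)
  set t := CutFEM.T ((1 + 3 * K.eta) / (1 - K.eta)) with ht
  have htm : t ≤ Tm := CutFEM.T_mono (harg _ hη0 hη1) (by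
    rw [div_le_div_iff₀ (by linarith) (by linarith)]; nlinarith)
  refine CutFEM.curveL2_le_of_sq (by positivity) ((hbound K hshape hK.large hη i p hp v hv).trans ?_)
  refine mul_le_mul_left (ENNReal.ofReal_le_ofReal ?_) _
  have e1 : (K.h ^ (-(1 / 2) : ℝ)) ^ 2 = 1 / K.h := by
    rw [← Real.rpow_natCast, ← Real.rpow_mul hh.le]
    norm_num
    rw [Real.rpow_neg_one]
  calc C * (p : ℝ) ^ 2 / K.h * t ^ ((2 * p + 1) * 2)
      = C * p ^ 2 / K.h * (t ^ 2 * (t ^ (2 * p)) ^ 2) := by ring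
    _ ≤ C * p ^ 2 / K.h * (Tm ^ 2 * (t ^ (2 * p)) ^ 2) := by gcongr
    _ = (Real.sqrt C * Tm * p * K.h ^ (-(1 / 2) : ℝ) * t ^ (2 * p)) ^ 2 := by
      rw [mul_pow, mul_pow, mul_pow, mul_pow, e1, Real.sq_sqrt hC.le]
      ring
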